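/- All objects are real and of class $C^\infty$, and the result is local. A planar 4-web on an open set $U\subseteq\mathbb R^2$ is given by smooth 1-forms $\omega_1,\dots,\omega_4$ on $U$ that are pairwise linearly independent at every point; its $i$-th foliation is $\omega_i=0$. The rank of the web at $p\in U$ is the dimension of the real vector space of germs at $p$ of smooth functions $(\lambda_1,\dots,\lambda_4)$ with $\lambda_1\omega_1+\dots+\lambda_4\omega_4=0$ and $d(\lambda_i\omega_i)=0$ for all $i$; the maximum rank of a planar 4-web is three. The web is linearizable at $p$ if a smooth diffeomorphism of a neighbourhood of $p$ onto an open subset of the plane takes it to a web whose leaves are pieces of straight lines. For a 3-subweb $[i,j,k]$ choose multiples $\eta,\eta',\eta''$ of $\omega_i,\omega_j,\omega_k$ by non-vanishing smooth functions with $\eta+\eta'+\eta''=0$, and let $\gamma_{ijk}$ be the unique 1-form with $d\eta=\eta\wedge\gamma_{ijk}$, $d\eta'=\eta'\wedge\gamma_{ijk}$, $d\eta''=\eta''\wedge\gamma_{ijk}$. The curvature form $d\gamma_{ijk}$ does not depend on the choice. The curvature form of the 4-web is $$\Omega=\tfrac14\left(d\gamma_{123}+d\gamma_{124}+d\gamma_{134}+d\gamma_{234}\right).$$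 **Theorem.** (a) For every planar 4-web on $U$ and every $p\in U$: the web has the maximum rank three at $p$ if and only if it is linearizable at $p$ and its curvature $\Omega$ vanishes in a neighbourhood of $p$. (b) Suppose that on an open set $V\subseteq U$ smooth forms $\eta_i$, which at every point of $V$ are non-zero multiples of the $\omega_i$, are normalized by $\eta_1+\eta_2+\eta_3=0$ and $a\eta_1+\eta_2+\eta_4=0$, where $a$ is a function (the basic invariant). Define the curvature function $K_{ijk}$ of each 3-subweb by $d\gamma_{ijk}=K_{ijk}\,\eta_1\wedge\eta_2$. Then on $V$ the curvature function of the 4-web, i.e. the arithmetic mean $\tfrac14(K_{123}+K_{124}+K_{134}+K_{234})$, equals $$c_0=K+\frac{a_{11}-a\,a_{22}-2(1-a)a_{12}}{4a(1-a)}+\frac{(-1+2a)a_1^2-a^2a_2^2+2(1-a)^2a_1a_2}{4(1-a)^2a^2}.$$ Here $K=K_{123}$; $\gamma=g_1\eta_1+g_2\eta_2$ is the form with $d\eta_i=\eta_i\wedge\gamma$ for $i=1,2,3$; $\partial_1,\partial_2$ is the frame dual to $\eta_1,\eta_2$; $a_i=\partial_i a$, and $a_{ij}=\partial_j a_i-g_j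 a_i$ (with $a_{12}=a_{21}$). -/

import Mathlib

open scoped ContDiff Topology

noncomputable section

namespace PlanarWeb

/-- The plane with its standard coordinates. -/
abbrev Plane := ℝ × ℝ

/-- (Not necessarily smooth) differential `1`-forms on the plane. -/
abbrev OneForm := Plane → Plane →L[ℝ] ℝ

/-- The coefficient of `α ∧ β` with respect to `dx ∧ dy`. -/
def wedge (α β : OneForm) (x : Plane) : ℝ :=
  α x (1, 0) * β x (0, 1) - α x (0, 1) * β x (1, 0)

/-- The coefficient of the exterior derivative `dα` with respect to `dx ∧ dy`. -/
def extD (α : OneForm) (x : Plane) : ℝ :=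
  extDeriv (fun y => ContinuousAlternatingMap.ofSubsingleton ℝ Plane ℝ (0 : Fin 1) (α y)) x
    ![(1, 0), (0, 1)]

theorem extD_eq {α : OneForm} {x : Plane} (h : DifferentiableAt ℝ α x) :
    extD α x = fderiv ℝ α x (1, 0) (0, 1) - fderiv ℝ α x (0, 1) (1, 0) := by
  have hL : HasFDerivAt
      (fun y => ContinuousAlternatingMap.ofSubsingleton ℝ Plane ℝ (0 : Fin 1) (α y))
      ((ContinuousAlternatingMap.ofSubsingletonLIE (𝕜 := ℝ) (E := Plane) (F := ℝ)
        (0 : Fin 1)).toContinuousLinearEquiv.toContinuousLinearMap ∘L fderiv ℝ α x) x :=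
    ((ContinuousAlternatingMap.ofSubsingletonLIE (𝕜 := ℝ) (E := Plane) (F := ℝ)
      (0 : Fin 1)).toContinuousLinearEquiv.toContinuousLinearMap.hasFDerivAt).comp x h.hasFDerivAt
  have hs : ∀ v : Plane, ∀ w : Fin 1 → Plane,
      fderiv ℝ (fun y => ContinuousAlternatingMap.ofSubsingleton ℝ Plane ℝ (0 : Fin 1) (α y)) x v w
        = fderiv ℝ α x v (w 0) := by
    intro v w
    rw [hL.fderiv]
    rfl
  rw [extD, extDeriv, ContinuousAlternatingMap.alternatizeUncurryFin_apply, Fin.sum_univ_two, hs, hs]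
  simp [Fin.removeNth]
  ring

/-- Multiplication of a `1`-form by a function. -/
def mulForm (u : Plane → ℝ) (α : OneForm) : OneForm := fun x => u x • α x

/-- For a `3`-web `η₁, η₂, η₃` normalized by `η₁ + η₂ + η₃ = 0`, the connection form
`γ = g₁ η₁ + g₂ η₂` determined by the structure equations `dηᵢ = ηᵢ ∧ γ`, `i = 1, 2, 3`. -/
def chernForm (η₁ η₂ : OneForm) : OneForm := fun x =>
  (-(extD η₂ x) / wedge η₁ η₂ x) • η₁ x + (extD η₁ x / wedge η₁ η₂ x) • η₂ x

/-- The structure equations hold for `chernForm`. -/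
theorem structure_equations {η₁ η₂ η₃ : OneForm} {x : Plane}
    (h₁ : DifferentiableAt ℝ η₁ x) (h₂ : DifferentiableAt ℝ η₂ x)
    (hsum : ∀ y, η₁ y + η₂ y + η₃ y = 0) (hw : wedge η₁ η₂ x ≠ 0) :
    extD η₁ x = wedge η₁ (chernForm η₁ η₂) x ∧
    extD η₂ x = wedge η₂ (chernForm η₁ η₂) x ∧
    extD η₃ x = wedge η₃ (chernForm η₁ η₂) x := by
  have h : η₃ = fun y => -(η₁ y + η₂ y) := by
    funext y
    exact eq_neg_of_add_eq_zero_right (hsum y)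
  have h₃ : extD η₃ x = -(extD η₁ x + extD η₂ x) := by
    have hd : HasFDerivAt η₃ (-(fderiv ℝ η₁ x + fderiv ℝ η₂ x)) x := by
      rw [h]
      exact (h₁.hasFDerivAt.add h₂.hasFDerivAt).neg
    rw [extD_eq hd.differentiableAt, extD_eq h₁, extD_eq h₂, hd.fderiv]
    simp
    ring
  have hw' := hw
  rw [wedge] at hw'
  have e₁ : extD η₁ x = wedge η₁ (chernForm η₁ η₂) x := by
    have hr := inv_mul_cancel₀ hw'
    simp only [chernForm, wedge, add_apply, smul_apply, smul_eq_mul, div_eq_mul_inv]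
    linear_combination (-extD η₁ x) * hr
  have e₂ : extD η₂ x = wedge η₂ (chernForm η₁ η₂) x := by
    have hr := inv_mul_cancel₀ hw'
    simp only [chernForm, wedge, add_apply, smul_apply, smul_eq_mul, div_eq_mul_inv]
    linear_combination (-extD η₂ x) * hr
  refine ⟨e₁, e₂, ?_⟩
  rw [h₃, e₁, e₂, h]
  simp [wedge]
  ring

/-- The structure equations determine `chernForm`. -/
theorem chernForm_unique {η₁ η₂ γ : OneForm} {x : Plane} (hw : wedge η₁ η₂ x ≠ 0)
    (h₁ : extD η₁ x = wedge η₁ γ x) (h₂ : extD η₂ x = wedge η₂ γ x) :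
    γ x = chernForm η₁ η₂ x := by
  have hw' := hw
  rw [wedge] at hw'
  refine ContinuousLinearMap.ext fun v => ?_
  have hv : v = v.1 • ((1, 0) : Plane) + v.2 • ((0, 1) : Plane) := by
    ext <;> simp
  rw [hv, map_add, map_add, map_smul, map_smul, map_smul, map_smul]
  have hr := inv_mul_cancel₀ hw'
  simp only [chernForm, h₁, h₂, wedge, smul_eq_mul, add_apply, smul_apply, div_eq_mul_inv]
  linear_combination (-(v.1 * γ x (1, 0) + v.2 * γ x (0, 1))) * hr

/-- The curvature form `dγ` of the `3`-web given by the `1`-forms `α, β, γ`, as a coefficient with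
respect to `dx ∧ dy`. The web is normalized by means of
`(β ∧ γ) α + (γ ∧ α) β + (α ∧ β) γ = 0`; the form `dγ` does not depend on the normalization. -/
def curvatureForm₃ (α β γ : OneForm) (x : Plane) : ℝ :=
  extD (chernForm (mulForm (wedge β γ) α) (mulForm (wedge γ α) β)) x

theorem normalization_identity (α β γ : OneForm) (x : Plane) :
    mulForm (wedge β γ) α x + mulForm (wedge γ α) β x + mulForm (wedge α β) γ x = 0 := by
  refine ContinuousLinearMap.ext fun v => ?_
  have hv : v = v.1 • ((1, 0) : Plane) + v.2 • ((0, 1) : Plane) := by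
    ext <;> simp
  rw [hv, map_add, map_smul, map_smul]
  simp only [mulForm, wedge, smul_eq_mul, zero_apply,
    add_apply, smul_apply]
  ring

end PlanarWeb

open PlanarWeb

/-- A planar `4`-web on an open subset `U` of the plane: four foliations in general position, given
by smooth `1`-forms `form i` (the `i`-th foliation is `form i = 0`) that are pairwise linearly independent
at every point of `U`. -/
structure FourWeb where
  U : Set Plane
  isOpen_U : IsOpen U
  form : Fin 4 → OneForm
  smooth : ∀ i, ContDiffOn ℝ ∞ (form i) U
  generalPosition : ∀ i j, i ≠ j → ∀ x ∈ U, wedge (form i) (form j) x ≠ 0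

namespace FourWeb

variable (W : FourWeb)

/-- The abelian equation at the point `x`, for functions `l` that are smooth at `x`:
`∑ i, lᵢ ωᵢ = 0` and `d(lᵢ ωᵢ) = 0` for all `i`. -/
def AbelianEqAt (l : Plane → Fin 4 → ℝ) (x : Plane) : Prop :=
  ContDiffAt ℝ ∞ l x ∧ ∑ i, l x i • W.form i x = 0 ∧
    ∀ i, extD (mulForm (fun y => l y i) (W.form i)) x = 0

theorem abelianEqAt_add {x : Plane} (hx : x ∈ W.U) {l m : Plane → Fin 4 → ℝ}
    (hl : W.AbelianEqAt l x) (hm : W.AbelianEqAt m x) : W.AbelianEqAt (l + m) x := by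
  refine ⟨hl.1.add hm.1, ?_, fun i => ?_⟩
  · have := congrArg₂ (· + ·) hl.2.1 hm.2.1
    simpa [add_smul, Finset.sum_add_distrib] using this
  · have hω : DifferentiableAt ℝ (W.form i) x :=
      ((W.smooth i).contDiffAt (W.isOpen_U.mem_nhds hx)).differentiableAt (by simp)
    have dl : DifferentiableAt ℝ (mulForm (fun y => l y i) (W.form i)) x :=
      (differentiableAt_pi.1 (hl.1.differentiableAt (by simp)) i).smul hω
    have dm : DifferentiableAt ℝ (mulForm (fun y => m y i) (W.form i)) x :=
      (differentiableAt_pi.1 (hm.1.differentiableAt (by simp)) i).smul hω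
    have e : mulForm (fun y => (l + m) y i) (W.form i) =
        mulForm (fun y => l y i) (W.form i) + mulForm (fun y => m y i) (W.form i) := by
      funext y
      simp [mulForm, add_smul]
    have h₁ := hl.2.2 i
    have h₂ := hm.2.2 i
    rw [extD_eq dl] at h₁
    rw [extD_eq dm] at h₂
    rw [e, extD_eq (dl.add dm), fderiv_add dl dm]
    simp only [add_apply]
    linarith

theorem abelianEqAt_smul {x : Plane} (hx : x ∈ W.U) (c : ℝ) {l : Plane → Fin 4 → ℝ}
    (hl : W.AbelianEqAt l x) : W.AbelianEqAt (c • l) x := by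
  refine ⟨hl.1.const_smul c, ?_, fun i => ?_⟩
  · have := congrArg (c • ·) hl.2.1
    simpa [mul_smul, Finset.smul_sum] using this
  · have hω : DifferentiableAt ℝ (W.form i) x :=
      ((W.smooth i).contDiffAt (W.isOpen_U.mem_nhds hx)).differentiableAt (by simp)
    have dl : DifferentiableAt ℝ (mulForm (fun y => l y i) (W.form i)) x :=
      (differentiableAt_pi.1 (hl.1.differentiableAt (by simp)) i).smul hω
    have e : mulForm (fun y => (c • l) y i) (W.form i) = c • mulForm (fun y => l y i) (W.form i) := by
      funext y
      simp [mulForm, mul_smul]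
    have h₁ := hl.2.2 i
    rw [extD_eq dl] at h₁
    rw [e, extD_eq (dl.const_smul c), fderiv_const_smul dl]
    simp only [smul_apply, smul_eq_mul]
    linear_combination c * h₁

theorem abelianEqAt_zero (x : Plane) : W.AbelianEqAt 0 x := by
  refine ⟨contDiffAt_const, by simp, fun i => ?_⟩
  have e : mulForm (fun y => (0 : Plane → Fin 4 → ℝ) y i) (W.form i) = fun _ => 0 := by
    funext y
    simp [mulForm]
  rw [e, extD_eq (differentiableAt_const _)]
  simp

/-- The vector space of germs at `p` of smooth solutions of the abelian equation. -/
def abelianGerms (p : Plane) (hp : p ∈ W.U) :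
    Submodule ℝ (Filter.Germ (𝓝 p) (Fin 4 → ℝ)) where
  carrier := {g | ∃ l : Plane → Fin 4 → ℝ, g = (l : Filter.Germ (𝓝 p) (Fin 4 → ℝ)) ∧
    ∀ᶠ x in 𝓝 p, W.AbelianEqAt l x}
  zero_mem' := ⟨0, rfl, Filter.Eventually.of_forall W.abelianEqAt_zero⟩
  add_mem' := by
    rintro _ _ ⟨l, rfl, hl⟩ ⟨m, rfl, hm⟩
    refine ⟨l + m, rfl, ?_⟩
    filter_upwards [hl, hm, W.isOpen_U.mem_nhds hp] with x h₁ h₂ hx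
    exact W.abelianEqAt_add hx h₁ h₂
  smul_mem' := by
    rintro c _ ⟨l, rfl, hl⟩
    refine ⟨c • l, rfl, ?_⟩
    filter_upwards [hl, W.isOpen_U.mem_nhds hp] with x h₁ hx
    exact W.abelianEqAt_smul hx c h₁

/-- The rank of the web at `p`: the dimension of the space of its abelian relations near `p`. -/
def rank (p : Plane) (hp : p ∈ W.U) : ℕ := Module.finrank ℝ (W.abelianGerms p hp)

/-- The leaves are (pieces of) straight lines: a segment in `U` that starts at `q` in the direction
of the `i`-th leaf through `q` is tangent to the `i`-th foliation along its whole length (as `v` may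
be scaled, it is enough to say this of the endpoint `q + v`). -/
def IsLinear : Prop :=
  ∀ i, ∀ q ∈ W.U, ∀ v : Plane, W.form i q v = 0 →
    segment ℝ q (q + v) ⊆ W.U → W.form i (q + v) v = 0

/-- Some smooth diffeomorphism of an open neighbourhood of `p` onto an open set takes the
foliations of `W` to those of `W'`. -/
def IsEquivalentAt (W' : FourWeb) (p : Plane) : Prop :=
  ∃ φ : OpenPartialHomeomorph Plane Plane,
    p ∈ φ.source ∧ φ.source ⊆ W.U ∧ φ.target ⊆ W'.U ∧
    ContDiffOn ℝ ∞ φ φ.source ∧ ContDiffOn ℝ ∞ φ.symm φ.target ∧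
    ∀ i, ∀ x ∈ φ.source, ∀ v : Plane, W.form i x v = 0 ↔ W'.form i (φ x) (fderiv ℝ φ x v) = 0

/-- Near `p` the web is equivalent to a web with straight leaves. -/
def IsLinearizableAt (p : Plane) : Prop :=
  ∃ W' : FourWeb, W'.IsLinear ∧ W.IsEquivalentAt W' p

/-- The curvature form of the web, i.e. the arithmetic mean of the curvature forms of its
`3`-subwebs, as a coefficient with respect to `dx ∧ dy`. -/
def curvatureForm (x : Plane) : ℝ :=
  (curvatureForm₃ (W.form 0) (W.form 1) (W.form 2) x + curvatureForm₃ (W.form 0) (W.form 1) (W.form 3) x +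
    curvatureForm₃ (W.form 0) (W.form 2) (W.form 3) x + curvatureForm₃ (W.form 1) (W.form 2) (W.form 3) x) / 4

/-- Smooth `1`-forms `η i` on `V`, proportional to the `form i`, with
`η₁ + η₂ + η₃ = 0` and `a η₁ + η₂ + η₄ = 0`; the function `a` is the basic invariant. -/
structure IsNormalization (V : Set Plane) (η : Fin 4 → OneForm) (a : Plane → ℝ) : Prop where
  isOpen : IsOpen V
  subset : V ⊆ W.U
  smooth : ∀ i, ContDiffOn ℝ ∞ (η i) V
  proportional : ∀ i, ∀ x ∈ V, ∃ m : ℝ, m ≠ 0 ∧ η i x = m • W.form i x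
  sum₁₂₃ : ∀ x ∈ V, η 0 x + η 1 x + η 2 x = 0
  sum₁₂₄ : ∀ x ∈ V, a x • η 0 x + η 1 x + η 3 x = 0

/-- The curvature function `K` of the `3`-subweb `[i, j, k]`, given by `dγ = K η₁ ∧ η₂`, where `γ` is
the connection form of that subweb. -/
def curvatureFunction₃ (η : Fin 4 → OneForm) (i j k : Fin 4) (x : Plane) : ℝ :=
  curvatureForm₃ (W.form i) (W.form j) (W.form k) x / wedge (η 0) (η 1) x

/-- The curvature function of the web: the arithmetic mean of those of its `3`-subwebs. -/
def curvatureFunction (η : Fin 4 → OneForm) (x : Plane) : ℝ :=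
  (W.curvatureFunction₃ η 0 1 2 x + W.curvatureFunction₃ η 0 1 3 x +
    W.curvatureFunction₃ η 0 2 3 x + W.curvatureFunction₃ η 1 2 3 x) / 4

end FourWeb

namespace PlanarWeb

/-- The vector field `∂₁` of the frame dual to `η₁, η₂`. -/
def dual₁ (η₁ η₂ : OneForm) (x : Plane) : Plane :=
  (wedge η₁ η₂ x)⁻¹ • (η₂ x (0, 1), -η₂ x (1, 0))

/-- The vector field `∂₂` of the frame dual to `η₁, η₂`. -/
def dual₂ (η₁ η₂ : OneForm) (x : Plane) : Plane :=
  (wedge η₁ η₂ x)⁻¹ • (-η₁ x (0, 1), η₁ x (1, 0))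

/-- The covariant derivative `δ₁(u) = ∂₁(u) - k g₁ u` of a function `u` of weight `k`, where
`g₁ = γ(∂₁)`. -/
def cov₁ (η₁ η₂ : OneForm) (k : ℝ) (u : Plane → ℝ) (x : Plane) : ℝ :=
  fderiv ℝ u x (dual₁ η₁ η₂ x) - k * chernForm η₁ η₂ x (dual₁ η₁ η₂ x) * u x

/-- The covariant derivative `δ₂(u) = ∂₂(u) - k g₂ u` of a function `u` of weight `k`, where
`g₂ = γ(∂₂)`. -/
def cov₂ (η₁ η₂ : OneForm) (k : ℝ) (u : Plane → ℝ) (x : Plane) : ℝ :=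
  fderiv ℝ u x (dual₂ η₁ η₂ x) - k * chernForm η₁ η₂ x (dual₂ η₁ η₂ x) * u x

/-- The curvature function `K` of the normalized `3`-web `η₁, η₂, -η₁-η₂`: `dγ = K η₁ ∧ η₂`. -/
def curvatureK (η₁ η₂ : OneForm) (x : Plane) : ℝ :=
  extD (chernForm η₁ η₂) x / wedge η₁ η₂ x

/-- The invariant `c₀`, in terms of `K` and of the covariant derivatives of the basic invariant `a`
(which has weight `0`, its first covariant derivatives having weight `1`). -/
def c₀ (η₁ η₂ : OneForm) (a : Plane → ℝ) (x : Plane) : ℝ :=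
  let K := curvatureK η₁ η₂ x
  let A := a x
  let a₁ := cov₁ η₁ η₂ 0 a x
  let a₂ := cov₂ η₁ η₂ 0 a x
  let a₁₁ := cov₁ η₁ η₂ 1 (cov₁ η₁ η₂ 0 a) x
  let a₁₂ := cov₂ η₁ η₂ 1 (cov₁ η₁ η₂ 0 a) x
  let a₂₂ := cov₂ η₁ η₂ 1 (cov₂ η₁ η₂ 0 a) x
  K + (a₁₁ - A * a₂₂ - 2 * (1 - A) * a₁₂) / (4 * A * (1 - A))
    + ((-1 + 2 * A) * a₁ ^ 2 - A ^ 2 * a₂ ^ 2 + 2 * (1 - A) ^ 2 * a₁ * a₂)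
      / (4 * (1 - A) ^ 2 * A ^ 2)

end PlanarWeb

end

/-! (a) A linear change of coordinates turns the foliations into dy = sᵢ dx (`exists_slopes`). Put
mₖ = Σ λᵢ sᵢᵏ. The equation Σ λᵢ ωᵢ = 0 says m₀ = m₁ = 0, so by Lagrange interpolation λ is
recovered from f = m₂ and g = m₃. Closedness of λᵢ ωᵢ is the conservation law ∂ₓλᵢ + ∂_y(sᵢ λᵢ) = 0,
and multiplying it by powers of sᵢ gives three first-order equations for f and g
(`moment_transport`). One prolongation closes the system in (f, g, fₓ)
(`eventually_eq_zero_of_moment_system`). Hence the rank is at most three, with equality exactly when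
every value of (f, g, fₓ) at p is attained (`rank_eq_three_iff`).

Rank three forces linearizability. Three relations λ⁰, λ¹, λ² take their values at each point in a
two-dimensional space, so X λ⁰ + Y λ¹ + λ² = 0 for some functions X, Y. The multiples λᵏᵢ ωᵢ of one
form are all closed, so the ratios of λ⁰ᵢ, λ¹ᵢ, λ²ᵢ are constant along the i-th leaves, and (X, Y)
maps each leaf into a line. Choosing the three jets as the standard basis makes (X, Y) local
coordinates (`isLinearizableAt_of_lines`).

For straight leaves ∂ₓsᵢ + sᵢ ∂_y sᵢ = 0. Then the curvature is ¾ σ_yy with σ = Σ sᵢ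
(`HasSlopes.curvatureForm_eq`), and the moment equations become homogeneous conservation laws. Their
integrability gives σ_yy fₓ = 0 wherever f = g = 0, so rank three implies σ_yy = 0. Conversely, if
σ_yy = 0, then σ_y depends on x alone and the system is solved explicitly with three free constants
(`rank_eq_three`). Rank and vanishing of the curvature are invariant under diffeomorphisms
(`IsEquiv.rank_eq`, `IsEquiv.curvatureForm_eq`), which carries the equivalence over to linearizable
webs.

(b) Each 3-subweb has connection form γ + z₁η₁ + z₂η₂, where z₁, z₂ are solved from its own
normalization. This changes dγ by (δ₁z₂ - δ₂z₁) η₁ ∧ η₂ (`extD_chernForm_frame`), and averaging the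
four results gives c₀. -/

noncomputable section

namespace PlanarWeb

/-! ### Partial derivatives -/

/-- The partial derivative in the first coordinate. -/
def dx (u : Plane → ℝ) (x : Plane) : ℝ := fderiv ℝ u x (1, 0)

/-- The partial derivative in the second coordinate. -/
def dy (u : Plane → ℝ) (x : Plane) : ℝ := fderiv ℝ u x (0, 1)

/-- The linear form with the given coefficients. -/
def lin (a b : ℝ) : Plane →L[ℝ] ℝ :=
  a • ContinuousLinearMap.fst ℝ ℝ ℝ + b • ContinuousLinearMap.snd ℝ ℝ ℝ

@[simp] theorem lin_apply (a b : ℝ) (v : Plane) : lin a b v = a * v.1 + b * v.2 := by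
  simp [lin]

theorem eq_lin (f : Plane →L[ℝ] ℝ) : f = lin (f (1, 0)) (f (0, 1)) := by
  ext <;> simp

theorem apply_eq (f : Plane →L[ℝ] ℝ) (v : Plane) : f v = f (1, 0) * v.1 + f (0, 1) * v.2 := by
  conv_lhs => rw [eq_lin f]
  simp

/-- `u` is differentiable at `x` with partial derivatives `a` and `b`. -/
def HasGrad (u : Plane → ℝ) (a b : ℝ) (x : Plane) : Prop := HasFDerivAt u (lin a b) x

namespace HasGrad

variable {u v : Plane → ℝ} {a b c d : ℝ} {x : Plane}

theorem dx_eq (h : HasGrad u a b x) : dx u x = a := by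
  rw [dx, HasFDerivAt.fderiv h]; simp

theorem dy_eq (h : HasGrad u a b x) : dy u x = b := by
  rw [dy, HasFDerivAt.fderiv h]; simp

theorem differentiableAt (h : HasGrad u a b x) : DifferentiableAt ℝ u x :=
  HasFDerivAt.differentiableAt h

theorem of_differentiableAt (h : DifferentiableAt ℝ u x) : HasGrad u (dx u x) (dy u x) x := by
  have := h.hasFDerivAt
  rwa [eq_lin (fderiv ℝ u x)] at this

theorem of_smooth (h : ContDiffAt ℝ ∞ u x) : HasGrad u (dx u x) (dy u x) x :=
  of_differentiableAt (h.differentiableAt (by simp))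

theorem congr_grad (h : HasGrad u a b x) (ha : a = c) (hb : b = d) : HasGrad u c d x := by
  subst ha hb; exact h

theorem congr_fun (h : HasGrad u a b x) (e : v =ᶠ[𝓝 x] u) : HasGrad v a b x :=
  HasFDerivAt.congr_of_eventuallyEq h e

theorem const (r : ℝ) : HasGrad (fun _ => r) 0 0 x := by
  have := hasFDerivAt_const (𝕜 := ℝ) r x
  refine this.congr_fderiv ?_
  ext <;> simp

theorem fst : HasGrad (fun y => y.1) 1 0 x := by
  refine (hasFDerivAt_fst (𝕜 := ℝ) (p := x)).congr_fderiv ?_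
  ext <;> simp

theorem snd : HasGrad (fun y => y.2) 0 1 x := by
  refine (hasFDerivAt_snd (𝕜 := ℝ) (p := x)).congr_fderiv ?_
  ext <;> simp

theorem add (hu : HasGrad u a b x) (hv : HasGrad v c d x) :
    HasGrad (fun y => u y + v y) (a + c) (b + d) x := by
  refine (HasFDerivAt.add hu hv).congr_fderiv ?_
  ext <;> simp

theorem neg (hu : HasGrad u a b x) : HasGrad (fun y => -u y) (-a) (-b) x := by
  refine (HasFDerivAt.neg hu).congr_fderiv ?_
  ext <;> simp

theorem sub (hu : HasGrad u a b x) (hv : HasGrad v c d x) :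
    HasGrad (fun y => u y - v y) (a - c) (b - d) x := by
  refine (HasFDerivAt.sub hu hv).congr_fderiv ?_
  ext <;> simp

theorem mul (hu : HasGrad u a b x) (hv : HasGrad v c d x) :
    HasGrad (fun y => u y * v y) (a * v x + u x * c) (b * v x + u x * d) x := by
  refine (HasFDerivAt.mul hu hv).congr_fderiv ?_
  ext <;> simp <;> ring

/-- The chain rule for a function of one variable. -/
theorem comp_hasDerivAt {F : ℝ → ℝ} {F' : ℝ} (hF : HasDerivAt F F' (u x))
    (hu : HasGrad u a b x) : HasGrad (fun y => F (u y)) (F' * a) (F' * b) x := by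
  refine (hF.comp_hasFDerivAt x hu).congr_fderiv ?_
  ext <;> simp

theorem inv (hu : HasGrad u a b x) (h : u x ≠ 0) :
    HasGrad (fun y => (u y)⁻¹) (-a / u x ^ 2) (-b / u x ^ 2) x := by
  refine (comp_hasDerivAt (hasDerivAt_inv h) hu).congr_grad ?_ ?_ <;> ring

theorem div (hu : HasGrad u a b x) (hv : HasGrad v c d x) (h : v x ≠ 0) :
    HasGrad (fun y => u y / v y) ((a * v x - u x * c) / v x ^ 2)
      ((b * v x - u x * d) / v x ^ 2) x := by
  have := hu.mul (hv.inv h)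
  refine (this.congr_fun (.of_eq (by ext; simp [div_eq_mul_inv]))).congr_grad ?_ ?_ <;>
    field_simp <;> ring

theorem pow (hu : HasGrad u a b x) (n : ℕ) :
    HasGrad (fun y => u y ^ (n + 1)) ((n + 1) * u x ^ n * a) ((n + 1) * u x ^ n * b) x := by
  have := comp_hasDerivAt (hasDerivAt_pow (n + 1) (u x)) hu
  simpa using this

theorem sum {ι : Type*} (s : Finset ι) {u : ι → Plane → ℝ} {a b : ι → ℝ}
    (h : ∀ i ∈ s, HasGrad (u i) (a i) (b i) x) :
    HasGrad (fun y => ∑ i ∈ s, u i y) (∑ i ∈ s, a i) (∑ i ∈ s, b i) x := by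
  refine (HasFDerivAt.fun_sum h).congr_fderiv ?_
  ext <;> simp

/-- The chain rule for a change of coordinates. -/
theorem comp {φ : Plane → Plane} {a₁ b₁ a₂ b₂ : ℝ} (hu : HasGrad u a b (φ x))
    (h₁ : HasGrad (fun y => (φ y).1) a₁ b₁ x) (h₂ : HasGrad (fun y => (φ y).2) a₂ b₂ x) :
    HasGrad (fun y => u (φ y)) (a * a₁ + b * a₂) (a * b₁ + b * b₂) x := by
  have h := HasFDerivAt.comp x hu (HasFDerivAt.prodMk h₁ h₂)
  refine h.congr_fderiv ?_
  ext <;> simp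

/-- The derivative along a line. -/
theorem hasDerivAt_line {q w : Plane} {t : ℝ} (h : HasGrad u a b (q + t • w)) :
    HasDerivAt (fun s : ℝ => u (q + s • w)) (a * w.1 + b * w.2) t := by
  have h₁ : HasDerivAt (fun s : ℝ => q + s • w) w t := by
    simpa using ((hasDerivAt_id t).smul_const w).const_add q
  have h₂ : HasFDerivAt u (lin a b) (q + t • w) := h
  simpa [Function.comp_def] using h₂.comp_hasDerivAt t h₁

end HasGrad

theorem dx_congr {u v : Plane → ℝ} {x : Plane} (h : u =ᶠ[𝓝 x] v) : dx u x = dx v x := by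
  rw [dx, dx, h.fderiv_eq]

theorem dy_congr {u v : Plane → ℝ} {x : Plane} (h : u =ᶠ[𝓝 x] v) : dy u x = dy v x := by
  rw [dy, dy, h.fderiv_eq]

theorem smooth_dx {u : Plane → ℝ} {x : Plane} (h : ContDiffAt ℝ ∞ u x) :
    ContDiffAt ℝ ∞ (dx u) x :=
  (h.fderiv_right (m := ∞) (by simp)).clm_apply contDiffAt_const

theorem smooth_dy {u : Plane → ℝ} {x : Plane} (h : ContDiffAt ℝ ∞ u x) :
    ContDiffAt ℝ ∞ (dy u) x :=
  (h.fderiv_right (m := ∞) (by simp)).clm_apply contDiffAt_const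

theorem dy_dx {u : Plane → ℝ} {x : Plane} (h : ContDiffAt ℝ ∞ u x) :
    dy (dx u) x = dx (dy u) x := by
  have hd : DifferentiableAt ℝ (fderiv ℝ u) x :=
    (h.fderiv_right (m := ∞) (by simp)).differentiableAt (by simp)
  have e : ∀ v w : Plane, fderiv ℝ (fun y => fderiv ℝ u y v) x w
      = fderiv ℝ (fderiv ℝ u) x w v := by
    intro v w
    rw [fderiv_clm_apply hd (differentiableAt_const v)]
    simp
  have hs : IsSymmSndFDerivAt ℝ u x := h.isSymmSndFDerivAt (by simp; norm_cast)
  change fderiv ℝ (fun y => fderiv ℝ u y (1, 0)) x (0, 1)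
    = fderiv ℝ (fun y => fderiv ℝ u y (0, 1)) x (1, 0)
  rw [e, e]
  exact hs _ _

/-- A function that is smooth at a point is differentiable near it. -/
theorem eventually_differentiableAt {E : Type*} [NormedAddCommGroup E] [NormedSpace ℝ E]
    {u : Plane → E} {x : Plane} (h : ContDiffAt ℝ ∞ u x) :
    ∀ᶠ y in 𝓝 x, DifferentiableAt ℝ u y := by
  filter_upwards [(h.of_le (m := 1) (by norm_cast)).eventually (by simp)] with y hy
  exact hy.differentiableAt (by simp)

/-! ### Components of differential forms -/

/-- The coefficient of `dx`. -/
def cx (α : OneForm) (x : Plane) : ℝ := α x (1, 0)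

/-- The coefficient of `dy`. -/
def cy (α : OneForm) (x : Plane) : ℝ := α x (0, 1)

/-- The form with the given coefficients. -/
def mkForm (A B : Plane → ℝ) : OneForm := fun x => lin (A x) (B x)

@[simp] theorem cx_mkForm (A B : Plane → ℝ) : cx (mkForm A B) = A := by
  ext; simp [cx, mkForm]

@[simp] theorem cy_mkForm (A B : Plane → ℝ) : cy (mkForm A B) = B := by
  ext; simp [cy, mkForm]

theorem form_eq (α : OneForm) : α = mkForm (cx α) (cy α) := by
  ext x <;> simp [mkForm, cx, cy]

theorem form_apply (α : OneForm) (x v : Plane) : α x v = cx α x * v.1 + cy α x * v.2 :=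
  apply_eq _ _

theorem form_ext {α β : OneForm} {x : Plane} (h₁ : cx α x = cx β x) (h₂ : cy α x = cy β x) :
    α x = β x := by
  rw [form_eq α, form_eq β, mkForm, mkForm, h₁, h₂]

theorem wedge_eq (α β : OneForm) (x : Plane) :
    wedge α β x = cx α x * cy β x - cy α x * cx β x := rfl

@[simp] theorem cx_mulForm (u : Plane → ℝ) (α : OneForm) (x : Plane) :
    cx (mulForm u α) x = u x * cx α x := by simp [cx, mulForm]

@[simp] theorem cy_mulForm (u : Plane → ℝ) (α : OneForm) (x : Plane) :
    cy (mulForm u α) x = u x * cy α x := by simp [cy, mulForm]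

theorem wedge_mulForm (u v : Plane → ℝ) (α β : OneForm) (x : Plane) :
    wedge (mulForm u α) (mulForm v β) x = u x * v x * wedge α β x := by
  simp only [wedge_eq, cx_mulForm, cy_mulForm]; ring

/-! ### Exterior derivatives, connection forms and change of normalization. -/

section Smooth

variable {α β : OneForm} {u v : Plane → ℝ} {x : Plane}

theorem smooth_cx (h : ContDiffAt ℝ ∞ α x) : ContDiffAt ℝ ∞ (cx α) x :=
  h.clm_apply contDiffAt_const

theorem smooth_cy (h : ContDiffAt ℝ ∞ α x) : ContDiffAt ℝ ∞ (cy α) x :=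
  h.clm_apply contDiffAt_const

theorem smooth_mkForm (hu : ContDiffAt ℝ ∞ u x) (hv : ContDiffAt ℝ ∞ v x) :
    ContDiffAt ℝ ∞ (mkForm u v) x :=
  (hu.smul contDiffAt_const).add (hv.smul contDiffAt_const)

theorem smooth_mulForm (hu : ContDiffAt ℝ ∞ u x) (hα : ContDiffAt ℝ ∞ α x) :
    ContDiffAt ℝ ∞ (mulForm u α) x := hu.smul hα

theorem smooth_wedge (hα : ContDiffAt ℝ ∞ α x) (hβ : ContDiffAt ℝ ∞ β x) :
    ContDiffAt ℝ ∞ (wedge α β) x :=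
  ((smooth_cx hα).mul (smooth_cy hβ)).sub ((smooth_cy hα).mul (smooth_cx hβ))

theorem extD_eq_dx (h : DifferentiableAt ℝ α x) : extD α x = dx (cy α) x - dy (cx α) x := by
  have e : ∀ v w : Plane, fderiv ℝ (fun y => α y v) x w = fderiv ℝ α x w v := by
    intro v w
    rw [fderiv_clm_apply h (differentiableAt_const v)]
    simp
  rw [extD_eq h]
  exact (congrArg₂ (· - ·) (e (0, 1) (1, 0)) (e (1, 0) (0, 1))).symm

theorem extD_eq_dx_of_smooth (h : ContDiffAt ℝ ∞ α x) :
    extD α x = dx (cy α) x - dy (cx α) x :=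
  extD_eq_dx (h.differentiableAt (by simp))

theorem extD_of_hasGrad {a b c d : ℝ} (h₁ : HasGrad (cx α) a b x) (h₂ : HasGrad (cy α) c d x) :
    extD α x = c - b := by
  have h : DifferentiableAt ℝ α x := by
    rw [form_eq α]
    exact (h₁.differentiableAt.smul_const _).add (h₂.differentiableAt.smul_const _)
  rw [extD_eq_dx h, h₁.dy_eq, h₂.dx_eq]

theorem extD_congr (h : α =ᶠ[𝓝 x] β) : extD α x = extD β x := by
  have : (fun y => ContinuousAlternatingMap.ofSubsingleton ℝ Plane ℝ (0 : Fin 1) (α y)) =ᶠ[𝓝 x]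
      (fun y => ContinuousAlternatingMap.ofSubsingleton ℝ Plane ℝ (0 : Fin 1) (β y)) := by
    filter_upwards [h] with y hy
    rw [hy]
  rw [extD, extD, this.extDeriv_eq]

theorem eventually_extD_congr (h : α =ᶠ[𝓝 x] β) : extD α =ᶠ[𝓝 x] extD β := by
  filter_upwards [eventually_eventually_nhds.2 h] with y hy using extD_congr hy

theorem smooth_extD (h : ContDiffAt ℝ ∞ α x) : ContDiffAt ℝ ∞ (extD α) x := by
  refine ((smooth_dx (smooth_cy h)).sub (smooth_dy (smooth_cx h))).congr_of_eventuallyEq ?_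
  filter_upwards [eventually_differentiableAt h] with y hy using extD_eq_dx hy

theorem smooth_chernForm (hα : ContDiffAt ℝ ∞ α x) (hβ : ContDiffAt ℝ ∞ β x)
    (hw : wedge α β x ≠ 0) : ContDiffAt ℝ ∞ (chernForm α β) x :=
  (((smooth_extD hβ).neg.div (smooth_wedge hα hβ) hw).smul hα).add
    (((smooth_extD hα).div (smooth_wedge hα hβ) hw).smul hβ)

theorem chernForm_congr {α' β' : OneForm} (h₁ : α =ᶠ[𝓝 x] α') (h₂ : β =ᶠ[𝓝 x] β') :
    chernForm α β =ᶠ[𝓝 x] chernForm α' β' := by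
  filter_upwards [h₁, h₂, eventually_extD_congr h₁, eventually_extD_congr h₂] with y e₁ e₂ e₃ e₄
  simp [chernForm, wedge, e₁, e₂, e₃, e₄]

theorem extD_mulForm (hu : DifferentiableAt ℝ u x) (hα : DifferentiableAt ℝ α x) :
    extD (mulForm u α) x = dx u x * cy α x - dy u x * cx α x + u x * extD α x := by
  have hx : DifferentiableAt ℝ (cx α) x := hα.clm_apply (differentiableAt_const _)
  have hy : DifferentiableAt ℝ (cy α) x := hα.clm_apply (differentiableAt_const _)
  have gu := HasGrad.of_differentiableAt hu
  rw [extD_of_hasGrad ((gu.mul (HasGrad.of_differentiableAt hx)).congr_fun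
      (.of_eq (funext (cx_mulForm u α))))
    ((gu.mul (HasGrad.of_differentiableAt hy)).congr_fun (.of_eq (funext (cy_mulForm u α)))),
    extD_eq_dx hα]
  ring

/-- The differential of a function. -/
def dForm (u : Plane → ℝ) : OneForm := mkForm (dx u) (dy u)

theorem extD_dForm (hu : ContDiffAt ℝ ∞ u x) : extD (dForm u) x = 0 := by
  rw [dForm, extD_eq_dx_of_smooth (smooth_mkForm (smooth_dx hu) (smooth_dy hu)), cx_mkForm,
    cy_mkForm, dy_dx hu, sub_self]

theorem extD_add (hα : DifferentiableAt ℝ α x) (hβ : DifferentiableAt ℝ β x) :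
    extD (α + β) x = extD α x + extD β x := by
  rw [extD_eq (hα.add hβ), extD_eq hα, extD_eq hβ, fderiv_add hα hβ]
  simp only [add_apply]
  ring

/-- The form `dγ` of a `3`-web does not depend on the normalization. -/
theorem extD_chernForm_mulForm (hα : ContDiffAt ℝ ∞ α x) (hβ : ContDiffAt ℝ ∞ β x)
    (hu : ContDiffAt ℝ ∞ u x) (hw : wedge α β x ≠ 0) (h0 : u x ≠ 0) :
    extD (chernForm (mulForm u α) (mulForm u β)) x = extD (chernForm α β) x := by
  -- `Real.log` is log |u|, so the sign of `u` does not matter.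
  have hl : ContDiffAt ℝ ∞ (fun y => Real.log (u y)) x := hu.log h0
  have hc := smooth_chernForm hα hβ hw
  have hneg : ContDiffAt ℝ ∞ (fun y => -Real.log (u y)) x := hl.neg
  have hd : ContDiffAt ℝ ∞ (dForm fun y => -Real.log (u y)) x :=
    smooth_mkForm (smooth_dx hneg) (smooth_dy hneg)
  -- Rescaling by `u` changes γ by the exact form -d log |u|, which dγ does not see.
  have e : chernForm (mulForm u α) (mulForm u β) =ᶠ[𝓝 x]
      chernForm α β + dForm fun y => -Real.log (u y) := by
    filter_upwards [eventually_differentiableAt hα, eventually_differentiableAt hβ,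
      eventually_differentiableAt hu, (smooth_wedge hα hβ).continuousAt.eventually_ne hw,
      hu.continuousAt.eventually_ne h0] with y h₁ h₂ h₃ h₄ h₅
    have g := (HasGrad.of_differentiableAt h₃)
    have gl := ((g.comp_hasDerivAt (Real.hasDerivAt_log h₅)).neg)
    have k₁ : extD α y = wedge α (chernForm α β) y :=
      (structure_equations (η₃ := fun y => -(α y + β y)) h₁ h₂ (by intro; abel) h₄).1
    have k₂ : extD β y = wedge β (chernForm α β) y :=
      (structure_equations (η₃ := fun y => -(α y + β y)) h₁ h₂ (by intro; abel) h₄).2.1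
    have ex : cx (chernForm α β + dForm fun y => -Real.log (u y)) y
        = cx (chernForm α β) y - (u y)⁻¹ * dx u y := by
      simp only [cx, Pi.add_apply, dForm, mkForm, add_apply, lin_apply]
      rw [gl.dx_eq, gl.dy_eq]; ring
    have ey : cy (chernForm α β + dForm fun y => -Real.log (u y)) y
        = cy (chernForm α β) y - (u y)⁻¹ * dy u y := by
      simp only [cy, Pi.add_apply, dForm, mkForm, add_apply, lin_apply]
      rw [gl.dx_eq, gl.dy_eq]; ring
    refine (chernForm_unique ?_ ?_ ?_).symm
    · rw [wedge_mulForm]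
      exact mul_ne_zero (mul_ne_zero h₅ h₅) h₄
    · rw [extD_mulForm h₃ h₁, k₁, wedge_eq, wedge_eq, ex, ey, cx_mulForm, cy_mulForm]
      field_simp
      ring
    · rw [extD_mulForm h₃ h₂, k₂, wedge_eq, wedge_eq, ex, ey, cx_mulForm, cy_mulForm]
      field_simp
      ring
  rw [extD_congr e, extD_add (hc.differentiableAt (by simp)) (hd.differentiableAt (by simp)),
    extD_dForm hneg, add_zero]

/-- The curvature form of a `3`-web can be computed from any normalization. -/
theorem curvatureForm₃_eq {γ : OneForm} {u v w : Plane → ℝ} (hα : ContDiffAt ℝ ∞ α x)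
    (hβ : ContDiffAt ℝ ∞ β x) (hγ : ContDiffAt ℝ ∞ γ x) (hu : ContDiffAt ℝ ∞ u x)
    (hv : ContDiffAt ℝ ∞ v x) (hu0 : u x ≠ 0)
    (hαβ : wedge α β x ≠ 0) (hβγ : wedge β γ x ≠ 0) (hγα : wedge γ α x ≠ 0)
    (hsum : ∀ᶠ y in 𝓝 x, u y • α y + v y • β y + w y • γ y = 0) :
    curvatureForm₃ α β γ x = extD (chernForm (mulForm u α) (mulForm v β)) x := by
  have sαβ := smooth_wedge hα hβ
  have sβγ := smooth_wedge hβ hγ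
  have sγα := smooth_wedge hγ hα
  have hf : ContDiffAt ℝ ∞ (fun y => wedge β γ y / u y) x := sβγ.div hu hu0
  -- Wedging the relation with `γ` gives u (α ∧ γ) + v (β ∧ γ) = 0: any normalization is
  -- proportional to the standard one.
  have key : ∀ᶠ y in 𝓝 x, wedge γ α y = wedge β γ y / u y * v y := by
    filter_upwards [hsum, hu.continuousAt.eventually_ne hu0] with y hy h0
    have hx : u y * cx α y + v y * cx β y + w y * cx γ y = 0 := by
      simpa [cx] using congrArg (fun f : Plane →L[ℝ] ℝ => f (1, 0)) hy
    have hy : u y * cy α y + v y * cy β y + w y * cy γ y = 0 := by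
      simpa [cy] using congrArg (fun f : Plane →L[ℝ] ℝ => f (0, 1)) hy
    field_simp
    rw [wedge_eq, wedge_eq]
    linear_combination (- cy γ y) * hx + cx γ y * hy
  have hv0 : v x ≠ 0 := fun h => hγα (by rw [key.self_of_nhds, h, mul_zero])
  rw [curvatureForm₃, ← extD_chernForm_mulForm (smooth_mulForm hu hα) (smooth_mulForm hv hβ) hf
    (by rw [wedge_mulForm]; exact mul_ne_zero (mul_ne_zero hu0 hv0) hαβ) (div_ne_zero hβγ hu0)]
  refine extD_congr (chernForm_congr ?_ ?_)
  · filter_upwards [hu.continuousAt.eventually_ne hu0] with y h0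
    simp [mulForm, smul_smul, div_mul_cancel₀ _ h0]
  · filter_upwards [key] with y hy
    simp [mulForm, smul_smul, hy]

end Smooth

/-! ### The curvature form depends only on the foliations. -/

section Scaling

variable {α β γ : OneForm} {x : Plane}

/-- The curvature form of a `3`-web depends only on the foliations. -/
theorem curvatureForm₃_mulForm {u v w : Plane → ℝ} (hα : ContDiffAt ℝ ∞ α x)
    (hβ : ContDiffAt ℝ ∞ β x) (hγ : ContDiffAt ℝ ∞ γ x) (hu : ContDiffAt ℝ ∞ u x)
    (hv : ContDiffAt ℝ ∞ v x) (hw : ContDiffAt ℝ ∞ w x) (hu0 : u x ≠ 0) (hv0 : v x ≠ 0)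
    (hw0 : w x ≠ 0)
    (hαβ : wedge α β x ≠ 0) (hβγ : wedge β γ x ≠ 0) (hγα : wedge γ α x ≠ 0) :
    curvatureForm₃ (mulForm u α) (mulForm v β) (mulForm w γ) x = curvatureForm₃ α β γ x := by
  have e : ∀ (r s : Plane → ℝ) (δ : OneForm),
      mulForm r (mulForm s δ) = mulForm (fun y => r y * s y) δ := by
    intro r s δ
    funext y
    simp [mulForm, smul_smul]
  rw [curvatureForm₃_eq (w := fun y => wedge (mulForm u α) (mulForm v β) y * w y)
    hα hβ hγ ((smooth_wedge (smooth_mulForm hv hβ) (smooth_mulForm hw hγ)).mul hu)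
    ((smooth_wedge (smooth_mulForm hw hγ) (smooth_mulForm hu hα)).mul hv) ?_ hαβ hβγ hγα ?_,
    curvatureForm₃, e, e]
  · rw [wedge_mulForm]
    exact mul_ne_zero (mul_ne_zero (mul_ne_zero hv0 hw0) hβγ) hu0
  · refine Filter.Eventually.of_forall fun y => ?_
    have := normalization_identity (mulForm u α) (mulForm v β) (mulForm w γ) y
    rw [e, e, e] at this
    exact this

theorem curvatureForm₃_congr {α' β' γ' : OneForm} (h₁ : α =ᶠ[𝓝 x] α') (h₂ : β =ᶠ[𝓝 x] β')
    (h₃ : γ =ᶠ[𝓝 x] γ') : curvatureForm₃ α β γ x = curvatureForm₃ α' β' γ' x := by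
  refine extD_congr (chernForm_congr ?_ ?_)
  · filter_upwards [h₁, h₂, h₃] with y e₁ e₂ e₃
    simp [mulForm, wedge, e₁, e₂, e₃]
  · filter_upwards [h₁, h₂, h₃] with y e₁ e₂ e₃
    simp [mulForm, wedge, e₁, e₂, e₃]

/-- Pointwise proportional smooth forms are proportional by a smooth function. -/
theorem exists_smooth_ratio {δ : OneForm} (hα : ContDiffAt ℝ ∞ α x) (hβ : ContDiffAt ℝ ∞ β x)
    (hδ : ContDiffAt ℝ ∞ δ x) (hw : wedge β δ x ≠ 0)
    (h : ∀ᶠ y in 𝓝 x, ∃ m : ℝ, m ≠ 0 ∧ α y = m • β y) :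
    ∃ m : Plane → ℝ, ContDiffAt ℝ ∞ m x ∧ m x ≠ 0 ∧ α =ᶠ[𝓝 x] mulForm m β := by
  have key : ∀ y, ∀ m : ℝ, α y = m • β y → wedge α δ y = m * wedge β δ y := by
    intro y m hm
    simp only [wedge, hm, smul_apply, smul_eq_mul]
    ring
  -- Wedging α = mβ with the transversal form `δ` exhibits m as a quotient of smooth functions.
  refine ⟨fun y => wedge α δ y / wedge β δ y, (smooth_wedge hα hδ).div (smooth_wedge hβ hδ) hw,
    ?_, ?_⟩
  · obtain ⟨m, hm, e⟩ := h.self_of_nhds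
    change wedge α δ x / wedge β δ x ≠ 0
    rw [key x m e]
    exact div_ne_zero (mul_ne_zero hm hw) hw
  · filter_upwards [h, (smooth_wedge hβ hδ).continuousAt.eventually_ne hw] with y hy hwy
    obtain ⟨m, -, e⟩ := hy
    rw [mulForm, key y m e, mul_div_cancel_right₀ _ hwy, e]

end Scaling

/-! ### Covariant derivatives in the frame dual to η₁, η₂. -/

section Frame

variable {η₁ η₂ : OneForm} {x : Plane}

theorem fderiv_dual₁ (u : Plane → ℝ) : fderiv ℝ u x (dual₁ η₁ η₂ x) =
    (wedge η₁ η₂ x)⁻¹ * (dx u x * cy η₂ x - dy u x * cx η₂ x) := by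
  rw [apply_eq]
  simp only [dual₁, dx, dy, cx, cy, Prod.smul_fst, Prod.smul_snd, smul_eq_mul]
  ring

theorem fderiv_dual₂ (u : Plane → ℝ) : fderiv ℝ u x (dual₂ η₁ η₂ x) =
    (wedge η₁ η₂ x)⁻¹ * (dy u x * cx η₁ x - dx u x * cy η₁ x) := by
  rw [apply_eq]
  simp only [dual₂, dx, dy, cx, cy, Prod.smul_fst, Prod.smul_snd, smul_eq_mul]
  ring

theorem chernForm_dual₁ (hw : wedge η₁ η₂ x ≠ 0) :
    chernForm η₁ η₂ x (dual₁ η₁ η₂ x) = -extD η₂ x / wedge η₁ η₂ x := by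
  have h := hw
  rw [wedge_eq] at h
  rw [form_apply]
  simp only [chernForm, dual₁, cx, cy, add_apply, smul_apply, smul_eq_mul, Prod.smul_fst,
    Prod.smul_snd, wedge] at h ⊢
  field_simp
  ring

theorem chernForm_dual₂ (hw : wedge η₁ η₂ x ≠ 0) :
    chernForm η₁ η₂ x (dual₂ η₁ η₂ x) = extD η₁ x / wedge η₁ η₂ x := by
  have h := hw
  rw [wedge_eq] at h
  rw [form_apply]
  simp only [chernForm, dual₂, cx, cy, add_apply, smul_apply, smul_eq_mul, Prod.smul_fst,
    Prod.smul_snd, wedge] at h ⊢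
  field_simp
  ring

theorem smooth_cov₁ (h₁ : ContDiffAt ℝ ∞ η₁ x) (h₂ : ContDiffAt ℝ ∞ η₂ x)
    (hw : wedge η₁ η₂ x ≠ 0) {k : ℝ} {u : Plane → ℝ} (hu : ContDiffAt ℝ ∞ u x) :
    ContDiffAt ℝ ∞ (cov₁ η₁ η₂ k u) x := by
  have hd : ContDiffAt ℝ ∞ (dual₁ η₁ η₂) x :=
    ((smooth_wedge h₁ h₂).inv hw).smul ((smooth_cy h₂).prodMk (smooth_cx h₂).neg)
  exact ((hu.fderiv_right (m := ∞) (by simp)).clm_apply hd).sub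
    ((contDiffAt_const.mul ((smooth_chernForm h₁ h₂ hw).clm_apply hd)).mul hu)

theorem smooth_cov₂ (h₁ : ContDiffAt ℝ ∞ η₁ x) (h₂ : ContDiffAt ℝ ∞ η₂ x)
    (hw : wedge η₁ η₂ x ≠ 0) {k : ℝ} {u : Plane → ℝ} (hu : ContDiffAt ℝ ∞ u x) :
    ContDiffAt ℝ ∞ (cov₂ η₁ η₂ k u) x := by
  have hd : ContDiffAt ℝ ∞ (dual₂ η₁ η₂) x :=
    ((smooth_wedge h₁ h₂).inv hw).smul ((smooth_cy h₁).neg.prodMk (smooth_cx h₁))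
  exact ((hu.fderiv_right (m := ∞) (by simp)).clm_apply hd).sub
    ((contDiffAt_const.mul ((smooth_chernForm h₁ h₂ hw).clm_apply hd)).mul hu)

theorem differentiableAt_mulForm {α : OneForm} {u : Plane → ℝ} (hu : DifferentiableAt ℝ u x)
    (hα : DifferentiableAt ℝ α x) : DifferentiableAt ℝ (mulForm u α) x := hu.smul hα

/-- The exterior derivative of a form in terms of covariant derivatives of its coefficients. -/
theorem extD_frame {u v : Plane → ℝ} (h₁ : DifferentiableAt ℝ η₁ x)
    (h₂ : DifferentiableAt ℝ η₂ x) (hu : DifferentiableAt ℝ u x) (hv : DifferentiableAt ℝ v x)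
    (hw : wedge η₁ η₂ x ≠ 0) : extD (mulForm u η₁ + mulForm v η₂) x =
      (cov₁ η₁ η₂ 1 v x - cov₂ η₁ η₂ 1 u x) * wedge η₁ η₂ x := by
  rw [extD_add (differentiableAt_mulForm hu h₁) (differentiableAt_mulForm hv h₂), extD_mulForm hu h₁, extD_mulForm hv h₂, cov₁, cov₂,
    fderiv_dual₁, fderiv_dual₂, chernForm_dual₁ hw, chernForm_dual₂ hw]
  field_simp
  ring

/-- In weight 0 the connection terms drop out and the covariant derivatives are the plain frame
derivatives. -/
theorem dForm_frame {u : Plane → ℝ} (hw : wedge η₁ η₂ x ≠ 0) :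
    dForm u x = (mulForm (cov₁ η₁ η₂ 0 u) η₁ + mulForm (cov₂ η₁ η₂ 0 u) η₂) x := by
  have h := hw
  rw [wedge_eq] at h
  apply form_ext <;>
  · simp only [dForm, mkForm, mulForm, cx, cy, Pi.add_apply, add_apply, smul_apply, smul_eq_mul,
      cov₁, cov₂, fderiv_dual₁, fderiv_dual₂, lin_apply, wedge] at h ⊢
    field_simp
    ring

/-- This is d(du) = 0 written in the frame. Taking the second derivatives in weight 1 absorbs dη₁
and dη₂, so no commutator term is left. -/
theorem cov_comm (h₁ : ContDiffAt ℝ ∞ η₁ x) (h₂ : ContDiffAt ℝ ∞ η₂ x)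
    (hw : wedge η₁ η₂ x ≠ 0) {u : Plane → ℝ} (hu : ContDiffAt ℝ ∞ u x) :
    cov₁ η₁ η₂ 1 (cov₂ η₁ η₂ 0 u) x = cov₂ η₁ η₂ 1 (cov₁ η₁ η₂ 0 u) x := by
  have e : dForm u =ᶠ[𝓝 x] mulForm (cov₁ η₁ η₂ 0 u) η₁ + mulForm (cov₂ η₁ η₂ 0 u) η₂ := by
    filter_upwards [(smooth_wedge h₁ h₂).continuousAt.eventually_ne hw] with y hy
    exact dForm_frame hy
  have h := extD_dForm hu
  rw [extD_congr e, extD_frame (h₁.differentiableAt (by simp)) (h₂.differentiableAt (by simp))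
    ((smooth_cov₁ h₁ h₂ hw hu).differentiableAt (by simp))
    ((smooth_cov₂ h₁ h₂ hw hu).differentiableAt (by simp)) hw] at h
  exact sub_eq_zero.1 ((mul_eq_zero.1 h).resolve_right hw)

/-- For α = uη₁ + vη₂ the structure equations give dα = du ∧ η₁ + dv ∧ η₂ + α ∧ γ. Hence dα = α ∧ (γ
+ z₁η₁ + z₂η₂) reduces to one scalar equation, linear in z₁ and z₂. -/
theorem extD_frame_eq_wedge {u v z₁ z₂ : Plane → ℝ} (h₁ : DifferentiableAt ℝ η₁ x)
    (h₂ : DifferentiableAt ℝ η₂ x) (hu : DifferentiableAt ℝ u x) (hv : DifferentiableAt ℝ v x)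
    (hw : wedge η₁ η₂ x ≠ 0)
    (h : cov₁ η₁ η₂ 0 v x - cov₂ η₁ η₂ 0 u x = u x * z₂ x - v x * z₁ x) :
    extD (mulForm u η₁ + mulForm v η₂) x = wedge (mulForm u η₁ + mulForm v η₂)
      (chernForm η₁ η₂ + (mulForm z₁ η₁ + mulForm z₂ η₂)) x := by
  have e : cov₁ η₁ η₂ 1 v x - cov₂ η₁ η₂ 1 u x =
      u x * z₂ x - v x * z₁ x + (extD η₂ x * v x + extD η₁ x * u x) / wedge η₁ η₂ x := by
    rw [← h]
    simp only [cov₁, cov₂, chernForm_dual₁ hw, chernForm_dual₂ hw]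
    field_simp
    ring
  rw [extD_frame h₁ h₂ hu hv hw, e]
  have h := hw
  simp only [wedge, chernForm, mulForm, Pi.add_apply, add_apply, smul_apply, smul_eq_mul] at h ⊢
  field_simp
  ring

/-- The connection form of another `3`-web, relative to that of `η₁, η₂, -η₁-η₂`. -/
theorem extD_chernForm_frame {u v u' v' z₁ z₂ : Plane → ℝ} {α β : OneForm}
    (h₁ : ContDiffAt ℝ ∞ η₁ x) (h₂ : ContDiffAt ℝ ∞ η₂ x)
    (hu : ContDiffAt ℝ ∞ u x) (hv : ContDiffAt ℝ ∞ v x)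
    (hu' : ContDiffAt ℝ ∞ u' x) (hv' : ContDiffAt ℝ ∞ v' x)
    (hz₁ : ContDiffAt ℝ ∞ z₁ x) (hz₂ : ContDiffAt ℝ ∞ z₂ x)
    (hw : wedge η₁ η₂ x ≠ 0) (hα : α =ᶠ[𝓝 x] mulForm u η₁ + mulForm v η₂)
    (hβ : β =ᶠ[𝓝 x] mulForm u' η₁ + mulForm v' η₂)
    (hd : u x * v' x - v x * u' x ≠ 0)
    (h : ∀ᶠ y in 𝓝 x, cov₁ η₁ η₂ 0 v y - cov₂ η₁ η₂ 0 u y = u y * z₂ y - v y * z₁ y)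
    (h' : ∀ᶠ y in 𝓝 x, cov₁ η₁ η₂ 0 v' y - cov₂ η₁ η₂ 0 u' y = u' y * z₂ y - v' y * z₁ y) :
    extD (chernForm α β) x = extD (chernForm η₁ η₂) x +
      (cov₁ η₁ η₂ 1 z₂ x - cov₂ η₁ η₂ 1 z₁ x) * wedge η₁ η₂ x := by
  -- The right side satisfies the structure equations of α and β, which have only one solution.
  have e : chernForm α β =ᶠ[𝓝 x] chernForm η₁ η₂ + (mulForm z₁ η₁ + mulForm z₂ η₂) := by
    refine (chernForm_congr hα hβ).trans ?_
    filter_upwards [h, h', eventually_differentiableAt h₁, eventually_differentiableAt h₂,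
      eventually_differentiableAt hu, eventually_differentiableAt hv,
      eventually_differentiableAt hu', eventually_differentiableAt hv',
      (smooth_wedge h₁ h₂).continuousAt.eventually_ne hw,
      ((hu.mul hv').sub (hv.mul hu')).continuousAt.eventually_ne hd]
      with y k k' d₁ d₂ d₃ d₄ d₅ d₆ kw kd
    refine (chernForm_unique ?_ (extD_frame_eq_wedge d₁ d₂ d₃ d₄ kw k)
      (extD_frame_eq_wedge d₁ d₂ d₅ d₆ kw k')).symm
    convert mul_ne_zero kd kw using 1
    simp only [wedge, mulForm, Pi.add_apply, add_apply, smul_apply, smul_eq_mul]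
    ring
  have hz : ContDiffAt ℝ ∞ (mulForm z₁ η₁ + mulForm z₂ η₂) x :=
    (smooth_mulForm hz₁ h₁).add (smooth_mulForm hz₂ h₂)
  rw [extD_congr e, extD_add ((smooth_chernForm h₁ h₂ hw).differentiableAt (by simp))
    (hz.differentiableAt (by simp)),
    extD_frame (h₁.differentiableAt (by simp)) (h₂.differentiableAt (by simp))
      (hz₁.differentiableAt (by simp)) (hz₂.differentiableAt (by simp)) hw]

theorem cov₁_hasGrad {k : ℝ} {u : Plane → ℝ} {a b : ℝ} (h : HasGrad u a b x) :
    cov₁ η₁ η₂ k u x = (wedge η₁ η₂ x)⁻¹ * (a * cy η₂ x - b * cx η₂ x)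
      - k * chernForm η₁ η₂ x (dual₁ η₁ η₂ x) * u x := by
  rw [cov₁, fderiv_dual₁, h.dx_eq, h.dy_eq]

theorem cov₂_hasGrad {k : ℝ} {u : Plane → ℝ} {a b : ℝ} (h : HasGrad u a b x) :
    cov₂ η₁ η₂ k u x = (wedge η₁ η₂ x)⁻¹ * (b * cx η₁ x - a * cy η₁ x)
      - k * chernForm η₁ η₂ x (dual₂ η₁ η₂ x) * u x := by
  rw [cov₂, fderiv_dual₂, h.dx_eq, h.dy_eq]

theorem cov₁_add {k : ℝ} {u v : Plane → ℝ} (hu : ContDiffAt ℝ ∞ u x) (hv : ContDiffAt ℝ ∞ v x) :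
    cov₁ η₁ η₂ k (fun y => u y + v y) x = cov₁ η₁ η₂ k u x + cov₁ η₁ η₂ k v x := by
  have gu := HasGrad.of_smooth hu
  have gv := HasGrad.of_smooth hv
  rw [cov₁_hasGrad (gu.add gv), cov₁_hasGrad gu, cov₁_hasGrad gv]
  ring

theorem cov₁_sub {k : ℝ} {u v : Plane → ℝ} (hu : ContDiffAt ℝ ∞ u x) (hv : ContDiffAt ℝ ∞ v x) :
    cov₁ η₁ η₂ k (fun y => u y - v y) x = cov₁ η₁ η₂ k u x - cov₁ η₁ η₂ k v x := by
  have gu := HasGrad.of_smooth hu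
  have gv := HasGrad.of_smooth hv
  rw [cov₁_hasGrad (gu.sub gv), cov₁_hasGrad gu, cov₁_hasGrad gv]
  ring

/-- The denominator is treated as having weight 0, so only the numerator carries a connection term.
-/
theorem cov₁_div {u v : Plane → ℝ} (hu : ContDiffAt ℝ ∞ u x)
    (hv : ContDiffAt ℝ ∞ v x) (h0 : v x ≠ 0) :
    cov₁ η₁ η₂ 1 (fun y => u y / v y) x =
      cov₁ η₁ η₂ 1 u x / v x - u x * cov₁ η₁ η₂ 0 v x / v x ^ 2 := by
  have gu := HasGrad.of_smooth hu
  have gv := HasGrad.of_smooth hv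
  rw [cov₁_hasGrad (gu.div gv h0), cov₁_hasGrad gu, cov₁_hasGrad gv]
  field_simp
  ring

theorem cov₂_div {u v : Plane → ℝ} (hu : ContDiffAt ℝ ∞ u x)
    (hv : ContDiffAt ℝ ∞ v x) (h0 : v x ≠ 0) :
    cov₂ η₁ η₂ 1 (fun y => u y / v y) x =
      cov₂ η₁ η₂ 1 u x / v x - u x * cov₂ η₁ η₂ 0 v x / v x ^ 2 := by
  have gu := HasGrad.of_smooth hu
  have gv := HasGrad.of_smooth hv
  rw [cov₂_hasGrad (gu.div gv h0), cov₂_hasGrad gu, cov₂_hasGrad gv]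
  field_simp
  ring

theorem cov₁_const (r : ℝ) : cov₁ η₁ η₂ 0 (fun _ => r) x = 0 := by
  rw [cov₁_hasGrad (.const r)]; ring

theorem cov₂_const (r : ℝ) : cov₂ η₁ η₂ 0 (fun _ => r) x = 0 := by
  rw [cov₂_hasGrad (.const r)]; ring

theorem cov₁_one_sub {a : Plane → ℝ} (h : DifferentiableAt ℝ a x) :
    cov₁ η₁ η₂ 0 (fun y => 1 - a y) x = -cov₁ η₁ η₂ 0 a x := by
  have g := HasGrad.of_differentiableAt h
  rw [cov₁_hasGrad ((HasGrad.const 1).sub g), cov₁_hasGrad g]; ring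

theorem cov₂_one_sub {a : Plane → ℝ} (h : DifferentiableAt ℝ a x) :
    cov₂ η₁ η₂ 0 (fun y => 1 - a y) x = -cov₂ η₁ η₂ 0 a x := by
  have g := HasGrad.of_differentiableAt h
  rw [cov₂_hasGrad ((HasGrad.const 1).sub g), cov₂_hasGrad g]; ring

end Frame

end PlanarWeb

/-! ### The four 3-subwebs and the formula for `c₀`. -/

namespace FourWeb

open PlanarWeb

variable {W : FourWeb}

theorem smooth_form (W : FourWeb) (i : Fin 4) {x : Plane} (hx : x ∈ W.U) :
    ContDiffAt ℝ ∞ (W.form i) x :=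
  (W.smooth i).contDiffAt (W.isOpen_U.mem_nhds hx)

namespace IsNormalization

variable {V : Set Plane} {η : Fin 4 → OneForm} {a : Plane → ℝ} {x : Plane}

theorem smoothAt (h : W.IsNormalization V η a) (hx : x ∈ V) (i : Fin 4) :
    ContDiffAt ℝ ∞ (η i) x :=
  (h.smooth i).contDiffAt (h.isOpen.mem_nhds hx)

theorem wedge_ne_zero (h : W.IsNormalization V η a) (hx : x ∈ V) {i j : Fin 4} (hij : i ≠ j) :
    wedge (η i) (η j) x ≠ 0 := by
  obtain ⟨m, hm, e⟩ := h.proportional i x hx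
  obtain ⟨n, hn, e'⟩ := h.proportional j x hx
  have := mul_ne_zero (mul_ne_zero hm hn) (W.generalPosition i j hij x (h.subset hx))
  convert this using 1
  simp only [wedge, e, e', smul_apply, smul_eq_mul]
  ring

theorem curvatureForm₃_eq (h : W.IsNormalization V η a) (hx : x ∈ V) {i j k : Fin 4}
    (hij : i ≠ j) (hjk : j ≠ k) (hki : k ≠ i) :
    curvatureForm₃ (W.form i) (W.form j) (W.form k) x = curvatureForm₃ (η i) (η j) (η k) x := by
  have hU := h.subset hx
  have ex : ∀ i j : Fin 4, i ≠ j → ∃ m : Plane → ℝ, ContDiffAt ℝ ∞ m x ∧ m x ≠ 0 ∧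
      η i =ᶠ[𝓝 x] mulForm m (W.form i) := fun i j hij =>
    exists_smooth_ratio (h.smoothAt hx i) (W.smooth_form i hU) (W.smooth_form j hU)
      (W.generalPosition i j hij x hU) (by
        filter_upwards [h.isOpen.mem_nhds hx] with y hy using h.proportional i y hy)
  obtain ⟨m, hm, hm0, e⟩ := ex i j hij
  obtain ⟨n, hn, hn0, e'⟩ := ex j k hjk
  obtain ⟨r, hr, hr0, e''⟩ := ex k i hki
  rw [curvatureForm₃_congr e e' e'', curvatureForm₃_mulForm (W.smooth_form i hU)
    (W.smooth_form j hU) (W.smooth_form k hU) hm hn hr hm0 hn0 hr0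
    (W.generalPosition i j hij x hU) (W.generalPosition j k hjk x hU)
    (W.generalPosition k i hki x hU)]

/-- Smoothness of `a` is not assumed. Wedging the second normalization with `η 1` shows that `a` is
the quotient of `η 1` ∧ `η 3` by `η 0` ∧ `η 1`. -/
theorem smooth_basicInvariant (h : W.IsNormalization V η a) (hx : x ∈ V) :
    ContDiffAt ℝ ∞ a x := by
  have hs := (smooth_wedge (h.smoothAt hx 1) (h.smoothAt hx 3)).div
    (smooth_wedge (h.smoothAt hx 0) (h.smoothAt hx 1)) (h.wedge_ne_zero hx (by decide))
  refine hs.congr_of_eventuallyEq ?_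
  filter_upwards [h.isOpen.mem_nhds hx] with y hy
  have hw := h.wedge_ne_zero hy (i := 0) (j := 1) (by decide)
  have e := h.sum₁₂₄ y hy
  have e₁ := congrArg (fun f : Plane →L[ℝ] ℝ => f (1, 0)) e
  have e₂ := congrArg (fun f : Plane →L[ℝ] ℝ => f (0, 1)) e
  simp only [add_apply, smul_apply, smul_eq_mul, zero_apply] at e₁ e₂
  rw [Pi.div_apply, eq_div_iff hw]
  simp only [wedge]
  linear_combination (η 1 y (0, 1)) * e₁ - (η 1 y (1, 0)) * e₂

/-- If `a` vanished, `η 3` would be -`η 1`, against general position. -/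
theorem basicInvariant_ne_zero (h : W.IsNormalization V η a) (hx : x ∈ V) : a x ≠ 0 := by
  intro h0
  have hw := h.wedge_ne_zero hx (i := 1) (j := 3) (by decide)
  have e := h.sum₁₂₄ x hx
  rw [h0, zero_smul, zero_add] at e
  refine hw ?_
  rw [wedge, eq_neg_of_add_eq_zero_right e]
  simp only [neg_apply]
  ring

/-- At a value 1 of `a` the two normalizations would give `η 2` = `η 3`. -/
theorem one_sub_basicInvariant_ne_zero (h : W.IsNormalization V η a) (hx : x ∈ V) :
    1 - a x ≠ 0 := by
  intro h0
  have hw := h.wedge_ne_zero hx (i := 2) (j := 3) (by decide)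
  have e := h.sum₁₂₄ x hx
  rw [← sub_eq_zero.1 h0, one_smul] at e
  refine hw ?_
  rw [wedge, eq_neg_of_add_eq_zero_right e, eq_neg_of_add_eq_zero_right (h.sum₁₂₃ x hx)]
  ring

/-- The curvature function of a `4`-web in terms of its basic invariant. -/
theorem curvatureFunction_eq (h : W.IsNormalization V η a) (hx : x ∈ V) :
    W.curvatureFunction η x = c₀ (η 0) (η 1) a x := by
  have s := fun i => h.smoothAt hx i
  have hw := h.wedge_ne_zero hx (i := 0) (j := 1) (by decide)
  have hV := h.isOpen.mem_nhds hx
  have ha := h.smooth_basicInvariant hx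
  have ha0 := h.basicInvariant_ne_zero hx
  have ha1 := h.one_sub_basicInvariant_ne_zero hx
  have hb : ContDiffAt ℝ ∞ (fun y => 1 - a y) x := contDiffAt_const.sub ha
  have h1 : ContDiffAt ℝ ∞ (cov₁ (η 0) (η 1) 0 a) x := smooth_cov₁ (s 0) (s 1) hw ha
  have h2 : ContDiffAt ℝ ∞ (cov₂ (η 0) (η 1) 0 a) x := smooth_cov₂ (s 0) (s 1) hw ha
  have c : ∀ r : ℝ, ContDiffAt ℝ ∞ (fun _ : Plane => r) x := fun r => contDiffAt_const
  have w' : ∀ i j : Fin 4, i ≠ j → wedge (η i) (η j) x ≠ 0 := fun i j => h.wedge_ne_zero hx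
  have e3 : ∀ y ∈ V, η 2 y = -(η 0 y + η 1 y) := fun y hy =>
    eq_neg_of_add_eq_zero_right (h.sum₁₂₃ y hy)
  have k123 : curvatureForm₃ (η 0) (η 1) (η 2) x = extD (chernForm (η 0) (η 1)) x := by
    rw [PlanarWeb.curvatureForm₃_eq (u := fun _ => 1) (v := fun _ => 1) (w := fun _ => 1) (s 0)
      (s 1) (s 2) (c 1) (c 1) one_ne_zero (w' _ _ (by decide)) (w' _ _ (by decide))
      (w' _ _ (by decide))]
    · congr 2 <;> · funext y; simp [mulForm]
    · filter_upwards [hV] with y hy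
      simpa using h.sum₁₂₃ y hy
  -- With the forms aη₁ and η₂ the two scalar equations are -a₂ = a z₂ and 0 = -z₁.
  have k124 : curvatureForm₃ (η 0) (η 1) (η 3) x = extD (chernForm (η 0) (η 1)) x +
      (cov₁ (η 0) (η 1) 1 (fun y => -(cov₂ (η 0) (η 1) 0 a y) / a y) x -
        cov₂ (η 0) (η 1) 1 (fun _ => 0) x) * wedge (η 0) (η 1) x := by
    rw [PlanarWeb.curvatureForm₃_eq (u := a) (v := fun _ => 1) (w := fun _ => 1) (s 0)
      (s 1) (s 3) ha (c 1) ha0 (w' _ _ (by decide)) (w' _ _ (by decide))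
      (w' _ _ (by decide))]
    · refine extD_chernForm_frame (u := a) (v := fun _ => 0) (u' := fun _ => 0)
        (v' := fun _ => 1) (s 0) (s 1) ha (c 0) (c 0) (c 1) (c 0) (h2.neg.div ha ha0) hw
        (.of_eq ?_) (.of_eq ?_) (by simpa using ha0) ?_ ?_
      · funext y; simp [mulForm]
      · funext y; simp [mulForm]
      · filter_upwards [ha.continuousAt.eventually_ne ha0] with y hy
        rw [cov₁_const]; field_simp; ring
      · filter_upwards with y
        rw [cov₁_const, cov₂_const]; ring
    · filter_upwards [hV] with y hy
      simpa using h.sum₁₂₄ y hy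
  -- Subtracting the normalizations gives (1 - a)η₁ + η₃ - η₄ = 0. With η₃ = -η₁ - η₂ the equations
  -- become a₂ = (1 - a) z₂ and z₁ = z₂.
  have k134 : curvatureForm₃ (η 0) (η 2) (η 3) x = extD (chernForm (η 0) (η 1)) x +
      (cov₁ (η 0) (η 1) 1 (fun y => cov₂ (η 0) (η 1) 0 a y / (1 - a y)) x -
        cov₂ (η 0) (η 1) 1 (fun y => cov₂ (η 0) (η 1) 0 a y / (1 - a y)) x)
          * wedge (η 0) (η 1) x := by
    rw [PlanarWeb.curvatureForm₃_eq (u := fun y => 1 - a y) (v := fun _ => 1) (w := fun _ => -1)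
      (s 0) (s 2) (s 3) hb (c 1) ha1 (w' _ _ (by decide)) (w' _ _ (by decide))
      (w' _ _ (by decide))]
    · refine extD_chernForm_frame (u := fun y => 1 - a y) (v := fun _ => 0) (u' := fun _ => -1)
        (v' := fun _ => -1) (s 0) (s 1) hb (c 0) (c _) (c _) (h2.div hb ha1) (h2.div hb ha1) hw
        (.of_eq ?_) ?_ (fun h0 => ha1 (by simp at h0; linarith)) ?_ ?_
      · funext y; simp [mulForm]
      · filter_upwards [hV] with y hy
        simp only [mulForm, e3 y hy, Pi.add_apply]
        module
      · filter_upwards [hb.continuousAt.eventually_ne ha1, eventually_differentiableAt ha]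
          with y hy hd
        rw [cov₁_const, cov₂_one_sub hd]; field_simp; ring
      · filter_upwards with y
        rw [cov₁_const, cov₂_const]; ring
    · filter_upwards [hV] with y hy
      rw [show (1 - a y) • η 0 y + (1 : ℝ) • η 2 y + (-1 : ℝ) • η 3 y =
        (η 0 y + η 1 y + η 2 y) - (a y • η 0 y + η 1 y + η 3 y) by module, h.sum₁₂₃ y hy,
        h.sum₁₂₄ y hy, sub_zero]
  -- Eliminating η₁ gives (1 - a)η₂ - aη₃ + η₄ = 0, where -aη₃ = aη₁ + aη₂. The equations are a₁ =
  -- (1 - a) z₁ and a₁ - a₂ = a (z₂ - z₁).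
  have k234 : curvatureForm₃ (η 1) (η 2) (η 3) x = extD (chernForm (η 0) (η 1)) x +
      (cov₁ (η 0) (η 1) 1 (fun y => cov₁ (η 0) (η 1) 0 a y / (1 - a y) +
          (cov₁ (η 0) (η 1) 0 a y - cov₂ (η 0) (η 1) 0 a y) / a y) x -
        cov₂ (η 0) (η 1) 1 (fun y => cov₁ (η 0) (η 1) 0 a y / (1 - a y)) x)
          * wedge (η 0) (η 1) x := by
    rw [PlanarWeb.curvatureForm₃_eq (u := fun y => 1 - a y) (v := fun y => -a y) (w := fun _ => 1)
      (s 1) (s 2) (s 3) hb ha.neg ha1 (w' _ _ (by decide)) (w' _ _ (by decide))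
      (w' _ _ (by decide))]
    · refine extD_chernForm_frame (u := fun _ => 0) (v := fun y => 1 - a y) (u' := a)
        (v' := a) (s 0) (s 1) (c 0) hb ha ha (h1.div hb ha1)
        ((h1.div hb ha1).add ((h1.sub h2).div ha ha0)) hw (.of_eq ?_) ?_ ?_ ?_ ?_
      · funext y; simp [mulForm]
      · filter_upwards [hV] with y hy
        simp only [mulForm, e3 y hy, Pi.add_apply]
        module
      · simpa using ⟨ha1, ha0⟩
      · filter_upwards [hb.continuousAt.eventually_ne ha1, eventually_differentiableAt ha]
          with y hy hd
        rw [cov₂_const, cov₁_one_sub hd]; field_simp; ring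
      · filter_upwards [ha.continuousAt.eventually_ne ha0] with y hy
        field_simp; ring
    · filter_upwards [hV] with y hy
      rw [show (1 - a y) • η 1 y + (-a y) • η 2 y + (1 : ℝ) • η 3 y =
        (-a y) • (η 0 y + η 1 y + η 2 y) + (a y • η 0 y + η 1 y + η 3 y) by module, h.sum₁₂₃ y hy,
        h.sum₁₂₄ y hy, smul_zero, add_zero]
  have hn2 : ∀ k : ℝ, cov₁ (η 0) (η 1) k (fun y => -cov₂ (η 0) (η 1) 0 a y) x =
      -cov₁ (η 0) (η 1) k (cov₂ (η 0) (η 1) 0 a) x := fun k => by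
    have g := HasGrad.of_smooth h2
    rw [cov₁_hasGrad g, cov₁_hasGrad g.neg]; ring
  have hz : cov₂ (η 0) (η 1) 1 (fun _ => (0 : ℝ)) x = 0 := by
    rw [cov₂_hasGrad (.const 0)]; ring
  have had := ha.differentiableAt (by simp : (∞ : WithTop ℕ∞) ≠ 0)
  rw [hz, cov₁_div h2.neg ha ha0, hn2] at k124
  rw [cov₁_div h2 hb ha1, cov₂_div h2 hb ha1, cov₁_one_sub had, cov₂_one_sub had] at k134
  have q1 : ContDiffAt ℝ ∞ (fun y => cov₁ (η 0) (η 1) 0 a y / (1 - a y)) x := h1.div hb ha1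
  have q2 : ContDiffAt ℝ ∞ (fun y => (cov₁ (η 0) (η 1) 0 a y - cov₂ (η 0) (η 1) 0 a y) / a y) x :=
    (h1.sub h2).div ha ha0
  rw [cov₁_add q1 q2, cov₁_div h1 hb ha1,
    cov₁_div (h1.sub h2) ha ha0, cov₁_sub h1 h2, cov₂_div h1 hb ha1, cov₁_one_sub had,
    cov₂_one_sub had] at k234
  have hc := cov_comm (s 0) (s 1) hw ha
  simp only [curvatureFunction, curvatureFunction₃, h.curvatureForm₃_eq hx (i := 0) (j := 1)
    (k := 2) (by decide) (by decide) (by decide), h.curvatureForm₃_eq hx (i := 0) (j := 1)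
    (k := 3) (by decide) (by decide) (by decide), h.curvatureForm₃_eq hx (i := 0) (j := 2)
    (k := 3) (by decide) (by decide) (by decide), h.curvatureForm₃_eq hx (i := 1) (j := 2)
    (k := 3) (by decide) (by decide) (by decide)]
  rw [k123, k124, k134, k234, hc]
  simp only [c₀, curvatureK]
  field_simp
  ring

end IsNormalization

end FourWeb

namespace PlanarWeb

/-! ### Pullback of forms -/

/-- The pullback of a `1`-form by a map. -/
def pull (φ : Plane → Plane) (α : OneForm) : OneForm := fun x => (α (φ x)).comp (fderiv ℝ φ x)

/-- The Jacobian determinant. -/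
def jac (φ : Plane → Plane) (x : Plane) : ℝ :=
  dx (fun y => (φ y).1) x * dy (fun y => (φ y).2) x
    - dy (fun y => (φ y).1) x * dx (fun y => (φ y).2) x

section Pull

variable {φ : Plane → Plane} {α β γ : OneForm} {x : Plane}

theorem hasGrad_fst (h : DifferentiableAt ℝ φ x) : HasGrad (fun y => (φ y).1)
    (dx (fun y => (φ y).1) x) (dy (fun y => (φ y).1) x) x :=
  .of_differentiableAt h.fst

theorem hasGrad_snd (h : DifferentiableAt ℝ φ x) : HasGrad (fun y => (φ y).2)
    (dx (fun y => (φ y).2) x) (dy (fun y => (φ y).2) x) x :=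
  .of_differentiableAt h.snd

theorem fderiv_eq (h : DifferentiableAt ℝ φ x) (v : Plane) : fderiv ℝ φ x v =
    (dx (fun y => (φ y).1) x * v.1 + dy (fun y => (φ y).1) x * v.2,
      dx (fun y => (φ y).2) x * v.1 + dy (fun y => (φ y).2) x * v.2) := by
  have e := HasFDerivAt.prodMk (hasGrad_fst h) (hasGrad_snd h)
  rw [e.fderiv]
  simp

theorem cx_pull (h : DifferentiableAt ℝ φ x) : cx (pull φ α) x =
    cx α (φ x) * dx (fun y => (φ y).1) x + cy α (φ x) * dx (fun y => (φ y).2) x := by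
  rw [cx, pull, ContinuousLinearMap.comp_apply, form_apply, fderiv_eq h]
  simp

theorem cy_pull (h : DifferentiableAt ℝ φ x) : cy (pull φ α) x =
    cx α (φ x) * dy (fun y => (φ y).1) x + cy α (φ x) * dy (fun y => (φ y).2) x := by
  rw [cy, pull, ContinuousLinearMap.comp_apply, form_apply, fderiv_eq h]
  simp

theorem wedge_pull (h : DifferentiableAt ℝ φ x) :
    wedge (pull φ α) (pull φ β) x = jac φ x * wedge α β (φ x) := by
  rw [wedge_eq, wedge_eq, cx_pull h, cx_pull h, cy_pull h, cy_pull h, jac]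
  ring

theorem smooth_pull (h : ContDiffAt ℝ ∞ φ x) (hα : ContDiffAt ℝ ∞ α (φ x)) :
    ContDiffAt ℝ ∞ (pull φ α) x :=
  (hα.comp x h).clm_comp (h.fderiv_right (m := ∞) (by simp))

theorem smooth_jac (h : ContDiffAt ℝ ∞ φ x) : ContDiffAt ℝ ∞ (jac φ) x :=
  ((smooth_dx h.fst).mul (smooth_dy h.snd)).sub ((smooth_dy h.fst).mul (smooth_dx h.snd))

/-- The second derivatives of `φ` enter only as mixed partials, which cancel by symmetry. -/
theorem extD_pull (h : ContDiffAt ℝ ∞ φ x) (hα : DifferentiableAt ℝ α (φ x)) :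
    extD (pull φ α) x = jac φ x * extD α (φ x) := by
  have hd := h.differentiableAt (by simp : (∞ : WithTop ℕ∞) ≠ 0)
  have gx := (HasGrad.of_differentiableAt (u := cx α) (hα.clm_apply (differentiableAt_const _))).comp
    (hasGrad_fst hd) (hasGrad_snd hd)
  have gy := (HasGrad.of_differentiableAt (u := cy α) (hα.clm_apply (differentiableAt_const _))).comp
    (hasGrad_fst hd) (hasGrad_snd hd)
  have g1x := HasGrad.of_smooth (smooth_dx h.fst)
  have g1y := HasGrad.of_smooth (smooth_dy h.fst)
  have g2x := HasGrad.of_smooth (smooth_dx h.snd)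
  have g2y := HasGrad.of_smooth (smooth_dy h.snd)
  have ev := eventually_differentiableAt h
  rw [extD_of_hasGrad
    (((gx.mul g1x).add (gy.mul g2x)).congr_fun (by filter_upwards [ev] with y hy using cx_pull hy))
    (((gx.mul g1y).add (gy.mul g2y)).congr_fun (by filter_upwards [ev] with y hy using cy_pull hy)),
    dy_dx h.fst, dy_dx h.snd, extD_eq_dx hα, jac]
  ring

/-- The structure equations pull back, and they determine the connection form. -/
theorem chernForm_pull (h : ContDiffAt ℝ ∞ φ x) (hα : DifferentiableAt ℝ α (φ x))
    (hβ : DifferentiableAt ℝ β (φ x)) (hw : wedge α β (φ x) ≠ 0) (hj : jac φ x ≠ 0) :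
    chernForm (pull φ α) (pull φ β) x = pull φ (chernForm α β) x := by
  have hd := h.differentiableAt (by simp : (∞ : WithTop ℕ∞) ≠ 0)
  have k := structure_equations (η₃ := fun y => -(α y + β y)) hα hβ (by intro; abel) hw
  refine (chernForm_unique ?_ ?_ ?_).symm
  · rw [wedge_pull hd]
    exact mul_ne_zero hj hw
  · rw [wedge_pull hd, extD_pull h hα, k.1]
  · rw [wedge_pull hd, extD_pull h hβ, k.2.1]

/-- Naturality of the curvature form of a `3`-web, for a map that is smooth near `x`. -/
theorem curvatureForm₃_pull (h : ∀ᶠ y in 𝓝 x, ContDiffAt ℝ ∞ φ y) (hj : jac φ x ≠ 0)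
    (hα : ContDiffAt ℝ ∞ α (φ x)) (hβ : ContDiffAt ℝ ∞ β (φ x)) (hγ : ContDiffAt ℝ ∞ γ (φ x))
    (hαβ : wedge α β (φ x) ≠ 0) (hβγ : wedge β γ (φ x) ≠ 0) (hγα : wedge γ α (φ x) ≠ 0) :
    curvatureForm₃ (pull φ α) (pull φ β) (pull φ γ) x
      = jac φ x * curvatureForm₃ α β γ (φ x) := by
  have hx := h.self_of_nhds
  have c := hx.continuousAt
  have s₁ : ContDiffAt ℝ ∞ (mulForm (wedge β γ) α) (φ x) :=
    smooth_mulForm (smooth_wedge hβ hγ) hα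
  have s₂ : ContDiffAt ℝ ∞ (mulForm (wedge γ α) β) (φ x) :=
    smooth_mulForm (smooth_wedge hγ hα) hβ
  have hw : wedge (mulForm (wedge β γ) α) (mulForm (wedge γ α) β) (φ x) ≠ 0 := by
    rw [wedge_mulForm]
    exact mul_ne_zero (mul_ne_zero hβγ hγα) hαβ
  have ev := eventually_differentiableAt hx
  -- The standard normalization of the pulled-back web carries an extra common factor, the Jacobian,
  -- to which the curvature form is insensitive.
  have e₁ : mulForm (wedge (pull φ β) (pull φ γ)) (pull φ α) =ᶠ[𝓝 x]
      mulForm (jac φ) (pull φ (mulForm (wedge β γ) α)) := by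
    filter_upwards [ev] with y hy
    ext <;> simp [mulForm, wedge_pull hy, pull, mul_assoc]
  have e₂ : mulForm (wedge (pull φ γ) (pull φ α)) (pull φ β) =ᶠ[𝓝 x]
      mulForm (jac φ) (pull φ (mulForm (wedge γ α) β)) := by
    filter_upwards [ev] with y hy
    ext <;> simp [mulForm, wedge_pull hy, pull, mul_assoc]
  have e₃ : chernForm (pull φ (mulForm (wedge β γ) α)) (pull φ (mulForm (wedge γ α) β)) =ᶠ[𝓝 x]
      pull φ (chernForm (mulForm (wedge β γ) α) (mulForm (wedge γ α) β)) := by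
    filter_upwards [h, (smooth_jac hx).continuousAt.eventually_ne hj,
      c.eventually (eventually_differentiableAt s₁), c.eventually (eventually_differentiableAt s₂),
      c.eventually ((smooth_wedge s₁ s₂).continuousAt.eventually_ne hw)] with y k₁ k₂ k₃ k₄ k₅
    exact chernForm_pull k₁ k₃ k₄ k₅ k₂
  rw [curvatureForm₃, extD_congr (chernForm_congr e₁ e₂), extD_chernForm_mulForm
    (smooth_pull hx s₁) (smooth_pull hx s₂) (smooth_jac hx) ?_ hj, extD_congr e₃,
    extD_pull hx ((smooth_chernForm s₁ s₂ hw).differentiableAt (by simp)), curvatureForm₃]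
  rw [wedge_pull (hx.differentiableAt (by simp))]
  exact mul_ne_zero hj hw

end Pull

end PlanarWeb

/-! ### Invariance of rank and curvature under diffeomorphisms. -/

namespace FourWeb

open PlanarWeb

/-- `φ` is a smooth diffeomorphism between open sets that takes the foliations of `W` to those of
`W'`. -/
structure IsEquiv (W W' : FourWeb) (φ : OpenPartialHomeomorph Plane Plane) : Prop where
  source_subset : φ.source ⊆ W.U
  target_subset : φ.target ⊆ W'.U
  contDiffOn : ContDiffOn ℝ ∞ φ φ.source
  contDiffOn_symm : ContDiffOn ℝ ∞ φ.symm φ.target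
  kernel : ∀ i, ∀ x ∈ φ.source, ∀ v : Plane,
    W.form i x v = 0 ↔ W'.form i (φ x) (fderiv ℝ φ x v) = 0

theorem isEquivalentAt_iff {W W' : FourWeb} {p : Plane} :
    W.IsEquivalentAt W' p ↔ ∃ φ, p ∈ φ.source ∧ W.IsEquiv W' φ :=
  ⟨fun ⟨φ, h, h₁, h₂, h₃, h₄, h₅⟩ => ⟨φ, h, h₁, h₂, h₃, h₄, h₅⟩,
    fun ⟨φ, h, h₁, h₂, h₃, h₄, h₅⟩ => ⟨φ, h, h₁, h₂, h₃, h₄, h₅⟩⟩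

namespace IsEquiv

variable {W W' W'' : FourWeb} {φ ψ : OpenPartialHomeomorph Plane Plane} {x : Plane}

theorem smoothAt (h : W.IsEquiv W' φ) (hx : x ∈ φ.source) : ContDiffAt ℝ ∞ φ x :=
  h.contDiffOn.contDiffAt (φ.open_source.mem_nhds hx)

theorem smoothAt_symm (h : W.IsEquiv W' φ) (hx : x ∈ φ.target) : ContDiffAt ℝ ∞ φ.symm x :=
  h.contDiffOn_symm.contDiffAt (φ.open_target.mem_nhds hx)

theorem fderiv_comp_symm (h : W.IsEquiv W' φ) (hx : x ∈ φ.target) (v : Plane) :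
    fderiv ℝ φ (φ.symm x) (fderiv ℝ φ.symm x v) = v := by
  have d₁ := (h.smoothAt_symm hx).differentiableAt (by simp : (∞ : WithTop ℕ∞) ≠ 0)
  have d₂ := (h.smoothAt (φ.map_target hx)).differentiableAt (by simp : (∞ : WithTop ℕ∞) ≠ 0)
  have e : (φ ∘ φ.symm) =ᶠ[𝓝 x] id := by
    filter_upwards [φ.open_target.mem_nhds hx] with y hy using φ.right_inv hy
  have := e.fderiv_eq (𝕜 := ℝ)
  rw [fderiv_comp x d₂ d₁, fderiv_id] at this
  exact congrArg (fun f : Plane →L[ℝ] Plane => f v) this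

theorem symm (h : W.IsEquiv W' φ) : W'.IsEquiv W φ.symm where
  source_subset := h.target_subset
  target_subset := h.source_subset
  contDiffOn := h.contDiffOn_symm
  contDiffOn_symm := by simpa using h.contDiffOn
  kernel i x hx v := by
    have hx' : x ∈ φ.target := hx
    rw [h.kernel i _ (φ.map_target hx'), φ.right_inv hx', h.fderiv_comp_symm hx']

theorem trans (h : W.IsEquiv W' φ) (h' : W'.IsEquiv W'' ψ) : W.IsEquiv W'' (φ.trans ψ) := by
  refine ⟨fun x hx => h.source_subset hx.1, fun x hx => h'.target_subset hx.1, ?_, ?_, ?_⟩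
  · exact h'.contDiffOn.comp (h.contDiffOn.mono fun x hx => hx.1) fun x hx => hx.2
  · exact h.contDiffOn_symm.comp (h'.contDiffOn_symm.mono fun x hx => hx.1) fun x hx => hx.2
  · intro i x hx v
    have d : DifferentiableAt ℝ ψ (φ x) := (h'.smoothAt hx.2).differentiableAt (by simp)
    rw [h.kernel i x hx.1, h'.kernel i (φ x) hx.2, OpenPartialHomeomorph.coe_trans,
      fderiv_comp x d ((h.smoothAt hx.1).differentiableAt (by simp))]
    rfl

theorem jac_ne_zero (h : W.IsEquiv W' φ) (hx : x ∈ φ.source) : jac φ x ≠ 0 := by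
  have d₁ := (h.smoothAt hx).differentiableAt (by simp : (∞ : WithTop ℕ∞) ≠ 0)
  intro h0
  have key : ∀ v, fderiv ℝ φ x v = 0 → v = 0 := by
    intro v hv
    have := h.symm.fderiv_comp_symm (x := x) hx v
    simp only [OpenPartialHomeomorph.symm_symm] at this
    rw [← this, hv, map_zero]
  rw [jac] at h0
  -- If the determinant is zero, each row of the Jacobian matrix, rotated by a right angle, lies in
  -- the kernel. Both rows then vanish, contradicting injectivity.
  have k₁ := key (dy (fun y => (φ y).1) x, -dx (fun y => (φ y).1) x) (by
    rw [fderiv_eq d₁]; ext <;> simp <;> linarith)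
  have k₂ := key (dy (fun y => (φ y).2) x, -dx (fun y => (φ y).2) x) (by
    rw [fderiv_eq d₁]; ext <;> simp <;> linarith)
  simp only [Prod.mk_eq_zero, neg_eq_zero] at k₁ k₂
  have := key (1, 0) (by rw [fderiv_eq d₁]; ext <;> simp [k₁, k₂])
  simp at this

/-- The pulled back forms are proportional to the original ones by smooth functions. -/
theorem exists_ratio (h : W.IsEquiv W' φ) : ∃ m : Fin 4 → Plane → ℝ, ∀ i, ∀ x ∈ φ.source,
    ContDiffAt ℝ ∞ (m i) x ∧ m i x ≠ 0 ∧ pull φ (W'.form i) x = m i x • W.form i x := by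
  -- The index `i + 1` is cyclic in `Fin 4`; it only serves to pick some form transversal to the
  -- `i`-th.
  refine ⟨fun i x => wedge (pull φ (W'.form i)) (W.form (i + 1)) x /
    wedge (W.form i) (W.form (i + 1)) x, fun i x hx => ?_⟩
  have hw := W.generalPosition i (i + 1) (by fin_cases i <;> simp) x (h.source_subset hx)
  have sp := smooth_pull (h.smoothAt hx)
    (W'.smooth_form i (h.target_subset (φ.map_source hx)))
  have si := W.smooth_form i (h.source_subset hx)
  have sj := W.smooth_form (i + 1) (h.source_subset hx)
  have k : cx (pull φ (W'.form i)) x * cy (W.form i) x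
      - cy (pull φ (W'.form i)) x * cx (W.form i) x = 0 := by
    -- Evaluating both forms on the tangent vector of the leaf shows that they are parallel.
    have := (h.kernel i x hx (cy (W.form i) x, -cx (W.form i) x)).1 (by rw [form_apply]; ring)
    change pull φ (W'.form i) x (cy (W.form i) x, -cx (W.form i) x) = 0 at this
    rw [form_apply] at this
    linarith
  have e : pull φ (W'.form i) x = (wedge (pull φ (W'.form i)) (W.form (i + 1)) x /
      wedge (W.form i) (W.form (i + 1)) x) • W.form i x := by
    have hw' := hw
    rw [wedge_eq] at hw'
    refine form_ext (β := mulForm (fun x => wedge (pull φ (W'.form i)) (W.form (i + 1)) x /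
      wedge (W.form i) (W.form (i + 1)) x) (W.form i)) ?_ ?_
    · rw [cx_mulForm, wedge_eq, wedge_eq, div_mul_eq_mul_div, eq_div_iff hw']
      linear_combination (-cx (W.form (i + 1)) x) * k
    · rw [cy_mulForm, wedge_eq, wedge_eq, div_mul_eq_mul_div, eq_div_iff hw']
      linear_combination (-cy (W.form (i + 1)) x) * k
  refine ⟨(smooth_wedge sp sj).div (smooth_wedge si sj) hw, fun h0 => ?_, e⟩
  dsimp only at h0
  rw [h0, zero_smul] at e
  have z : ∀ v, W.form i x v = 0 := fun v => (h.kernel i x hx v).2 (by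
    change pull φ (W'.form i) x v = 0
    rw [e]; rfl)
  exact hw (by simp [wedge, z])

theorem curvatureForm_eq (h : W.IsEquiv W' φ) (hx : x ∈ φ.source) :
    W.curvatureForm x = jac φ x * W'.curvatureForm (φ x) := by
  obtain ⟨m, hm⟩ := h.exists_ratio
  have hU := h.source_subset hx
  have hU' := h.target_subset (φ.map_source hx)
  have e : ∀ i, pull φ (W'.form i) =ᶠ[𝓝 x] mulForm (m i) (W.form i) := fun i => by
    filter_upwards [φ.open_source.mem_nhds hx] with y hy using (hm i y hy).2.2
  have key : ∀ i j k : Fin 4, i ≠ j → j ≠ k → k ≠ i →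
      curvatureForm₃ (W.form i) (W.form j) (W.form k) x
        = jac φ x * curvatureForm₃ (W'.form i) (W'.form j) (W'.form k) (φ x) := by
    intro i j k hij hjk hki
    rw [← curvatureForm₃_pull ?_ (h.jac_ne_zero hx) (W'.smooth_form i hU') (W'.smooth_form j hU')
      (W'.smooth_form k hU') (W'.generalPosition i j hij _ hU')
      (W'.generalPosition j k hjk _ hU') (W'.generalPosition k i hki _ hU'),
      curvatureForm₃_congr (e i) (e j) (e k), curvatureForm₃_mulForm (W.smooth_form i hU)
      (W.smooth_form j hU) (W.smooth_form k hU) (hm i x hx).1 (hm j x hx).1 (hm k x hx).1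
      (hm i x hx).2.1 (hm j x hx).2.1 (hm k x hx).2.1 (W.generalPosition i j hij _ hU)
      (W.generalPosition j k hjk _ hU) (W.generalPosition k i hki _ hU)]
    filter_upwards [φ.open_source.mem_nhds hx] with y hy using h.smoothAt hy
  rw [curvatureForm, curvatureForm, key 0 1 2 (by decide) (by decide) (by decide),
    key 0 1 3 (by decide) (by decide) (by decide), key 0 2 3 (by decide) (by decide) (by decide),
    key 1 2 3 (by decide) (by decide) (by decide)]
  ring

theorem eventually_curvatureForm_eq_zero (h : W.IsEquiv W' φ) (hx : x ∈ φ.source)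
    (hc : ∀ᶠ y in 𝓝 (φ x), W'.curvatureForm y = 0) : ∀ᶠ y in 𝓝 x, W.curvatureForm y = 0 := by
  filter_upwards [φ.open_source.mem_nhds hx, (h.smoothAt hx).continuousAt.eventually hc]
    with y hy e
  rw [h.curvatureForm_eq hy, e, mul_zero]

/-- What is pulled back are the closed forms `l i` · `W'.form i`; expressing them through `W.form i`
produces the factor `m i`. -/
theorem abelianEqAt_pull (h : W.IsEquiv W' φ) {m : Fin 4 → Plane → ℝ}
    (hm : ∀ i, ∀ x ∈ φ.source, ContDiffAt ℝ ∞ (m i) x ∧ m i x ≠ 0 ∧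
      pull φ (W'.form i) x = m i x • W.form i x) (hx : x ∈ φ.source) {l : Plane → Fin 4 → ℝ}
    (hl : W'.AbelianEqAt l (φ x)) : W.AbelianEqAt (fun y i => m i y * l (φ y) i) x := by
  have hφ := h.smoothAt hx
  have hU' := h.target_subset (φ.map_source hx)
  have sl : ∀ i, ContDiffAt ℝ ∞ (fun y => l y i) (φ x) := contDiffAt_pi.1 hl.1
  refine ⟨contDiffAt_pi.2 fun i => (hm i x hx).1.mul ((sl i).comp x hφ), ?_, fun i => ?_⟩
  · have := congrArg (fun f : Plane →L[ℝ] ℝ => f.comp (fderiv ℝ φ x)) hl.2.1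
    rw [ContinuousLinearMap.zero_comp] at this
    rw [← this]
    ext
    · simp only [ContinuousLinearMap.comp_apply, sum_apply, smul_apply, smul_eq_mul]
      refine Finset.sum_congr rfl fun i _ => ?_
      have e := congrArg (fun f : Plane →L[ℝ] ℝ => f (1, 0)) (hm i x hx).2.2
      simp only [pull, ContinuousLinearMap.comp_apply, smul_apply, smul_eq_mul] at e
      simp only [ContinuousLinearMap.inl_apply, e]
      ring
    · simp only [ContinuousLinearMap.comp_apply, sum_apply, smul_apply, smul_eq_mul]
      refine Finset.sum_congr rfl fun i _ => ?_
      have e := congrArg (fun f : Plane →L[ℝ] ℝ => f (0, 1)) (hm i x hx).2.2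
      simp only [pull, ContinuousLinearMap.comp_apply, smul_apply, smul_eq_mul] at e
      simp only [ContinuousLinearMap.inr_apply, e]
      ring
  · have e : mulForm (fun y => m i y * l (φ y) i) (W.form i) =ᶠ[𝓝 x]
        pull φ (mulForm (fun y => l y i) (W'.form i)) := by
      filter_upwards [φ.open_source.mem_nhds hx] with y hy
      have := (hm i y hy).2.2
      simp only [pull, mulForm, ContinuousLinearMap.smul_comp] at this ⊢
      rw [this, smul_smul, mul_comm]
    rw [extD_congr e, extD_pull hφ ((smooth_mulForm (sl i)
      (W'.smooth_form i hU')).differentiableAt (by simp)), hl.2.2 i, mul_zero]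

/-- Pulling back relations is linear, and it is injective because the ratios do not vanish and `φ`
is invertible. Cardinal ranks are compared because `Module.finrank` takes the default value 0 in
infinite dimension, and no finiteness is known at this point. -/
theorem rank_le (h : W.IsEquiv W' φ) (hx : x ∈ φ.source) :
    Module.rank ℝ (W'.abelianGerms (φ x) (h.target_subset (φ.map_source hx))) ≤
      Module.rank ℝ (W.abelianGerms x (h.source_subset hx)) := by
  obtain ⟨m, hm⟩ := h.exists_ratio
  have ht : Filter.Tendsto φ (𝓝 x) (𝓝 (φ x)) := (h.smoothAt hx).continuousAt
  let T : W'.abelianGerms (φ x) (h.target_subset (φ.map_source hx)) →ₗ[ℝ]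
      W.abelianGerms x (h.source_subset hx) :=
    { toFun := fun g => ⟨((fun y i => m i y : Plane → Fin 4 → ℝ) : Filter.Germ (𝓝 x) _) *
          g.1.compTendsto φ ht, by
        obtain ⟨g, l, rfl, hl⟩ := g
        refine ⟨fun y i => m i y * l (φ y) i, rfl, ?_⟩
        filter_upwards [φ.open_source.mem_nhds hx, ht.eventually hl] with y hy e
        exact h.abelianEqAt_pull hm hy e⟩
      map_add' := by
        rintro ⟨_, l, rfl, hl⟩ ⟨_, l', rfl, hl'⟩
        refine Subtype.ext (Filter.Germ.coe_eq.2 (.of_eq ?_))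
        funext y
        ext i
        simp [mul_add]
      map_smul' := by
        rintro c ⟨_, l, rfl, hl⟩
        refine Subtype.ext (Filter.Germ.coe_eq.2 (.of_eq ?_))
        funext y
        ext i
        simp [mul_left_comm] }
  refine LinearMap.rank_le_of_injective T ((injective_iff_map_eq_zero T).2 ?_)
  rintro ⟨_, l, rfl, hl⟩ h0
  have h1 : (fun y => (fun i => m i y) * l (φ y)) =ᶠ[𝓝 x] fun _ => 0 :=
    Filter.Germ.coe_eq.1 (congrArg Subtype.val h0)
  refine Subtype.ext (Filter.Germ.coe_eq.2 ?_)
  have hc : Filter.Tendsto φ.symm (𝓝 (φ x)) (𝓝 x) := by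
    have := (h.smoothAt_symm (φ.map_source hx)).continuousAt
    rwa [ContinuousAt, φ.left_inv hx] at this
  filter_upwards [hc.eventually h1, φ.open_target.mem_nhds (φ.map_source hx)] with y e hy
  rw [φ.right_inv hy] at e
  ext i
  have := congrFun e i
  exact (mul_eq_zero.1 this).resolve_left (hm i _ (φ.map_target hy)).2.1

theorem rank_eq (h : W.IsEquiv W' φ) (hx : x ∈ φ.source) :
    W.rank x (h.source_subset hx) = W'.rank (φ x) (h.target_subset (φ.map_source hx)) := by
  have h₁ := h.rank_le hx
  -- The point `φ.symm (φ x)` equals `x` only propositionally, and the space of germs depends on the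
  -- point; the variable `q` permits the substitution.
  have h₂ : ∀ (q : Plane) (hq : q ∈ W.U), φ.symm (φ x) = q →
      Module.rank ℝ (W.abelianGerms q hq) ≤
        Module.rank ℝ (W'.abelianGerms (φ x) (h.target_subset (φ.map_source hx))) := by
    rintro _ hq rfl
    exact h.symm.rank_le (x := φ x) (φ.map_source hx)
  replace h₂ := h₂ x (h.source_subset hx) (φ.left_inv hx)
  rw [rank, rank, Module.finrank, Module.finrank, le_antisymm h₂ h₁]

end IsEquiv

end FourWeb

/-! ### Straight leaves and reduction to slopes. -/

namespace PlanarWeb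

/-- The obstruction to the straightness of the integral curves of `α = 0`. -/
def bend (α : OneForm) (x : Plane) : ℝ :=
  cy α x ^ 2 * dx (cx α) x - cx α x * cy α x * (dy (cx α) x + dx (cy α) x)
    + cx α x ^ 2 * dy (cy α) x

/-- The form `dy - s dx`. -/
def slopeForm (s : Plane → ℝ) : OneForm := mkForm (fun x => -s x) (fun _ => 1)

@[simp] theorem cx_slopeForm (s : Plane → ℝ) : cx (slopeForm s) = fun x => -s x := cx_mkForm _ _

@[simp] theorem cy_slopeForm (s : Plane → ℝ) : cy (slopeForm s) = fun _ => 1 := cy_mkForm _ _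

theorem slopeForm_apply (s : Plane → ℝ) (x v : Plane) : slopeForm s x v = v.2 - s x * v.1 := by
  simp [slopeForm, mkForm]; ring

theorem wedge_slopeForm (s t : Plane → ℝ) (x : Plane) :
    wedge (slopeForm s) (slopeForm t) x = t x - s x := by
  simp [wedge_eq]; ring

theorem bend_slopeForm {s : Plane → ℝ} {x : Plane} (h : DifferentiableAt ℝ s x) :
    bend (slopeForm s) x = -(dx s x + s x * dy s x) := by
  have g := (HasGrad.of_differentiableAt h).neg
  have c : HasGrad (fun _ => (1 : ℝ)) 0 0 x := .const 1
  rw [bend, cx_slopeForm, cy_slopeForm, g.dx_eq, g.dy_eq, c.dx_eq, c.dy_eq]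
  ring

end PlanarWeb

namespace FourWeb

open PlanarWeb

variable {W : FourWeb}

/-- Let v span the kernel of the form at x. Straightness makes the form at x + tv vanish on v for
all small t, and the derivative of this at t = 0 is `bend`. -/
theorem IsLinear.bend_eq_zero (h : W.IsLinear) (i : Fin 4) {x : Plane} (hx : x ∈ W.U) :
    bend (W.form i) x = 0 := by
  have s := W.smooth_form i hx
  obtain ⟨r, hr, hb⟩ := Metric.isOpen_iff.1 W.isOpen_U x hx
  set v : Plane := (cy (W.form i) x, -cx (W.form i) x) with hv
  have hc : Filter.Tendsto (fun t : ℝ => x + t • v) (𝓝 0) (𝓝 x) := by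
    have : Continuous fun t : ℝ => x + t • v := by fun_prop
    simpa using this.tendsto 0
  have hz : (fun t : ℝ => W.form i (x + t • v) v) =ᶠ[𝓝 0] fun _ => 0 := by
    filter_upwards [hc.eventually (Metric.ball_mem_nhds x hr)] with t ht
    rcases eq_or_ne t 0 with rfl | h0
    · rw [zero_smul, add_zero, form_apply, hv]; ring
    · have := h i x hx (t • v) (by rw [map_smul, form_apply, hv, smul_eq_mul]; ring)
        (((convex_ball x r).segment_subset (Metric.mem_ball_self hr) ht).trans hb)
      rw [map_smul, smul_eq_mul] at this
      exact (mul_eq_zero.1 this).resolve_left h0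
  have g₁ := (HasGrad.of_smooth (smooth_cx s))
  have g₂ := (HasGrad.of_smooth (smooth_cy s))
  have g : HasGrad (fun y => W.form i y v) (dx (cx (W.form i)) x * v.1 + dx (cy (W.form i)) x * v.2)
      (dy (cx (W.form i)) x * v.1 + dy (cy (W.form i)) x * v.2) x := by
    refine (((g₁.mul (.const v.1)).add (g₂.mul (.const v.2))).congr_fun
      (.of_eq (funext fun y => form_apply _ _ _))).congr_grad ?_ ?_ <;> ring
  have hd := HasGrad.hasDerivAt_line (t := 0) (q := x) (w := v) (by simpa using g)
  have := hd.deriv.symm.trans hz.deriv_eq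
  rw [deriv_const] at this
  rw [bend, ← this, hv]
  ring

/-- Along a segment with direction v, the value of the form on v satisfies a linear equation h' = κ
h with h(0) = 0, hence vanishes by Grönwall. -/
theorem isLinear_of_bend (h : ∀ i, ∀ x ∈ W.U, bend (W.form i) x = 0) : W.IsLinear := by
  intro i q _ v h0 hseg
  have hmem : ∀ t ∈ Set.Icc (0 : ℝ) 1, q + t • v ∈ W.U := fun t ht => hseg <| by
    rw [segment_eq_image']
    exact ⟨t, ht, by simp⟩
  set A := fun x => cx (W.form i) x with hA
  set B := fun x => cy (W.form i) x with hB
  have sA : ∀ x ∈ W.U, ContDiffAt ℝ ∞ A x := fun x hx => smooth_cx (W.smooth_form i hx)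
  have sB : ∀ x ∈ W.U, ContDiffAt ℝ ∞ B x := fun x hx => smooth_cy (W.smooth_form i hx)
  have hN : ∀ x ∈ W.U, (A x ^ 2 + B x ^ 2) ≠ 0 := by
    intro x hx h0
    have h1 : A x = 0 := by nlinarith [sq_nonneg (A x), sq_nonneg (B x)]
    have h2 : B x = 0 := by nlinarith [sq_nonneg (A x), sq_nonneg (B x)]
    refine W.generalPosition i (i + 1) (by fin_cases i <;> simp) x hx ?_
    rw [wedge_eq]
    change A x * _ - B x * _ = 0
    rw [h1, h2]; ring
  -- With h = A v₁ + B v₂ and λ = B v₁ - A v₂ one has (A² + B²) v = λ (B, -A) + h (A, B). Let Q(v)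
  -- be the derivative in direction v of the form evaluated on v, a quadratic form in v. Then Q(B,
  -- -A) is `bend`, which vanishes, so Q(v) is a multiple of h, and κ is the factor.
  let κ : Plane → ℝ := fun x =>
    ((v.1 * B x - v.2 * A x) * (2 * dx A x * A x * B x + (dy A x + dx B x) * (B x ^ 2 - A x ^ 2)
      - 2 * dy B x * A x * B x) + (A x * v.1 + B x * v.2) *
      (dx A x * A x ^ 2 + (dy A x + dx B x) * A x * B x + dy B x * B x ^ 2))
      / (A x ^ 2 + B x ^ 2) ^ 2
  have hκ : ∀ x ∈ W.U, ContinuousAt κ x := by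
    intro x hx
    have c₁ := (sA x hx).continuousAt
    have c₂ := (sB x hx).continuousAt
    have c₃ := (smooth_dx (sA x hx)).continuousAt
    have c₄ := (smooth_dy (sA x hx)).continuousAt
    have c₅ := (smooth_dx (sB x hx)).continuousAt
    have c₆ := (smooth_dy (sB x hx)).continuousAt
    have := pow_ne_zero 2 (hN x hx)
    fun_prop (disch := assumption)
  have hderiv : ∀ t ∈ Set.Icc (0 : ℝ) 1, HasDerivAt (fun s : ℝ => W.form i (q + s • v) v)
      (κ (q + t • v) * W.form i (q + t • v) v) t := by
    intro t ht
    have hx := hmem t ht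
    have g : HasGrad (fun y => W.form i y v) (dx A (q + t • v) * v.1 + dx B (q + t • v) * v.2)
        (dy A (q + t • v) * v.1 + dy B (q + t • v) * v.2) (q + t • v) := by
      refine ((((HasGrad.of_smooth (sA _ hx)).mul (.const v.1)).add
        ((HasGrad.of_smooth (sB _ hx)).mul (.const v.2))).congr_fun
        (.of_eq (funext fun y => form_apply _ _ _))).congr_grad ?_ ?_ <;> ring
    convert g.hasDerivAt_line using 1
    have hq : B (q + t • v) ^ 2 * dx A (q + t • v) - A (q + t • v) * B (q + t • v) *
      (dy A (q + t • v) + dx B (q + t • v)) + A (q + t • v) ^ 2 * dy B (q + t • v) = 0 :=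
      h i _ hx
    have hn := hN _ hx
    rw [form_apply]
    change κ (q + t • v) * (A (q + t • v) * v.1 + B (q + t • v) * v.2) = _
    simp only [κ]
    rw [div_mul_eq_mul_div, div_eq_iff (pow_ne_zero 2 hn)]
    linear_combination (-(v.1 * B (q + t • v) - v.2 * A (q + t • v)) ^ 2) * hq
  have hcont : ContinuousOn (fun t : ℝ => κ (q + t • v)) (Set.Icc 0 1) := by
    intro t ht
    have c : ContinuousAt (fun t : ℝ => q + t • v) t := by fun_prop
    exact (ContinuousAt.comp (f := fun t : ℝ => q + t • v) (hκ _ (hmem t ht)) c).continuousWithinAt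
  obtain ⟨K, hK⟩ := isCompact_Icc.exists_bound_of_continuousOn hcont
  have := eq_zero_of_abs_deriv_le_mul_abs_self_of_eq_zero_right (K := K)
    (f := fun s : ℝ => W.form i (q + s • v) v)
    (fun t ht => (hderiv t ht).continuousAt.continuousWithinAt)
    (fun t ht => (hderiv t (Set.Ico_subset_Icc_self ht)).hasDerivWithinAt) (by simpa using h0)
    (fun t ht => by
      rw [norm_mul]
      exact mul_le_mul_of_nonneg_right (hK t (Set.Ico_subset_Icc_self ht)) (norm_nonneg _))
    1 (by simp)
  simpa using this

/-- The linear change of coordinates `(x, y) ↦ (y - t x, x)`. -/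
def shear (t : ℝ) : Plane ≃L[ℝ] Plane :=
  LinearEquiv.toContinuousLinearEquiv
    { toFun := fun x => (x.2 - t * x.1, x.1)
      map_add' := fun x y => by ext <;> simp; ring
      map_smul' := fun c x => by ext <;> simp; ring
      invFun := fun x => (x.2, x.1 + t * x.2)
      left_inv := fun x => by ext <;> simp
      right_inv := fun x => by ext <;> simp }

@[simp] theorem shear_symm_apply (t : ℝ) (x : Plane) :
    (shear t).symm x = (x.2, x.1 + t * x.2) := rfl

/-- Each of the four forms annihilates (1, t) for at most one t. -/
theorem exists_transversal (W : FourWeb) {p : Plane} (hp : p ∈ W.U) :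
    ∃ t : ℝ, ∀ i, W.form i p (1, t) ≠ 0 := by
  have hf : ∀ i, {t : ℝ | W.form i p (1, t) = 0}.Finite := by
    intro i
    refine Set.Subsingleton.finite fun t ht t' ht' => ?_
    simp only [Set.mem_ofPred_eq, form_apply (W.form i)] at ht ht'
    by_contra hne
    have h1 : cy (W.form i) p = 0 := by
      have : cy (W.form i) p * (t - t') = 0 := by linarith
      exact (mul_eq_zero.1 this).resolve_right (sub_ne_zero.2 hne)
    have h2 : cx (W.form i) p = 0 := by rw [h1] at ht; linarith
    refine W.generalPosition i (i + 1) (by fin_cases i <;> simp) p hp ?_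
    rw [wedge_eq, h1, h2]; ring
  obtain ⟨t, ht⟩ := (Set.finite_iUnion hf).exists_notMem
  exact ⟨t, fun i hi => ht (Set.mem_iUnion.2 ⟨i, hi⟩)⟩

/-- In suitable linear coordinates, the leaves of a web are nowhere vertical. -/
theorem exists_slopes (W : FourWeb) {p : Plane} (hp : p ∈ W.U) :
    ∃ (S : FourWeb) (s : Fin 4 → Plane → ℝ) (φ : OpenPartialHomeomorph Plane Plane),
      (∀ i, S.form i = slopeForm (s i)) ∧ p ∈ φ.source ∧ W.IsEquiv S φ ∧
        (W.IsLinear → S.IsLinear) := by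
  obtain ⟨t, ht⟩ := W.exists_transversal hp
  let O : Set Plane := {x | x ∈ W.U ∧ ∀ i, W.form i x (1, t) ≠ 0}
  have hO : IsOpen O := by
    rw [isOpen_iff_mem_nhds]
    rintro x ⟨hx, h⟩
    have : ∀ᶠ y in 𝓝 x, ∀ i, W.form i y (1, t) ≠ 0 := Filter.eventually_all.2 fun i =>
      ((W.smooth_form i hx).clm_apply (contDiffAt_const (c := ((1, t) :
        Plane)))).continuousAt.eventually_ne (h i)
    filter_upwards [W.isOpen_U.mem_nhds hx, this] with y h₁ h₂ using ⟨h₁, h₂⟩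
  -- The inverse shear sends (1, 0) to (0, 1) and (0, 1) to (1, t), so these are the coefficients of
  -- the form in the new coordinates; (1, t) being transversal makes the second one nonzero.
  let s : Fin 4 → Plane → ℝ := fun i q =>
    -(W.form i ((shear t).symm q) (0, 1)) / W.form i ((shear t).symm q) (1, t)
  have hs : ∀ i q, (shear t).symm q ∈ O → ContDiffAt ℝ ∞ (s i) q := by
    intro i q hq
    have h := ((W.smooth_form i hq.1).comp q (shear t).symm.contDiff.contDiffAt)
    exact ((h.clm_apply contDiffAt_const).neg).div (h.clm_apply contDiffAt_const) (hq.2 i)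
  have hker : ∀ i q, (shear t).symm q ∈ O → ∀ v, slopeForm (s i) q v = 0 ↔
      W.form i ((shear t).symm q) ((shear t).symm v) = 0 := by
    intro i q hq v
    have h := hq.2 i
    rw [slopeForm_apply, form_apply (W.form i) _ ((shear t).symm v), shear_symm_apply t v]
    simp only [s]
    have e := form_apply (W.form i) ((shear t).symm q) (1, t)
    rw [e] at h ⊢
    change v.2 - -(cy (W.form i) ((shear t).symm q)) / _ * v.1 = 0 ↔ _
    rw [div_mul_eq_mul_div, sub_eq_zero, eq_div_iff h]
    dsimp only
    constructor <;> intro h' <;> linarith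
  let S : FourWeb :=
    { U := (shear t).symm ⁻¹' O
      isOpen_U := hO.preimage (shear t).symm.continuous
      form := fun i => slopeForm (s i)
      smooth := fun i q hq =>
        (smooth_mkForm (hs i q hq).neg contDiffAt_const).contDiffWithinAt
      generalPosition := by
        intro i j hij q hq h0
        have hi := hq.2 i
        have hj := hq.2 j
        refine W.generalPosition i j hij _ hq.1 ?_
        rw [wedge_slopeForm] at h0
        simp only [s] at h0
        rw [sub_eq_zero, div_eq_div_iff hj hi, form_apply _ _ (1, t), form_apply _ _ (1, t)] at h0
        rw [wedge_eq]
        simp only [cx, cy] at h0 ⊢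
        linarith }
  refine ⟨S, s, (shear t).toHomeomorph.toOpenPartialHomeomorph.restrOpen O hO, fun i => rfl,
    ⟨trivial, hp, ht⟩, ⟨fun x hx => hx.2.1, fun q hq => ?_, (shear t).contDiff.contDiffOn,
    (shear t).symm.contDiff.contDiffOn, ?_⟩, ?_⟩
  · exact hq.2
  · intro i x hx v
    have hx' : (shear t).symm (shear t x) ∈ O := by
      rw [(shear t).symm_apply_apply]; exact hx.2
    have e : fderiv ℝ (shear t) x v = shear t v := by rw [(shear t).fderiv]; rfl
    change _ ↔ slopeForm (s i) (shear t x) (fderiv ℝ (shear t) x v) = 0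
    rw [e, hker i _ hx', (shear t).symm_apply_apply, (shear t).symm_apply_apply]
  · intro hlin i q hq v h0 hseg
    have hq2 : q + v ∈ S.U := hseg (right_mem_segment ℝ q (q + v))
    refine (hker i _ hq2 v).2 ?_
    rw [map_add]
    refine hlin i _ hq.1 _ ((hker i q hq v).1 h0) ?_
    rintro _ ⟨a, b, ha, hb, hab, rfl⟩
    have := (hseg ⟨a, b, ha, hb, hab, rfl⟩ : (shear t).symm _ ∈ O).1
    simpa only [map_add, map_smul] using this

end FourWeb

namespace PlanarWeb

/-! ### Uniqueness for closed linear systems -/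

/-- A solution of a closed linear first-order system that vanishes at a point vanishes near it. -/
theorem eventually_eq_zero_of_linear_system {n : ℕ} {v : Fin n → Plane → ℝ} {p : Plane}
    {Mx My : Fin n → Fin n → Plane → ℝ} (hMx : ∀ i j, ContinuousAt (Mx i j) p)
    (hMy : ∀ i j, ContinuousAt (My i j) p)
    (h : ∀ᶠ x in 𝓝 p, ∀ i, HasGrad (v i) (∑ j, Mx i j x * v j x) (∑ j, My i j x * v j x) x)
    (h0 : ∀ i, v i p = 0) : ∀ᶠ x in 𝓝 p, ∀ i, v i x = 0 := by
  have bd : ∀ {u : Plane → ℝ}, ContinuousAt u p → ∀ᶠ x in 𝓝 p, |u x| ≤ |u p| + 1 := by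
    intro u hu
    filter_upwards [hu.abs.eventually_lt_const (lt_add_one _)] with x hx using hx.le
  have bx : ∀ᶠ x in 𝓝 p, ∀ i j, |Mx i j x| ≤ |Mx i j p| + 1 :=
    Filter.eventually_all.2 fun i => Filter.eventually_all.2 fun j => bd (hMx i j)
  have by' : ∀ᶠ x in 𝓝 p, ∀ i j, |My i j x| ≤ |My i j p| + 1 :=
    Filter.eventually_all.2 fun i => Filter.eventually_all.2 fun j => bd (hMy i j)
  obtain ⟨r, hr, hball⟩ := Metric.eventually_nhds_iff_ball.1 (h.and (bx.and by'))
  refine Metric.eventually_nhds_iff_ball.2 ⟨r, hr, fun x hx => ?_⟩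
  set w := x - p with hw
  -- On the ball each coefficient is at most its absolute value at `p` plus one. The sum over both
  -- indices dominates every row, so `C` serves as Grönwall constant for the sup norm on the segment
  -- from `p` to `x`.
  set C : ℝ := ∑ i, ∑ j, ((|Mx i j p| + 1) * |w.1| + (|My i j p| + 1) * |w.2|) with hC
  have hmem : ∀ t ∈ Set.Icc (0 : ℝ) 1, p + t • w ∈ Metric.ball p r := by
    intro t ht
    refine (convex_ball p r).segment_subset (Metric.mem_ball_self hr) hx ?_
    rw [segment_eq_image']
    exact ⟨t, ht, rfl⟩
  have hd : ∀ t ∈ Set.Icc (0 : ℝ) 1, HasDerivAt (fun s : ℝ => fun i => v i (p + s • w))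
      (fun i => (∑ j, Mx i j (p + t • w) * v j (p + t • w)) * w.1 +
        (∑ j, My i j (p + t • w) * v j (p + t • w)) * w.2) t := fun t ht =>
    hasDerivAt_pi.2 fun i => ((hball _ (hmem t ht)).1 i).hasDerivAt_line
  have := eq_zero_of_abs_deriv_le_mul_abs_self_of_eq_zero_right (K := C)
    (f := fun s : ℝ => fun i => v i (p + s • w))
    (fun t ht => (hd t ht).continuousAt.continuousWithinAt)
    (fun t ht => (hd t (Set.Ico_subset_Icc_self ht)).hasDerivWithinAt)
    (by funext i; simpa using h0 i)
    (fun t ht => by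
      obtain ⟨-, k₁, k₂⟩ := hball _ (hmem t (Set.Ico_subset_Icc_self ht))
      set y := p + t • w
      have nn : 0 ≤ ‖fun i => v i y‖ := norm_nonneg _
      have nC : 0 ≤ C := Finset.sum_nonneg fun i _ => Finset.sum_nonneg fun j _ => by positivity
      refine (pi_norm_le_iff_of_nonneg (mul_nonneg nC nn)).2 fun i => ?_
      have e : (∑ j, Mx i j y * v j y) * w.1 + (∑ j, My i j y * v j y) * w.2
          = ∑ j, (Mx i j y * w.1 + My i j y * w.2) * v j y := by
        rw [Finset.sum_mul, Finset.sum_mul, ← Finset.sum_add_distrib]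
        exact Finset.sum_congr rfl fun j _ => by ring
      rw [e]
      have s₁ : ‖∑ j, (Mx i j y * w.1 + My i j y * w.2) * v j y‖ ≤
          ∑ j, ((|Mx i j p| + 1) * |w.1| + (|My i j p| + 1) * |w.2|) * ‖fun i => v i y‖ := by
        refine (norm_sum_le _ _).trans (Finset.sum_le_sum fun j _ => ?_)
        rw [norm_mul]
        refine mul_le_mul ?_ (norm_le_pi_norm (fun i => v i y) j) (norm_nonneg _) (by positivity)
        refine (norm_add_le _ _).trans ?_
        rw [norm_mul, norm_mul]
        exact add_le_add (mul_le_mul_of_nonneg_right (k₁ i j) (abs_nonneg _))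
          (mul_le_mul_of_nonneg_right (k₂ i j) (abs_nonneg _))
      refine s₁.trans ?_
      rw [← Finset.sum_mul]
      refine mul_le_mul_of_nonneg_right ?_ nn
      exact Finset.single_le_sum (f := fun i => ∑ j, ((|Mx i j p| + 1) * |w.1| +
        (|My i j p| + 1) * |w.2|)) (fun i _ => Finset.sum_nonneg fun j _ => by positivity)
        (Finset.mem_univ i))
    1 (by simp)
  intro i
  simpa [hw] using congrFun this i

/-- The overdetermined system for the moments of an abelian relation, after one prolongation, is
closed. -/
theorem eventually_eq_zero_of_moment_system {f g a₁ b₁ a₂ b₂ a₃ b₃ σ τ : Plane → ℝ} {p : Plane}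
    (hc : ∀ᶠ x in 𝓝 p, ContDiffAt ℝ ∞ a₁ x ∧ ContDiffAt ℝ ∞ b₁ x ∧ ContDiffAt ℝ ∞ a₂ x ∧
      ContDiffAt ℝ ∞ b₂ x ∧ ContDiffAt ℝ ∞ a₃ x ∧ ContDiffAt ℝ ∞ b₃ x ∧ ContDiffAt ℝ ∞ σ x ∧
      ContDiffAt ℝ ∞ τ x)
    (hs : ∀ᶠ x in 𝓝 p, ContDiffAt ℝ ∞ f x ∧ ContDiffAt ℝ ∞ g x)
    (h₁ : ∀ᶠ x in 𝓝 p, dy f x = a₁ x * f x + b₁ x * g x)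
    (h₂ : ∀ᶠ x in 𝓝 p, dx f x + dy g x = a₂ x * f x + b₂ x * g x)
    (h₃ : ∀ᶠ x in 𝓝 p, dx g x + dy (fun y => σ y * g y - τ y * f y) x =
      a₃ x * f x + b₃ x * g x)
    (hf : f p = 0) (hg : g p = 0) (hh : dx f p = 0) :
    ∀ᶠ x in 𝓝 p, f x = 0 ∧ g x = 0 := by
  -- The closed system solves for gₓ = c₃ f + d₃ g + σ fₓ, for f_xy = p₁ f + p₂ g + p₃ fₓ by
  -- differentiating the first equation in x, and for f_xx = q₁ f + q₂ g + q₃ fₓ.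
  let c₃ : Plane → ℝ := fun x => a₃ x - σ x * a₂ x + dy τ x + τ x * a₁ x
  let d₃ : Plane → ℝ := fun x => b₃ x - dy σ x - σ x * b₂ x + τ x * b₁ x
  let p₁ : Plane → ℝ := fun x => dx a₁ x + b₁ x * c₃ x
  let p₂ : Plane → ℝ := fun x => dx b₁ x + b₁ x * d₃ x
  let p₃ : Plane → ℝ := fun x => a₁ x + b₁ x * σ x
  let q₁ : Plane → ℝ := fun x => dx a₂ x + b₂ x * c₃ x - σ x * p₁ x - dy c₃ x - c₃ x * a₁ x
    - d₃ x * a₂ x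
  let q₂ : Plane → ℝ := fun x => dx b₂ x + b₂ x * d₃ x - σ x * p₂ x - dy d₃ x - c₃ x * b₁ x
    - d₃ x * b₂ x
  let q₃ : Plane → ℝ := fun x => a₂ x + b₂ x * σ x - dy σ x - σ x * p₃ x + d₃ x
  have sc : ∀ᶠ x in 𝓝 p, ContDiffAt ℝ ∞ c₃ x ∧ ContDiffAt ℝ ∞ d₃ x := by
    filter_upwards [hc] with x ⟨s₁, s₂, s₃, s₄, s₅, s₆, s₇, s₈⟩
    exact ⟨((s₅.sub (s₇.mul s₃)).add (smooth_dy s₈)).add (s₈.mul s₁),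
      ((s₆.sub (smooth_dy s₇)).sub (s₇.mul s₄)).add (s₈.mul s₂)⟩
  have hgx : ∀ᶠ x in 𝓝 p, dx g x = σ x * dx f x + c₃ x * f x + d₃ x * g x := by
    filter_upwards [hc, hs, h₁, h₂, h₃] with x ⟨_, _, _, _, _, _, s₇, s₈⟩ ⟨sf, sg⟩ e₁ e₂ e₃
    rw [(((HasGrad.of_smooth s₇).mul (.of_smooth sg)).sub
      ((HasGrad.of_smooth s₈).mul (.of_smooth sf))).dy_eq] at e₃
    simp only [c₃, d₃]
    linear_combination e₃ - σ x * e₂ + τ x * e₁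
  have hgy : ∀ᶠ x in 𝓝 p, dy g x = -dx f x + a₂ x * f x + b₂ x * g x := by
    filter_upwards [h₂] with x e
    linarith
  have hhy : ∀ᶠ x in 𝓝 p, dy (dx f) x = p₁ x * f x + p₂ x * g x + p₃ x * dx f x := by
    filter_upwards [hc, hs, eventually_eventually_nhds.2 h₁, hgx]
      with x ⟨s₁, s₂, _⟩ ⟨sf, sg⟩ e₁ e₂
    rw [dy_dx sf, dx_congr e₁, (((HasGrad.of_smooth s₁).mul (.of_smooth sf)).add
      ((HasGrad.of_smooth s₂).mul (.of_smooth sg))).dx_eq, e₂]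
    simp only [p₁, p₂, p₃]
    ring
  have hhx : ∀ᶠ x in 𝓝 p, dx (dx f) x = q₁ x * f x + q₂ x * g x + q₃ x * dx f x := by
    filter_upwards [hc, hs, sc, h₁, hgx, eventually_eventually_nhds.2 hgx,
      eventually_eventually_nhds.2 hgy, hgy, hhy]
      with x ⟨_, _, s₃, s₄, _, _, s₇, _⟩ ⟨sf, sg⟩ ⟨s₉, s₁₀⟩ e₁ e₂ e₃ e₄ e₅ e₆
    have hfx := HasGrad.of_smooth (smooth_dx sf)
    have gf := HasGrad.of_smooth sf
    have gg := HasGrad.of_smooth sg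
    -- The second derivative f_xx enters through g_y = -fₓ + …, so equality of the mixed derivatives
    -- of g determines it.
    have key := dy_dx sg
    rw [dy_congr e₃, dx_congr e₄, ((((HasGrad.of_smooth s₇).mul hfx).add
      ((HasGrad.of_smooth s₉).mul gf)).add ((HasGrad.of_smooth s₁₀).mul gg)).dy_eq,
      ((hfx.neg.add ((HasGrad.of_smooth s₃).mul gf)).add ((HasGrad.of_smooth s₄).mul gg)).dx_eq,
      e₁, e₂, e₅, e₆] at key
    simp only [q₁, q₂, q₃]
    linear_combination key
  have hsmall := eventually_eq_zero_of_linear_system (v := ![f, g, dx f]) (p := p)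
    (Mx := ![![fun _ => 0, fun _ => 0, fun _ => 1], ![c₃, d₃, σ], ![q₁, q₂, q₃]])
    (My := ![![a₁, b₁, fun _ => 0], ![a₂, b₂, fun _ => -1], ![p₁, p₂, p₃]]) ?_ ?_ ?_ ?_
  · filter_upwards [hsmall] with x hx using ⟨hx 0, hx 1⟩
  all_goals
    obtain ⟨s₁, s₂, s₃, s₄, s₅, s₆, s₇, s₈⟩ := hc.self_of_nhds
    obtain ⟨s₉, s₁₀⟩ := sc.self_of_nhds
    have sp₁ : ContDiffAt ℝ ∞ p₁ p := (smooth_dx s₁).add (s₂.mul s₉)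
    have sp₂ : ContDiffAt ℝ ∞ p₂ p := (smooth_dx s₂).add (s₂.mul s₁₀)
    have sp₃ : ContDiffAt ℝ ∞ p₃ p := s₁.add (s₂.mul s₇)
  · have k₁ : ContDiffAt ℝ ∞ q₁ p := (((((smooth_dx s₃).add (s₄.mul s₉)).sub (s₇.mul sp₁)).sub
      (smooth_dy s₉)).sub (s₉.mul s₁)).sub (s₁₀.mul s₃)
    have k₂ : ContDiffAt ℝ ∞ q₂ p := (((((smooth_dx s₄).add (s₄.mul s₁₀)).sub (s₇.mul sp₂)).sub
      (smooth_dy s₁₀)).sub (s₉.mul s₂)).sub (s₁₀.mul s₄)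
    have k₃ : ContDiffAt ℝ ∞ q₃ p := (((s₃.add (s₄.mul s₇)).sub (smooth_dy s₇)).sub
      (s₇.mul sp₃)).add s₁₀
    intro i j
    fin_cases i <;> fin_cases j
    exacts [continuousAt_const, continuousAt_const, continuousAt_const, s₉.continuousAt,
      s₁₀.continuousAt, s₇.continuousAt, k₁.continuousAt, k₂.continuousAt, k₃.continuousAt]
  · intro i j
    fin_cases i <;> fin_cases j
    exacts [s₁.continuousAt, s₂.continuousAt, continuousAt_const, s₃.continuousAt,
      s₄.continuousAt, continuousAt_const, sp₁.continuousAt, sp₂.continuousAt, sp₃.continuousAt]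
  · filter_upwards [hs, h₁, hgx, hgy, hhx, hhy] with x ⟨sf, sg⟩ e₁ e₂ e₃ e₄ e₅
    intro i
    fin_cases i
    · refine (HasGrad.of_smooth sf).congr_grad ?_ ?_ <;> simp [Fin.sum_univ_three, e₁]
    · refine (HasGrad.of_smooth sg).congr_grad ?_ ?_
      · simp [Fin.sum_univ_three, e₂]; ring
      · simp [Fin.sum_univ_three, e₃]; ring
    · refine (HasGrad.of_smooth (smooth_dx sf)).congr_grad ?_ ?_
      · simp [Fin.sum_univ_three, e₄]
      · simp [Fin.sum_univ_three, e₅]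
  · intro i
    fin_cases i
    exacts [hf, hg, hh]

/-! ### Vectors with two vanishing moments -/

/-- The coefficient of the third moment in Lagrange's formula. -/
def lagrangeB (t : Fin 4 → ℝ) (i : Fin 4) : ℝ := (∏ j ∈ Finset.univ.erase i, (t i - t j))⁻¹

/-- The coefficient of the second moment in Lagrange's formula. -/
def lagrangeA (t : Fin 4 → ℝ) (i : Fin 4) : ℝ := -(∑ j, t j - t i) * lagrangeB t i

theorem lagrangeB_ne_zero {t : Fin 4 → ℝ} (ht : Function.Injective t) (i : Fin 4) :
    lagrangeB t i ≠ 0 :=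
  inv_ne_zero <| Finset.prod_ne_zero_iff.2 fun _ hj =>
    sub_ne_zero.2 fun h => (Finset.ne_of_mem_erase hj) (ht h).symm

/-- Pair `l` with the cubic ∏ (X - tⱼ) over j ≠ i: only the i-th term survives. The coefficients of
degree 0 and 1 meet vanishing moments, and that of degree 2 is -(∑ tⱼ - tᵢ). -/
theorem lagrange_formula {t l : Fin 4 → ℝ} (ht : Function.Injective t) (h₀ : ∑ i, l i = 0)
    (h₁ : ∑ i, l i * t i = 0) (i : Fin 4) :
    l i = lagrangeA t i * ∑ j, l j * t j ^ 2 + lagrangeB t i * ∑ j, l j * t j ^ 3 := by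
  have hB := lagrangeB_ne_zero ht i
  have key : l i * ∏ j ∈ Finset.univ.erase i, (t i - t j) =
      ∑ j, l j * t j ^ 3 - (∑ j, t j - t i) * ∑ j, l j * t j ^ 2 := by
    simp only [Fin.sum_univ_four] at h₀ h₁ ⊢
    fin_cases i
    · change l 0 * ∏ j ∈ Finset.univ.erase 0, (t 0 - t j) = _ - (_ - t 0) * _
      rw [show (Finset.univ : Finset (Fin 4)).erase 0 = {1, 2, 3} by decide]
      rw [Finset.prod_insert (by decide), Finset.prod_insert (by decide), Finset.prod_singleton]
      linear_combination (t 1 * t 2 + t 1 * t 3 + t 2 * t 3) * h₁ - t 1 * t 2 * t 3 * h₀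
    · change l 1 * ∏ j ∈ Finset.univ.erase 1, (t 1 - t j) = _ - (_ - t 1) * _
      rw [show (Finset.univ : Finset (Fin 4)).erase 1 = {0, 2, 3} by decide]
      rw [Finset.prod_insert (by decide), Finset.prod_insert (by decide), Finset.prod_singleton]
      linear_combination (t 0 * t 2 + t 0 * t 3 + t 2 * t 3) * h₁ - t 0 * t 2 * t 3 * h₀
    · change l 2 * ∏ j ∈ Finset.univ.erase 2, (t 2 - t j) = _ - (_ - t 2) * _
      rw [show (Finset.univ : Finset (Fin 4)).erase 2 = {0, 1, 3} by decide]
      rw [Finset.prod_insert (by decide), Finset.prod_insert (by decide), Finset.prod_singleton]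
      linear_combination (t 0 * t 1 + t 0 * t 3 + t 1 * t 3) * h₁ - t 0 * t 1 * t 3 * h₀
    · change l 3 * ∏ j ∈ Finset.univ.erase 3, (t 3 - t j) = _ - (_ - t 3) * _
      rw [show (Finset.univ : Finset (Fin 4)).erase 3 = {0, 1, 2} by decide]
      rw [Finset.prod_insert (by decide), Finset.prod_insert (by decide), Finset.prod_singleton]
      linear_combination (t 0 * t 1 + t 0 * t 2 + t 1 * t 2) * h₁ - t 0 * t 1 * t 2 * h₀
  replace hB := inv_ne_zero hB
  rw [lagrangeB, inv_inv] at hB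
  rw [lagrangeA, lagrangeB]
  field_simp
  linear_combination key

/-- The Vandermonde matrix is invertible, so some vector has moments 0, 0, f, g, and
`lagrange_formula` identifies it. -/
theorem lagrange_moments {t : Fin 4 → ℝ} (ht : Function.Injective t) (f g : ℝ) :
    ∑ i, (lagrangeA t i * f + lagrangeB t i * g) = 0 ∧
    ∑ i, (lagrangeA t i * f + lagrangeB t i * g) * t i = 0 ∧
    ∑ i, (lagrangeA t i * f + lagrangeB t i * g) * t i ^ 2 = f ∧
    ∑ i, (lagrangeA t i * f + lagrangeB t i * g) * t i ^ 3 = g := by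
  have hV : IsUnit (Matrix.vandermonde t) := (Matrix.isUnit_iff_isUnit_det _).2
    (Matrix.det_vandermonde_ne_zero_iff.2 ht).isUnit
  obtain ⟨l, hl⟩ := (Matrix.vecMul_surjective_iff_isUnit.2 hV) ![0, 0, f, g]
  have e : ∀ k : Fin 4, ∑ i, l i * t i ^ (k : ℕ) = ![0, 0, f, g] k := by
    intro k
    rw [← hl]
    simp [Matrix.vecMul, dotProduct, Matrix.vandermonde_apply]
  have e₀ : ∑ i, l i = 0 := by simpa using e 0
  have e₁ : ∑ i, l i * t i = 0 := by simpa using e 1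
  have e₂ : ∑ i, l i * t i ^ 2 = f := by simpa using e 2
  have e₃ : ∑ i, l i * t i ^ 3 = g := by simpa using e 3
  have el : ∀ i, lagrangeA t i * f + lagrangeB t i * g = l i := fun i => by
    rw [lagrange_formula ht e₀ e₁ i, e₂, e₃]
  simp only [el]
  exact ⟨e₀, e₁, e₂, e₃⟩

/-- The moments of a vector-valued function with respect to slopes `s`. -/
def moment (s : Fin 4 → Plane → ℝ) (k : ℕ) (l : Plane → Fin 4 → ℝ) (x : Plane) : ℝ :=
  ∑ i, l x i * s i x ^ k

/-- The failure of the integral curves of `dy - s dx` to be straight. -/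
def burgers (s : Plane → ℝ) (x : Plane) : ℝ := dx s x + s x * dy s x

/-- The divergence expressing that `l (dy - s dx)` is closed. -/
def closedness (s l : Plane → ℝ) (x : Plane) : ℝ := dx l x + s x * dy l x + l x * dy s x

theorem extD_mulForm_slopeForm {s l : Plane → ℝ} {x : Plane} (hs : ContDiffAt ℝ ∞ s x)
    (hl : ContDiffAt ℝ ∞ l x) : extD (mulForm l (slopeForm s)) x = closedness s l x := by
  have gs := HasGrad.of_smooth hs
  have hd : ContDiffAt ℝ ∞ (slopeForm s) x := smooth_mkForm hs.neg contDiffAt_const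
  rw [extD_mulForm (hl.differentiableAt (by simp)) (hd.differentiableAt (by simp)),
    extD_of_hasGrad (α := slopeForm s) (by rw [cx_slopeForm]; exact gs.neg)
      (by rw [cy_slopeForm]; exact .const 1), cx_slopeForm, cy_slopeForm, closedness]
  ring

theorem HasGrad.pow_nat {u : Plane → ℝ} {a b : ℝ} {x : Plane} (hu : HasGrad u a b x) (n : ℕ) :
    HasGrad (fun y => u y ^ n) (n * u x ^ (n - 1) * a) (n * u x ^ (n - 1) * b) x := by
  cases n with
  | zero => simpa using HasGrad.const (x := x) 1
  | succ n => simpa using hu.pow n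

/-! ### Conservation laws for the moments. -/

section Moments

variable {s : Fin 4 → Plane → ℝ} {l : Plane → Fin 4 → ℝ} {x : Plane}

theorem smooth_moment (hs : ∀ i, ContDiffAt ℝ ∞ (s i) x) (hl : ContDiffAt ℝ ∞ l x) (k : ℕ) :
    ContDiffAt ℝ ∞ (moment s k l) x :=
  ContDiffAt.sum fun i _ => (contDiffAt_pi.1 hl i).mul ((hs i).pow k)

/-- Multiply the conservation law of each `l i` by the k-th power of the slope. Since ∂ₓ + s ∂_y
sends sᵏ to k sᵏ⁻¹ times `burgers`, that is the only extra term. For k = 0 the truncated exponent is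
harmless because of the factor k. -/
theorem moment_transport (hs : ∀ i, ContDiffAt ℝ ∞ (s i) x) (hl : ContDiffAt ℝ ∞ l x) (k : ℕ) :
    dx (moment s k l) x + dy (moment s (k + 1) l) x =
      ∑ i, closedness (s i) (fun y => l y i) x * s i x ^ k +
        k * ∑ i, l x i * s i x ^ (k - 1) * burgers (s i) x := by
  have gs := fun i => HasGrad.of_smooth (hs i)
  have gl := fun i => HasGrad.of_smooth (contDiffAt_pi.1 hl i)
  have g := fun k => HasGrad.sum Finset.univ fun i _ => (gl i).mul ((gs i).pow_nat k)
  have e₁ : dx (moment s k l) x = _ := (g k).dx_eq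
  have e₂ : dy (moment s (k + 1) l) x = _ := (g (k + 1)).dy_eq
  rw [e₁, e₂, Finset.mul_sum, ← Finset.sum_add_distrib, ← Finset.sum_add_distrib]
  refine Finset.sum_congr rfl fun i _ => ?_
  rw [closedness, burgers]
  cases k with
  | zero => simp; ring
  | succ k => simp only [Nat.add_sub_cancel]; push_cast; ring

/-- Every slope is a root of the quartic ∏ (X - sⱼ), and its two lowest coefficients multiply
vanishing moments. -/
theorem moment_four (h₀ : moment s 0 l x = 0) (h₁ : moment s 1 l x = 0) : moment s 4 l x =
    (∑ i, s i x) * moment s 3 l x - (s 0 x * s 1 x + s 0 x * s 2 x + s 0 x * s 3 x + s 1 x * s 2 x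
      + s 1 x * s 3 x + s 2 x * s 3 x) * moment s 2 l x := by
  simp only [moment, Fin.sum_univ_four] at *
  linear_combination (s 0 x * s 1 x * s 2 x + s 0 x * s 1 x * s 3 x + s 0 x * s 2 x * s 3 x
    + s 1 x * s 2 x * s 3 x) * h₁ - s 0 x * s 1 x * s 2 x * s 3 x * h₀

end Moments

/-- The second elementary symmetric function of the slopes. -/
def slopeE₂ (s : Fin 4 → Plane → ℝ) (x : Plane) : ℝ :=
  s 0 x * s 1 x + s 0 x * s 2 x + s 0 x * s 3 x + s 1 x * s 2 x + s 1 x * s 3 x + s 2 x * s 3 x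

/-- The sum of the slopes. -/
def slopeSum (s : Fin 4 → Plane → ℝ) (x : Plane) : ℝ := ∑ i, s i x

end PlanarWeb

/-! ### Abelian relations in terms of moments, and the bound three for the rank. -/

namespace FourWeb

open PlanarWeb

/-- The `i`-th foliation of the web is `dy = sᵢ dx`. -/
def HasSlopes (S : FourWeb) (s : Fin 4 → Plane → ℝ) : Prop := ∀ i, S.form i = slopeForm (s i)

namespace HasSlopes

variable {S : FourWeb} {s : Fin 4 → Plane → ℝ} {x p : Plane} {l : Plane → Fin 4 → ℝ}

theorem smooth (h : S.HasSlopes s) (hx : x ∈ S.U) (i : Fin 4) : ContDiffAt ℝ ∞ (s i) x := by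
  have := (smooth_cx (S.smooth_form i hx)).neg
  rw [h i, cx_slopeForm] at this
  simpa using this

theorem injective (h : S.HasSlopes s) (hx : x ∈ S.U) : Function.Injective fun i => s i x := by
  intro i j hij
  by_contra hne
  have := S.generalPosition i j hne x hx
  rw [h i, h j, wedge_slopeForm] at this
  exact this (sub_eq_zero.2 hij.symm)

theorem smooth_lagrangeB (h : S.HasSlopes s) (hx : x ∈ S.U) (i : Fin 4) :
    ContDiffAt ℝ ∞ (fun y => lagrangeB (fun j => s j y) i) x := by
  refine ContDiffAt.inv (contDiffAt_prod fun j _ => (h.smooth hx i).sub (h.smooth hx j)) ?_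
  exact fun h0 => lagrangeB_ne_zero (h.injective hx) i (by simp [lagrangeB, h0])

theorem smooth_slopeSum (h : S.HasSlopes s) (hx : x ∈ S.U) : ContDiffAt ℝ ∞ (slopeSum s) x :=
  ContDiffAt.sum fun j _ => h.smooth hx j

theorem smooth_slopeE₂ (h : S.HasSlopes s) (hx : x ∈ S.U) : ContDiffAt ℝ ∞ (slopeE₂ s) x := by
  have := h.smooth hx
  exact (((((((this 0).mul (this 1)).add ((this 0).mul (this 2))).add ((this 0).mul (this 3))).add
    ((this 1).mul (this 2))).add ((this 1).mul (this 3))).add ((this 2).mul (this 3)))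

theorem smooth_lagrangeA (h : S.HasSlopes s) (hx : x ∈ S.U) (i : Fin 4) :
    ContDiffAt ℝ ∞ (fun y => lagrangeA (fun j => s j y) i) x :=
  (((h.smooth_slopeSum hx).sub (h.smooth hx i)).neg).mul (h.smooth_lagrangeB hx i)

theorem smooth_burgers (h : S.HasSlopes s) (hx : x ∈ S.U) (i : Fin 4) :
    ContDiffAt ℝ ∞ (burgers (s i)) x :=
  (smooth_dx (h.smooth hx i)).add ((h.smooth hx i).mul (smooth_dy (h.smooth hx i)))

/-- The sum Σ λᵢ (dy - sᵢ dx) equals m₀ dy - m₁ dx. -/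
theorem abelianEqAt_iff (h : S.HasSlopes s) (hx : x ∈ S.U) : S.AbelianEqAt l x ↔
    ContDiffAt ℝ ∞ l x ∧ moment s 0 l x = 0 ∧ moment s 1 l x = 0 ∧
      ∀ i, closedness (s i) (fun y => l y i) x = 0 := by
  refine and_congr_right fun hl => ?_
  have hc : ∀ i, extD (mulForm (fun y => l y i) (S.form i)) x
      = closedness (s i) (fun y => l y i) x := fun i => by
    rw [h i, extD_mulForm_slopeForm (h.smooth hx i) (contDiffAt_pi.1 hl i)]
  simp only [hc, ← and_assoc]
  refine and_congr_left fun _ => ?_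
  have e : ∀ v : Plane, (∑ i, l x i • S.form i x) v
      = moment s 0 l x * v.2 - moment s 1 l x * v.1 := by
    intro v
    simp only [moment, sum_apply, smul_apply, smul_eq_mul, h _, slopeForm_apply, Finset.sum_mul,
      ← Finset.sum_sub_distrib]
    exact Finset.sum_congr rfl fun i _ => by ring
  constructor
  · intro h0
    have e₁ := e (0, 1)
    have e₂ := e (1, 0)
    rw [h0] at e₁ e₂
    simp only [zero_apply] at e₁ e₂
    exact ⟨by linarith, by linarith⟩
  · rintro ⟨h₀, h₁⟩
    refine ContinuousLinearMap.ext fun v => ?_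
    rw [e, h₀, h₁, zero_apply]
    ring

section System

variable (h : S.HasSlopes s) (hx : x ∈ S.U) (hl : ∀ᶠ y in 𝓝 x, S.AbelianEqAt l y)
include h hx hl

theorem eventually_moments : ∀ᶠ y in 𝓝 x, moment s 0 l y = 0 ∧ moment s 1 l y = 0 := by
  filter_upwards [S.isOpen_U.mem_nhds hx, hl] with y hy hly
  exact ⟨((h.abelianEqAt_iff hy).1 hly).2.1, ((h.abelianEqAt_iff hy).1 hly).2.2.1⟩

theorem moment_eq_burgers (k : ℕ) : dx (moment s k l) x + dy (moment s (k + 1) l) x =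
    k * ∑ i, l x i * s i x ^ (k - 1) * burgers (s i) x := by
  obtain ⟨sl, -, -, hE⟩ := (h.abelianEqAt_iff hx).1 hl.self_of_nhds
  rw [moment_transport (h.smooth hx) sl]
  simp [hE]

theorem dy_moment_two : dy (moment s 2 l) x = ∑ i, l x i * burgers (s i) x := by
  have := h.moment_eq_burgers hx hl 1
  rw [dx_congr ((h.eventually_moments hx hl).mono fun y hy => hy.2 :
    moment s 1 l =ᶠ[𝓝 x] fun _ => 0), (HasGrad.const (0 : ℝ)).dx_eq] at this
  simpa using this

theorem dx_moment_two_add : dx (moment s 2 l) x + dy (moment s 3 l) x =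
    2 * ∑ i, l x i * s i x * burgers (s i) x := by
  simpa using h.moment_eq_burgers hx hl 2

theorem dx_moment_three_add : dx (moment s 3 l) x +
    dy (fun y => slopeSum s y * moment s 3 l y - slopeE₂ s y * moment s 2 l y) x =
    3 * ∑ i, l x i * s i x ^ 2 * burgers (s i) x := by
  have := h.moment_eq_burgers hx hl 3
  rw [dy_congr ((h.eventually_moments hx hl).mono fun y hy => moment_four hy.1 hy.2 :
    moment s (3 + 1) l =ᶠ[𝓝 x]
      fun y => slopeSum s y * moment s 3 l y - slopeE₂ s y * moment s 2 l y)] at this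
  simpa using this

theorem eq_lagrange (i : Fin 4) : l x i = lagrangeA (fun j => s j x) i * moment s 2 l x +
    lagrangeB (fun j => s j x) i * moment s 3 l x := by
  obtain ⟨h₀, h₁⟩ := (h.eventually_moments hx hl).self_of_nhds
  exact lagrange_formula (h.injective hx) (by simpa [moment] using h₀)
    (by simpa [moment] using h₁) i

theorem sum_eq_lagrange (c : Fin 4 → ℝ) : ∑ i, l x i * c i =
    (∑ i, lagrangeA (fun j => s j x) i * c i) * moment s 2 l x +
    (∑ i, lagrangeB (fun j => s j x) i * c i) * moment s 3 l x := by
  rw [Finset.sum_mul, Finset.sum_mul, ← Finset.sum_add_distrib]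
  refine Finset.sum_congr rfl fun i _ => ?_
  rw [h.eq_lagrange hx hl i]
  ring

end System

/-- An abelian relation with vanishing jet at `p` vanishes near `p`. -/
theorem eventually_eq_zero (h : S.HasSlopes s) (hp : p ∈ S.U)
    (hl : ∀ᶠ y in 𝓝 p, S.AbelianEqAt l y) (hf : moment s 2 l p = 0) (hg : moment s 3 l p = 0)
    (hh : dx (moment s 2 l) p = 0) : l =ᶠ[𝓝 p] 0 := by
  have hU := S.isOpen_U.mem_nhds hp
  have hll := eventually_eventually_nhds.2 hl
  let A : Fin 4 → Plane → ℝ := fun i x => lagrangeA (fun j => s j x) i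
  let B : Fin 4 → Plane → ℝ := fun i x => lagrangeB (fun j => s j x) i
  have key := eventually_eq_zero_of_moment_system (f := moment s 2 l) (g := moment s 3 l) (p := p)
    (a₁ := fun x => ∑ i, A i x * burgers (s i) x) (b₁ := fun x => ∑ i, B i x * burgers (s i) x)
    (a₂ := fun x => 2 * ∑ i, A i x * (s i x * burgers (s i) x))
    (b₂ := fun x => 2 * ∑ i, B i x * (s i x * burgers (s i) x))
    (a₃ := fun x => 3 * ∑ i, A i x * (s i x ^ 2 * burgers (s i) x))
    (b₃ := fun x => 3 * ∑ i, B i x * (s i x ^ 2 * burgers (s i) x))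
    (σ := slopeSum s) (τ := slopeE₂ s) ?_ ?_ ?_ ?_ ?_ hf hg hh
  · filter_upwards [hU, hll, key] with x hx hlx ⟨k₁, k₂⟩
    funext i
    rw [h.eq_lagrange hx hlx i, k₁, k₂]
    simp
  · filter_upwards [hU] with x hx
    have sA : ∀ i, ContDiffAt ℝ ∞ (A i) x := h.smooth_lagrangeA hx
    have sB : ∀ i, ContDiffAt ℝ ∞ (B i) x := h.smooth_lagrangeB hx
    have sb := h.smooth_burgers hx
    have ss := h.smooth hx
    exact ⟨ContDiffAt.sum fun i _ => (sA i).mul (sb i), ContDiffAt.sum fun i _ => (sB i).mul (sb i),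
      contDiffAt_const.mul (ContDiffAt.sum fun i _ => (sA i).mul ((ss i).mul (sb i))),
      contDiffAt_const.mul (ContDiffAt.sum fun i _ => (sB i).mul ((ss i).mul (sb i))),
      contDiffAt_const.mul (ContDiffAt.sum fun i _ => (sA i).mul (((ss i).pow 2).mul (sb i))),
      contDiffAt_const.mul (ContDiffAt.sum fun i _ => (sB i).mul (((ss i).pow 2).mul (sb i))),
      h.smooth_slopeSum hx, h.smooth_slopeE₂ hx⟩
  · filter_upwards [hU, hl] with x hx hlx
    exact ⟨smooth_moment (h.smooth hx) hlx.1 2, smooth_moment (h.smooth hx) hlx.1 3⟩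
  · filter_upwards [hU, hll] with x hx hlx
    rw [h.dy_moment_two hx hlx, h.sum_eq_lagrange hx hlx]
  · filter_upwards [hU, hll] with x hx hlx
    rw [h.dx_moment_two_add hx hlx]
    simp only [mul_assoc]
    rw [h.sum_eq_lagrange hx hlx, mul_add]
  · filter_upwards [hU, hll] with x hx hlx
    rw [h.dx_moment_three_add hx hlx]
    simp only [mul_assoc]
    rw [h.sum_eq_lagrange hx hlx, mul_add]

/-- The data that determine an abelian relation near `p`. -/
def jet (s : Fin 4 → Plane → ℝ) (l : Plane → Fin 4 → ℝ) (p : Plane) : Fin 3 → ℝ :=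
  ![moment s 2 l p, moment s 3 l p, dx (moment s 2 l) p]

theorem jet_congr {m : Plane → Fin 4 → ℝ} (e : l =ᶠ[𝓝 p] m) : jet s l p = jet s m p := by
  have e' : ∀ k, moment s k l =ᶠ[𝓝 p] moment s k m := fun k => by
    filter_upwards [e] with y hy
    simp [moment, hy]
  simp [jet, (e' 2).self_of_nhds, (e' 3).self_of_nhds, dx_congr (e' 2)]

theorem jet_add (h : S.HasSlopes s) (hp : p ∈ S.U) {m : Plane → Fin 4 → ℝ}
    (hl : ContDiffAt ℝ ∞ l p) (hm : ContDiffAt ℝ ∞ m p) :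
    jet s (l + m) p = jet s l p + jet s m p := by
  have e : ∀ k, moment s k (l + m) = fun y => moment s k l y + moment s k m y := fun k => by
    funext y
    simp [moment, add_mul, Finset.sum_add_distrib]
  have g := (HasGrad.of_smooth (smooth_moment (h.smooth hp) hl 2)).add
    (HasGrad.of_smooth (smooth_moment (h.smooth hp) hm 2))
  simp [jet, e, g.dx_eq]

theorem jet_smul (h : S.HasSlopes s) (hp : p ∈ S.U) (c : ℝ) (hl : ContDiffAt ℝ ∞ l p) :
    jet s (c • l) p = c • jet s l p := by
  have e : ∀ k, moment s k (c • l) = fun y => c * moment s k l y := fun k => by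
    funext y
    simp [moment, Finset.mul_sum, mul_assoc]
  have g := (HasGrad.const c).mul (HasGrad.of_smooth (smooth_moment (h.smooth hp) hl 2))
  simp [jet, e, g.dx_eq]

/-- The rank is three if and only if abelian relations with arbitrary jets exist. -/
theorem rank_eq_three_iff (h : S.HasSlopes s) (hp : p ∈ S.U) : S.rank p hp = 3 ↔
    ∀ c : Fin 3 → ℝ, ∃ l, (∀ᶠ x in 𝓝 p, S.AbelianEqAt l x) ∧ jet s l p = c := by
  -- A representative is chosen for each germ; `jet_congr` makes the jet independent of this choice,
  -- so it is linear on germs.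
  choose r hr hra using fun g : S.abelianGerms p hp => g.2
  have hrl : ∀ (g : S.abelianGerms p hp) (l : Plane → Fin 4 → ℝ), g.1 = l → r g =ᶠ[𝓝 p] l :=
    fun g l hgl => Filter.Germ.coe_eq.1 ((hr g).symm.trans hgl)
  let J : S.abelianGerms p hp →ₗ[ℝ] (Fin 3 → ℝ) :=
    { toFun := fun g => jet s (r g) p
      map_add' := fun g g' => by
        rw [← h.jet_add hp (hra g).self_of_nhds.1 (hra g').self_of_nhds.1]
        refine jet_congr (hrl _ _ ?_)
        rw [Submodule.coe_add, hr g, hr g']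
        rfl
      map_smul' := fun c g => by
        rw [RingHom.id_apply, ← h.jet_smul hp c (hra g).self_of_nhds.1]
        refine jet_congr (hrl _ _ ?_)
        rw [Submodule.coe_smul, hr g]
        rfl }
  have hJ : Function.Injective J := by
    refine (injective_iff_map_eq_zero J).2 fun g hg => ?_
    have e := h.eventually_eq_zero hp (hra g) (congrFun hg 0) (congrFun hg 1) (congrFun hg 2)
    exact Subtype.ext ((hr g).trans (Filter.Germ.coe_eq.2 e))
  have hfin := LinearMap.finrank_range_of_inj hJ
  -- The rank is the dimension of the range of an injective map into ℝ³.
  have hsurj : S.rank p hp = 3 ↔ Function.Surjective J := by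
    rw [rank, ← hfin, ← LinearMap.range_eq_top]
    constructor
    · intro h3
      exact Submodule.eq_top_of_finrank_eq (by rw [h3, Module.finrank_fin_fun])
    · intro ht
      rw [ht, finrank_top, Module.finrank_fin_fun]
  rw [hsurj]
  constructor
  · intro hs c
    obtain ⟨g, hg⟩ := hs c
    exact ⟨r g, hra g, hg⟩
  · intro hs c
    obtain ⟨l, hl, hc⟩ := hs c
    refine ⟨⟨(l : Filter.Germ (𝓝 p) _), l, rfl, hl⟩, ?_⟩
    rw [← hc]
    exact jet_congr (hrl _ _ rfl)

end HasSlopes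

end FourWeb

/-! ### Rank three implies linearizability. -/

namespace PlanarWeb

theorem exists_equiv_of_jac_ne_zero {Φ : Plane → Plane} {x : Plane} (h : DifferentiableAt ℝ Φ x)
    (hj : jac Φ x ≠ 0) : ∃ e : Plane ≃L[ℝ] Plane, HasFDerivAt Φ (e : Plane →L[ℝ] Plane) x := by
  have hinj : Function.Injective (fderiv ℝ Φ x : Plane →ₗ[ℝ] Plane) := by
    refine (injective_iff_map_eq_zero _).2 fun v hv => ?_
    rw [ContinuousLinearMap.coe_coe, fderiv_eq h, Prod.mk_eq_zero] at hv
    have h₁ : jac Φ x * v.1 = 0 := by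
      rw [jac]
      linear_combination dy (fun y => (Φ y).2) x * hv.1 - dy (fun y => (Φ y).1) x * hv.2
    have h₂ : jac Φ x * v.2 = 0 := by
      rw [jac]
      linear_combination dx (fun y => (Φ y).1) x * hv.2 - dx (fun y => (Φ y).2) x * hv.1
    exact Prod.ext ((mul_eq_zero.1 h₁).resolve_left hj) ((mul_eq_zero.1 h₂).resolve_left hj)
  refine ⟨(LinearEquiv.ofInjectiveEndo _ hinj).toContinuousLinearEquiv, ?_⟩
  convert h.hasFDerivAt using 1
  ext <;> rfl

/-- The inverse function theorem in the smooth category, with a prescribed neighbourhood. -/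
theorem exists_local_diffeomorphism {Φ : Plane → Plane} {p : Plane} {P : Plane → Prop}
    (hs : ∀ᶠ x in 𝓝 p, ContDiffAt ℝ ∞ Φ x) (hj : jac Φ p ≠ 0) (hP : ∀ᶠ x in 𝓝 p, P x) :
    ∃ φ : OpenPartialHomeomorph Plane Plane, p ∈ φ.source ∧ (φ : Plane → Plane) = Φ ∧
      (∀ x ∈ φ.source, P x ∧ ContDiffAt ℝ ∞ Φ x ∧ jac Φ x ≠ 0) ∧
      ContDiffOn ℝ ∞ φ.symm φ.target := by
  have hp := hs.self_of_nhds
  obtain ⟨e, he⟩ := exists_equiv_of_jac_ne_zero (hp.differentiableAt (by simp)) hj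
  obtain ⟨O, hO, hOo, hpO⟩ := eventually_nhds_iff.1
    (hP.and (hs.and ((smooth_jac hp).continuousAt.eventually_ne hj)))
  refine ⟨(hp.toOpenPartialHomeomorph Φ he (by simp)).restrOpen O hOo,
    ⟨hp.mem_toOpenPartialHomeomorph_source he (by simp), hpO⟩, rfl, fun x hx => hO x hx.2, ?_⟩
  intro y hy
  set φ := (hp.toOpenPartialHomeomorph Φ he (by simp)).restrOpen O hOo
  have hx := hO _ (φ.map_target hy).2
  obtain ⟨e', he'⟩ := exists_equiv_of_jac_ne_zero (hx.2.1.differentiableAt (by simp)) hx.2.2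
  exact (φ.contDiffAt_symm hy he' hx.2.1).contDiffWithinAt

end PlanarWeb

namespace FourWeb

open PlanarWeb

namespace HasSlopes

variable {S : FourWeb} {s : Fin 4 → Plane → ℝ} {p : Plane}

/-- A diffeomorphism that takes each leaf into a line with coefficients `l 0 · i, l 1 · i, l 2 · i`,
given by three abelian relations, straightens the web. -/
theorem isLinearizableAt_of_lines (h : S.HasSlopes s) {Φ : Plane → Plane}
    {l : Fin 3 → Plane → Fin 4 → ℝ} (hs : ∀ᶠ x in 𝓝 p, ContDiffAt ℝ ∞ Φ x) (hj : jac Φ p ≠ 0)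
    (hU : p ∈ S.U) (hl : ∀ k, ∀ᶠ x in 𝓝 p, S.AbelianEqAt (l k) x)
    (h1 : ∀ i, l 1 p i ≠ 0)
    (hline : ∀ᶠ x in 𝓝 p, ∀ i, (Φ x).1 * l 0 x i + (Φ x).2 * l 1 x i + l 2 x i = 0) :
    S.IsLinearizableAt p := by
  have h1' : ∀ᶠ x in 𝓝 p, ∀ i, l 1 x i ≠ 0 := Filter.eventually_all.2 fun i =>
    (contDiffAt_pi.1 (hl 1).self_of_nhds.1 i).continuousAt.eventually_ne (h1 i)
  have hU' : ∀ᶠ x in 𝓝 p, x ∈ S.U := S.isOpen_U.mem_nhds hU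
  obtain ⟨φ, hpφ, rfl, hφ, hφs⟩ := exists_local_diffeomorphism hs hj
    (hU'.and ((Filter.eventually_all.2 hl).and (h1'.and (eventually_eventually_nhds.2 hline))))
  -- The leaf through a point lies on the line X λ⁰ᵢ + Y λ¹ᵢ + λ²ᵢ = 0 with fixed coefficients,
  -- whose conormal is λ⁰ᵢ dX + λ¹ᵢ dY.
  let θ : Fin 4 → OneForm := fun i =>
    mkForm (fun y => l 0 (φ.symm y) i) (fun y => l 1 (φ.symm y) i)
  have sψ : ∀ y ∈ φ.target, ContDiffAt ℝ ∞ φ.symm y := fun y hy =>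
    hφs.contDiffAt (φ.open_target.mem_nhds hy)
  have hA : ∀ k, ∀ x ∈ φ.source, ContDiffAt ℝ ∞ (l k) x ∧
      ∀ i, closedness (s i) (fun y => l k y i) x = 0 := fun k x hx =>
    have := (h.abelianEqAt_iff (hφ x hx).1.1).1 ((hφ x hx).1.2.1 k)
    ⟨this.1, this.2.2.2⟩
  have sl : ∀ k i, ∀ x ∈ φ.source, ContDiffAt ℝ ∞ (fun y => l k y i) x := fun k i x hx =>
    contDiffAt_pi.1 (hA k x hx).1 i
  have sθ : ∀ i, ∀ y ∈ φ.target, ContDiffAt ℝ ∞ (θ i) y := fun i y hy =>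
    smooth_mkForm ((sl 0 i _ (φ.map_target hy)).comp y (sψ y hy))
      ((sl 1 i _ (φ.map_target hy)).comp y (sψ y hy))
  have hdiff : ∀ x ∈ φ.source, DifferentiableAt ℝ φ x := fun x hx =>
    (hφ x hx).2.1.differentiableAt (by simp)
  have hcomp : ∀ i, ∀ x ∈ φ.source, cx (θ i) (φ x) = l 0 x i ∧ cy (θ i) (φ x) = l 1 x i := by
    intro i x hx
    simp [θ, φ.left_inv hx]
  -- Differentiate the line equation along (1, sᵢ). All three coefficients satisfy the same
  -- transport equation, so their derivatives contribute a multiple of the line equation itself,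
  -- that is, nothing.
  have hpull : ∀ i, ∀ x ∈ φ.source, cx (pull φ (θ i)) x = -(s i x) * cy (pull φ (θ i)) x := by
    intro i x hx
    rw [cx_pull (hdiff x hx), cy_pull (hdiff x hx), (hcomp i x hx).1, (hcomp i x hx).2]
    have g := fun k => HasGrad.of_smooth (sl k i x hx)
    have gX := hasGrad_fst (hdiff x hx)
    have gY := hasGrad_snd (hdiff x hx)
    have gl := ((gX.mul (g 0)).add (gY.mul (g 1))).add (g 2)
    have hz : (fun y => (φ y).1 * l 0 y i + (φ y).2 * l 1 y i + l 2 y i) =ᶠ[𝓝 x] fun _ => 0 := by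
      filter_upwards [(hφ x hx).1.2.2.2] with y hy using hy i
    have e₁ := gl.dx_eq.symm.trans ((dx_congr hz).trans (HasGrad.const 0).dx_eq)
    have e₂ := gl.dy_eq.symm.trans ((dy_congr hz).trans (HasGrad.const 0).dy_eq)
    have e₃ := hz.self_of_nhds
    have c := fun k => (hA k x hx).2 i
    simp only [closedness] at c
    linear_combination e₁ + s i x * e₂ + dy (s i) x * e₃ - (φ x).1 * c 0 - (φ x).2 * c 1 - c 2
  have hpull0 : ∀ i, ∀ x ∈ φ.source, cy (pull φ (θ i)) x ≠ 0 := by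
    intro i x hx h0
    have h0' := hpull i x hx
    rw [h0, mul_zero, cx_pull (hdiff x hx), (hcomp i x hx).1, (hcomp i x hx).2] at h0'
    rw [cy_pull (hdiff x hx), (hcomp i x hx).1, (hcomp i x hx).2] at h0
    have hz : jac φ x * l 1 x i = 0 := by
      rw [jac]
      linear_combination dx (fun y => (φ y).1) x * h0 - dy (fun y => (φ y).1) x * h0'
    exact mul_ne_zero (hφ x hx).2.2 ((hφ x hx).1.2.2.1 i) hz
  let W' : FourWeb :=
    { U := φ.target
      isOpen_U := φ.open_target
      form := θ
      smooth := fun i y hy => (sθ i y hy).contDiffWithinAt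
      generalPosition := by
        intro i j hij y hy h0
        have hx := φ.map_target hy
        have hw := wedge_pull (α := θ i) (β := θ j) (hdiff _ hx)
        rw [φ.right_inv hy, h0, mul_zero, wedge_eq, hpull i _ hx, hpull j _ hx] at hw
        have hne : s j (φ.symm y) - s i (φ.symm y) ≠ 0 := sub_ne_zero.2 fun he =>
          hij ((h.injective (hφ _ hx).1.1) he).symm
        refine mul_ne_zero (mul_ne_zero hne (hpull0 i _ hx)) (hpull0 j _ hx) ?_
        linear_combination hw }
  have heq : S.IsEquiv W' φ :=
    { source_subset := fun x hx => (hφ x hx).1.1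
      target_subset := subset_rfl
      contDiffOn := fun x hx => (hφ x hx).2.1.contDiffWithinAt
      contDiffOn_symm := hφs
      kernel := by
        intro i x hx v
        change _ ↔ pull φ (θ i) x v = 0
        rw [h i, slopeForm_apply, form_apply, hpull i x hx]
        constructor
        · intro e
          linear_combination cy (pull φ (θ i)) x * e
        · intro e
          refine (mul_eq_zero.1 (?_ : cy (pull φ (θ i)) x * _ = 0)).resolve_left (hpull0 i x hx)
          linear_combination e }
  refine ⟨W', isLinear_of_bend fun i y hy => ?_, isEquivalentAt_iff.2 ⟨φ, hpφ, heq⟩⟩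
  have hy' : y ∈ φ.target := hy
  have hx := φ.map_target hy'
  set x := φ.symm y with hxdef
  have dψ := (sψ y hy').differentiableAt (by simp : (∞ : WithTop ℕ∞) ≠ 0)
  have g : ∀ k, HasGrad (fun z => l k (φ.symm z) i)
      (dx (fun z => l k z i) x * dx (fun z => (φ.symm z).1) y +
        dy (fun z => l k z i) x * dx (fun z => (φ.symm z).2) y)
      (dx (fun z => l k z i) x * dy (fun z => (φ.symm z).1) y +
        dy (fun z => l k z i) x * dy (fun z => (φ.symm z).2) y) y := fun k =>
    (HasGrad.of_smooth (sl k i x hx)).comp (hasGrad_fst dψ) (hasGrad_snd dψ)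
  -- The line direction pulls back to the leaf direction. There λ⁰ᵢ and λ¹ᵢ satisfy the same
  -- transport equation, so their ratio is constant and `bend` vanishes.
  have hv := (heq.kernel i x hx (fderiv ℝ φ.symm y (l 1 x i, -l 0 x i))).2 (by
    rw [heq.fderiv_comp_symm hy', form_apply]
    change cx (θ i) (φ x) * _ + cy (θ i) (φ x) * _ = 0
    rw [(hcomp i x hx).1, (hcomp i x hx).2]
    ring)
  rw [h i, slopeForm_apply, fderiv_eq dψ] at hv
  have c := fun k => (hA k x hx).2 i
  simp only [closedness] at c
  change bend (θ i) y = 0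
  rw [bend, cx_mkForm, cy_mkForm, (g 0).dx_eq, (g 0).dy_eq, (g 1).dx_eq, (g 1).dy_eq]
  simp only [← hxdef]
  dsimp only at hv
  set a := dx (fun y => (φ.symm y).1) y
  set b := dy (fun y => (φ.symm y).1) y
  set v := a * l 1 x i - b * l 0 x i
  linear_combination (l 1 x i * dy (fun y => l 0 y i) x - l 0 x i * dy (fun y => l 1 y i) x) * hv
    + l 1 x i * v * c 0 - l 0 x i * v * c 1

/-- A web of rank three is linearizable. -/
theorem isLinearizableAt_of_rank (h : S.HasSlopes s) (hp : p ∈ S.U) (h3 : S.rank p hp = 3) :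
    S.IsLinearizableAt p := by
  choose l hl hjet using fun k : Fin 3 => (h.rank_eq_three_iff hp).1 h3 (Pi.single k 1)
  have hl' := fun k => eventually_eventually_nhds.2 (hl k)
  set f : Fin 3 → Plane → ℝ := fun k => moment s 2 (l k) with hf
  set g : Fin 3 → Plane → ℝ := fun k => moment s 3 (l k) with hg
  have jf : ∀ k, f k p = (Pi.single k 1 : Fin 3 → ℝ) 0 := fun k => congrFun (hjet k) 0
  have jg : ∀ k, g k p = (Pi.single k 1 : Fin 3 → ℝ) 1 := fun k => congrFun (hjet k) 1
  have jh : ∀ k, dx (f k) p = (Pi.single k 1 : Fin 3 → ℝ) 2 := fun k => congrFun (hjet k) 2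
  have sf : ∀ᶠ x in 𝓝 p, ∀ k, ContDiffAt ℝ ∞ (f k) x ∧ ContDiffAt ℝ ∞ (g k) x := by
    filter_upwards [S.isOpen_U.mem_nhds hp, Filter.eventually_all.2 hl] with x hx hlx k
    exact ⟨smooth_moment (h.smooth hx) (hlx k).1 2, smooth_moment (h.smooth hx) (hlx k).1 3⟩
  have hf2y : dy (f 2) p = 0 := by
    have := h.dy_moment_two hp (hl 2)
    rw [h.sum_eq_lagrange hp (hl 2)] at this
    refine this.trans ?_
    change _ * f 2 p + _ * g 2 p = 0
    rw [jf, jg]; simp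
  have hg2y : dy (g 2) p = -1 := by
    have := h.dx_moment_two_add hp (hl 2)
    simp only [mul_assoc] at this
    rw [h.sum_eq_lagrange hp (hl 2)] at this
    change dx (f 2) p + dy (g 2) p = 2 * (_ * f 2 p + _ * g 2 p) at this
    rw [jf, jg, jh] at this
    simp at this
    linarith
  -- The cross product of the vectors (fₖ) and (gₖ) is orthogonal to both, hence gives the
  -- coefficients of a linear relation among the three abelian relations.
  let c₀ : Plane → ℝ := fun x => f 1 x * g 2 x - f 2 x * g 1 x
  let c₁ : Plane → ℝ := fun x => f 2 x * g 0 x - f 0 x * g 2 x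
  let c₂ : Plane → ℝ := fun x => f 0 x * g 1 x - f 1 x * g 0 x
  have hc₂p : c₂ p ≠ 0 := by simp [c₂, jf, jg]
  have sc : ∀ᶠ x in 𝓝 p, ContDiffAt ℝ ∞ c₀ x ∧ ContDiffAt ℝ ∞ c₁ x ∧ ContDiffAt ℝ ∞ c₂ x := by
    filter_upwards [sf] with x hx
    exact ⟨((hx 1).1.mul (hx 2).2).sub ((hx 2).1.mul (hx 1).2),
      ((hx 2).1.mul (hx 0).2).sub ((hx 0).1.mul (hx 2).2),
      ((hx 0).1.mul (hx 1).2).sub ((hx 1).1.mul (hx 0).2)⟩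
  have hc₂ : ∀ᶠ x in 𝓝 p, c₂ x ≠ 0 := sc.self_of_nhds.2.2.continuousAt.eventually_ne hc₂p
  refine h.isLinearizableAt_of_lines (Φ := fun x => (c₀ x / c₂ x, c₁ x / c₂ x)) (l := l) ?_ ?_ hp
    hl ?_ ?_
  · filter_upwards [sc, hc₂] with x hx h0
    exact (hx.1.div hx.2.2 h0).prodMk (hx.2.1.div hx.2.2 h0)
  -- At `p` the vectors (fₖ), (gₖ), (∂ₓfₖ) are the standard basis, while ∂_y f₂ = 0 and ∂_y g₂ = -1;
  -- the Jacobian is therefore -1.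
  · have k := sf.self_of_nhds
    have gf := fun i => HasGrad.of_smooth (k i).1
    have gg := fun i => HasGrad.of_smooth (k i).2
    have g₀ := ((gf 1).mul (gg 2)).sub ((gf 2).mul (gg 1))
    have g₁ := ((gf 2).mul (gg 0)).sub ((gf 0).mul (gg 2))
    have g₂ := ((gf 0).mul (gg 1)).sub ((gf 1).mul (gg 0))
    have e₀ := g₀.div g₂ hc₂p
    have e₁ := g₁.div g₂ hc₂p
    rw [jac, e₀.dx_eq, e₀.dy_eq, e₁.dx_eq, e₁.dy_eq]
    simp [jf, jg, jh, hf2y, hg2y]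
  · intro i
    rw [h.eq_lagrange hp (hl 1) i]
    change _ * f 1 p + _ * g 1 p ≠ 0
    rw [jf, jg]
    simpa using lagrangeB_ne_zero (h.injective hp) i
  · filter_upwards [S.isOpen_U.mem_nhds hp, Filter.eventually_all.2 hl', hc₂] with x hx hlx h0 i
    rw [h.eq_lagrange hx (hlx 0) i, h.eq_lagrange hx (hlx 1) i, h.eq_lagrange hx (hlx 2) i]
    change c₀ x / c₂ x * (_ * f 0 x + _ * g 0 x) + c₁ x / c₂ x * (_ * f 1 x + _ * g 1 x)
      + (_ * f 2 x + _ * g 2 x) = 0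
    field_simp
    simp only [c₀, c₁, c₂]
    ring

end HasSlopes

end FourWeb

/-! ### Curvature of 3-webs of straight lines, and primitives. -/

namespace PlanarWeb

section LinearThreeWeb

theorem cx_add (α β : OneForm) (x : Plane) : cx (α + β) x = cx α x + cx β x := rfl

theorem cy_add (α β : OneForm) (x : Plane) : cy (α + β) x = cy α x + cy β x := rfl

theorem cx_dForm (u : Plane → ℝ) : cx (dForm u) = dx u := cx_mkForm _ _

theorem cy_dForm (u : Plane → ℝ) : cy (dForm u) = dy u := cy_mkForm _ _

variable {p q r : Plane → ℝ} {x : Plane}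

theorem extD_normalized_slopeForm {u : Plane → ℝ} {G : OneForm} {A B : ℝ}
    (hp : ContDiffAt ℝ ∞ p x) (hu : ContDiffAt ℝ ∞ u x) (hA : cx G x = A) (hB : cy G x = B)
    (h : dx u x + p x * dy u x + u x * dy p x = -(u x * (A + p x * B))) :
    extD (mulForm u (slopeForm p)) x = wedge (mulForm u (slopeForm p)) G x := by
  rw [extD_mulForm_slopeForm hp hu, closedness, h, wedge_eq, hA, hB, cx_mulForm, cy_mulForm,
    cx_slopeForm, cy_slopeForm]
  ring

/-- The curvature form of a `3`-web of straight lines. -/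
theorem curvatureForm₃_slopeForm (hs : ∀ᶠ y in 𝓝 x, ContDiffAt ℝ ∞ p y ∧ ContDiffAt ℝ ∞ q y ∧
      ContDiffAt ℝ ∞ r y) (hb : ∀ᶠ y in 𝓝 x, burgers p y = 0 ∧ burgers q y = 0 ∧ burgers r y = 0)
    (hpq : p x ≠ q x) (hqr : q x ≠ r x) (hrp : r x ≠ p x) :
    curvatureForm₃ (slopeForm p) (slopeForm q) (slopeForm r) x =
      dy (dy p) x + dy (dy q) x + dy (dy r) x := by
  obtain ⟨sp, sq, sr⟩ := hs.self_of_nhds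
  have hΔ0 : (p x - q x) * (q x - r x) * (r x - p x) ≠ 0 :=
    mul_ne_zero (mul_ne_zero (sub_ne_zero.2 hpq) (sub_ne_zero.2 hqr)) (sub_ne_zero.2 hrp)
  have sΔ : ContDiffAt ℝ ∞ (fun y => (p y - q y) * (q y - r y) * (r y - p y)) x :=
    ((sp.sub sq).mul (sq.sub sr)).mul (sr.sub sp)
  have sL : ContDiffAt ℝ ∞ (fun y => -Real.log ((p y - q y) * (q y - r y) * (r y - p y))) x :=
    (sΔ.log hΔ0).neg
  have sσ : ContDiffAt ℝ ∞ (fun y => -(dy p y + dy q y + dy r y)) x :=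
    (((smooth_dy sp).add (smooth_dy sq)).add (smooth_dy sr)).neg
  have w : ∀ a b : Plane → ℝ, wedge (slopeForm a) (slopeForm b) = fun y => b y - a y :=
    fun a b => funext (wedge_slopeForm a b)
  -- The connection form is -(p_y + q_y + r_y) dx - d log |(p - q)(q - r)(r - p)|, as the structure
  -- equations confirm; only the first term contributes to dγ.
  have e : chernForm (mulForm (wedge (slopeForm q) (slopeForm r)) (slopeForm p))
      (mulForm (wedge (slopeForm r) (slopeForm p)) (slopeForm q)) =ᶠ[𝓝 x]
      mkForm (fun y => -(dy p y + dy q y + dy r y)) (fun _ => 0) +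
        dForm (fun y => -Real.log ((p y - q y) * (q y - r y) * (r y - p y))) := by
    filter_upwards [hs, hb, sΔ.continuousAt.eventually_ne hΔ0] with y ⟨kp, kq, kr⟩ hb hΔ
    have h₁ : p y - q y ≠ 0 := left_ne_zero_of_mul (left_ne_zero_of_mul hΔ)
    have h₂ : q y - r y ≠ 0 := right_ne_zero_of_mul (left_ne_zero_of_mul hΔ)
    have h₃ : r y - p y ≠ 0 := right_ne_zero_of_mul hΔ
    have gp := HasGrad.of_smooth kp
    have gq := HasGrad.of_smooth kq
    have gr := HasGrad.of_smooth kr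
    have bp : dx p y = -(p y * dy p y) := eq_neg_of_add_eq_zero_left hb.1
    have bq : dx q y = -(q y * dy q y) := eq_neg_of_add_eq_zero_left hb.2.1
    have br : dx r y = -(r y * dy r y) := eq_neg_of_add_eq_zero_left hb.2.2
    have gL := ((((gp.sub gq).mul (gq.sub gr)).mul (gr.sub gp)).comp_hasDerivAt
      (Real.hasDerivAt_log hΔ)).neg
    have ex := cx_add (mkForm (fun y => -(dy p y + dy q y + dy r y)) (fun _ => 0))
      (dForm (fun y => -Real.log ((p y - q y) * (q y - r y) * (r y - p y)))) y
    have ey := cy_add (mkForm (fun y => -(dy p y + dy q y + dy r y)) (fun _ => 0))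
      (dForm (fun y => -Real.log ((p y - q y) * (q y - r y) * (r y - p y)))) y
    rw [cx_mkForm, cx_dForm, gL.dx_eq, bp, bq, br] at ex
    rw [cy_mkForm, cy_dForm, gL.dy_eq] at ey
    refine (chernForm_unique ?_ ?_ ?_).symm
    · rw [wedge_mulForm, w, w, w]
      convert neg_ne_zero.2 hΔ using 1
      ring
    · rw [w]
      refine extD_normalized_slopeForm kp (kr.sub kq) ex ey ?_
      rw [(gr.sub gq).dx_eq, (gr.sub gq).dy_eq, bq, br]
      field_simp
      ring
    · rw [w]
      refine extD_normalized_slopeForm kq (kp.sub kr) ex ey ?_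
      rw [(gp.sub gr).dx_eq, (gp.sub gr).dy_eq, bp, br]
      field_simp
      ring
  have sm : ContDiffAt ℝ ∞ (mkForm (fun y => -(dy p y + dy q y + dy r y)) (fun _ => 0)) x :=
    smooth_mkForm sσ contDiffAt_const
  have sd : ContDiffAt ℝ ∞
      (dForm (fun y => -Real.log ((p y - q y) * (q y - r y) * (r y - p y)))) x :=
    smooth_mkForm (smooth_dx sL) (smooth_dy sL)
  have g := ((((HasGrad.of_smooth (smooth_dy sp)).add (.of_smooth (smooth_dy sq))).add
    (.of_smooth (smooth_dy sr))).neg)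
  rw [curvatureForm₃, extD_congr e, extD_add (sm.differentiableAt (by simp))
    (sd.differentiableAt (by simp)), extD_dForm sL,
    extD_of_hasGrad (by rw [cx_mkForm]; exact g) (by rw [cy_mkForm]; exact .const 0)]
  ring

end LinearThreeWeb

/-- A closed form `u dx` has a primitive. -/
theorem exists_primitive {u : Plane → ℝ} {p : Plane} (hu : ∀ᶠ x in 𝓝 p, ContDiffAt ℝ ∞ u x)
    (h : ∀ᶠ x in 𝓝 p, dy u x = 0) :
    ∃ M : Plane → ℝ, ∀ᶠ x in 𝓝 p, ContDiffAt ℝ ∞ M x ∧ HasGrad M (u x) 0 x := by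
  obtain ⟨r, hr, hball⟩ := Metric.eventually_nhds_iff_ball.1 (hu.and h)
  -- In the sup metric the ball is a square, so its horizontal and vertical sections through any of
  -- its points are intervals.
  have hmem : ∀ x : Plane, x ∈ Metric.ball p r ↔
      x.1 ∈ Metric.ball p.1 r ∧ x.2 ∈ Metric.ball p.2 r := fun x => by
    rw [← ball_prod_same]; exact Iff.rfl
  have hsec : ∀ a ∈ Metric.ball p.1 r, (a, p.2) ∈ Metric.ball p r := fun a ha =>
    (hmem _).2 ⟨ha, Metric.mem_ball_self hr⟩
  have hα : ∀ a ∈ Metric.ball p.1 r, ContDiffAt ℝ ∞ (fun t => u (t, p.2)) a := fun a ha =>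
    (hball _ (hsec a ha)).1.comp a (contDiffAt_id.prodMk contDiffAt_const)
  have hαc : ContinuousOn (fun t => u (t, p.2)) (Metric.ball p.1 r) := fun a ha =>
    (hα a ha).continuousAt.continuousWithinAt
  have hd : ∀ a ∈ Metric.ball p.1 r,
      HasDerivAt (fun b => ∫ t in p.1..b, u (t, p.2)) (u (a, p.2)) a := by
    intro a ha
    refine intervalIntegral.integral_hasDerivAt_right ?_
      (hαc.stronglyMeasurableAtFilter Metric.isOpen_ball a ha) (hα a ha).continuousAt
    exact (hαc.mono ((convex_ball p.1 r).ordConnected.uIcc_subset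
      (Metric.mem_ball_self hr) ha)).intervalIntegrable
  have hs : ContDiffOn ℝ ∞ (fun b => ∫ t in p.1..b, u (t, p.2)) (Metric.ball p.1 r) := by
    rw [contDiffOn_infty_iff_deriv_of_isOpen Metric.isOpen_ball]
    refine ⟨fun a ha => (hd a ha).differentiableAt.differentiableWithinAt, ?_⟩
    refine ContDiffOn.congr (f := fun t => u (t, p.2)) ?_ fun a ha => (hd a ha).deriv
    exact fun a ha => (hα a ha).contDiffWithinAt
  -- Since ∂_y u = 0 on the square, integrating `u` along the horizontal line through `p` suffices.
  have hconst : ∀ x ∈ Metric.ball p r, u (x.1, p.2) = u x := by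
    intro x hx
    have hx' := (hmem x).1 hx
    have key := (convex_ball p.2 r).norm_image_sub_le_of_norm_hasDerivWithin_le (C := 0)
      (f := fun b => u (x.1, b)) (f' := fun _ => 0) (fun b hb => ?_) (by simp)
      hx'.2 (Metric.mem_ball_self hr)
    · simpa [sub_eq_zero] using key
    · have hb' := hball (x.1, b) ((hmem _).2 ⟨hx'.1, hb⟩)
      have e : ∀ c : ℝ, ((x.1, 0) : Plane) + c • ((0, 1) : Plane) = (x.1, c) := fun c => by
        simp
      have g := HasGrad.of_smooth hb'.1
      rw [hb'.2, ← e b] at g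
      have := g.hasDerivAt_line
      simp only [e] at this
      simpa using this.hasDerivWithinAt
  refine ⟨fun x => ∫ t in p.1..x.1, u (t, p.2),
    Metric.eventually_nhds_iff_ball.2 ⟨r, hr, fun x hx => ⟨?_, ?_⟩⟩⟩
  · exact (hs.contDiffAt (Metric.isOpen_ball.mem_nhds ((hmem x).1 hx).1)).comp x contDiffAt_fst
  · have := HasGrad.comp_hasDerivAt (hd x.1 ((hmem x).1 hx).1) HasGrad.fst
    rw [hconst x hx] at this
    simpa using this

end PlanarWeb

/-! ### Rank and curvature of webs of straight lines. -/

namespace FourWeb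

open PlanarWeb

namespace HasSlopes

variable {S : FourWeb} {s : Fin 4 → Plane → ℝ} {x p : Plane} {l : Plane → Fin 4 → ℝ}

theorem burgers_eq_zero (h : S.HasSlopes s) (hlin : S.IsLinear) (hx : x ∈ S.U) (i : Fin 4) :
    burgers (s i) x = 0 := by
  have := hlin.bend_eq_zero i hx
  rw [h i, bend_slopeForm ((h.smooth hx i).differentiableAt (by simp)), neg_eq_zero] at this
  exact this

/-- Each slope belongs to three of the four 3-subwebs, whence the factor 3/4. -/
theorem curvatureForm_eq (h : S.HasSlopes s) (hlin : S.IsLinear) (hx : x ∈ S.U) :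
    S.curvatureForm x = 3 / 4 * dy (dy (slopeSum s)) x := by
  have hU : ∀ᶠ y in 𝓝 x, y ∈ S.U := S.isOpen_U.mem_nhds hx
  have key : ∀ i j k : Fin 4, i ≠ j → j ≠ k → k ≠ i →
      curvatureForm₃ (S.form i) (S.form j) (S.form k) x =
        dy (dy (s i)) x + dy (dy (s j)) x + dy (dy (s k)) x := by
    intro i j k hij hjk hki
    rw [h i, h j, h k]
    refine curvatureForm₃_slopeForm ?_ ?_ (fun e => hij (h.injective hx e))
      (fun e => hjk (h.injective hx e)) (fun e => hki (h.injective hx e))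
    · filter_upwards [hU] with y hy using ⟨h.smooth hy i, h.smooth hy j, h.smooth hy k⟩
    · filter_upwards [hU] with y hy using ⟨h.burgers_eq_zero hlin hy i,
        h.burgers_eq_zero hlin hy j, h.burgers_eq_zero hlin hy k⟩
  have e : dy (slopeSum s) =ᶠ[𝓝 x] fun y => ∑ i, dy (s i) y := by
    filter_upwards [hU] with y hy
    exact (HasGrad.sum Finset.univ fun i _ => HasGrad.of_smooth (h.smooth hy i)).dy_eq
  rw [dy_congr e, (HasGrad.sum Finset.univ fun i _ =>
    HasGrad.of_smooth (smooth_dy (h.smooth hx i))).dy_eq, Fin.sum_univ_four, curvatureForm,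
    key 0 1 2 (by decide) (by decide) (by decide), key 0 1 3 (by decide) (by decide) (by decide),
    key 0 2 3 (by decide) (by decide) (by decide), key 1 2 3 (by decide) (by decide) (by decide)]
  ring

/-- An integrability condition for abelian relations of a web of straight lines. -/
theorem dy_dy_slopeSum_eq_zero_of_relation (h : S.HasSlopes s) (hlin : S.IsLinear) (hx : x ∈ S.U)
    (hl : ∀ᶠ y in 𝓝 x, S.AbelianEqAt l y) (hf : moment s 2 l x = 0) (hg : moment s 3 l x = 0)
    (hh : dx (moment s 2 l) x ≠ 0) : dy (dy (slopeSum s)) x = 0 := by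
  have hU : ∀ᶠ y in 𝓝 x, y ∈ S.U := S.isOpen_U.mem_nhds hx
  have hll := eventually_eventually_nhds.2 hl
  set f := moment s 2 l
  set g := moment s 3 l
  set σ := slopeSum s
  set τ := slopeE₂ s
  have hsm : ∀ᶠ y in 𝓝 x, ContDiffAt ℝ ∞ f y ∧ ContDiffAt ℝ ∞ g y ∧ ContDiffAt ℝ ∞ σ y ∧
      ContDiffAt ℝ ∞ τ y := by
    filter_upwards [hU, hl] with y hy hly
    exact ⟨smooth_moment (h.smooth hy) hly.1 2, smooth_moment (h.smooth hy) hly.1 3,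
      h.smooth_slopeSum hy, h.smooth_slopeE₂ hy⟩
  have h₁ : ∀ᶠ y in 𝓝 x, dy f y = 0 := by
    filter_upwards [hU, hll] with y hy hly
    rw [h.dy_moment_two hy hly]
    simp [h.burgers_eq_zero hlin hy]
  have h₂ : ∀ᶠ y in 𝓝 x, dy g y = -dx f y := by
    filter_upwards [hU, hll] with y hy hly
    have := h.dx_moment_two_add hy hly
    simp only [h.burgers_eq_zero hlin hy, mul_zero, Finset.sum_const_zero] at this
    linarith
  have h₃ : ∀ᶠ y in 𝓝 x, dx g y = σ y * dx f y - dy σ y * g y + dy τ y * f y := by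
    filter_upwards [hU, hll, hsm, h₁, h₂] with y hy hly ⟨sf, sg, sσ, sτ⟩ e₁ e₂
    have := h.dx_moment_three_add hy hly
    simp only [h.burgers_eq_zero hlin hy, mul_zero, Finset.sum_const_zero] at this
    rw [(((HasGrad.of_smooth sσ).mul (.of_smooth sg)).sub
      ((HasGrad.of_smooth sτ).mul (.of_smooth sf))).dy_eq, e₁, e₂] at this
    linear_combination this
  have h₄ : ∀ᶠ y in 𝓝 x, dy (dx f) y = 0 := by
    filter_upwards [hsm, eventually_eventually_nhds.2 h₁] with y ⟨sf, _⟩ e₁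
    rw [dy_dx sf, dx_congr e₁, (HasGrad.const 0).dx_eq]
  have h₅ : ∀ᶠ y in 𝓝 x, dx (dx f) y =
      dy (dy σ) y * g y - 2 * (dy σ y * dx f y) - dy (dy τ) y * f y := by
    filter_upwards [hsm, h₁, h₂, h₄, eventually_eventually_nhds.2 h₂,
      eventually_eventually_nhds.2 h₃] with y ⟨sf, sg, sσ, sτ⟩ e₁ e₂ e₄ e₅ e₆
    have gh := HasGrad.of_smooth (smooth_dx sf)
    have key := dy_dx sg
    rw [dy_congr e₆, dx_congr e₅, gh.neg.dx_eq, ((((HasGrad.of_smooth sσ).mul gh).sub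
      ((HasGrad.of_smooth (smooth_dy sσ)).mul (.of_smooth sg))).add
      ((HasGrad.of_smooth (smooth_dy sτ)).mul (.of_smooth sf))).dy_eq, e₁, e₂, e₄] at key
    linear_combination key
  obtain ⟨sf, sg, sσ, sτ⟩ := hsm.self_of_nhds
  -- The mixed derivatives of fₓ must agree. As f_xy = 0 and f_xx = σ_yy g - 2σ_y fₓ - τ_yy f with
  -- g_y = -fₓ, at a point with f = g = 0 this reads -3 σ_yy fₓ = 0.
  have key := dy_dx (smooth_dx sf)
  rw [dy_congr h₅, dx_congr h₄, (HasGrad.const 0).dx_eq,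
    ((((HasGrad.of_smooth (smooth_dy (smooth_dy sσ))).mul (.of_smooth sg)).sub
      ((HasGrad.const 2).mul ((HasGrad.of_smooth (smooth_dy sσ)).mul
        (.of_smooth (smooth_dx sf))))).sub
      ((HasGrad.of_smooth (smooth_dy (smooth_dy sτ))).mul (.of_smooth sf))).dy_eq,
    h₁.self_of_nhds, h₂.self_of_nhds, h₄.self_of_nhds, hf, hg] at key
  refine (mul_eq_zero.1 (?_ : dy (dy σ) x * dx f x = 0)).resolve_right hh
  linear_combination (-1 / 3) * key

/-- Near a point of rank three, the rank is three. -/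
theorem eventually_exists_relation (h : S.HasSlopes s) (hp : p ∈ S.U) (h3 : S.rank p hp = 3) :
    ∀ᶠ x in 𝓝 p, ∀ c : Fin 3 → ℝ, ∃ l, (∀ᶠ y in 𝓝 x, S.AbelianEqAt l y) ∧ jet s l x = c := by
  choose l hl hjet using fun k : Fin 3 => (h.rank_eq_three_iff hp).1 h3 (Pi.single k 1)
  -- The matrix of jets of the three basic relations is the identity at `p`, hence invertible
  -- nearby; their combinations realize every jet there.
  let M : Plane → Matrix (Fin 3) (Fin 3) ℝ := fun x => Matrix.of fun k j => jet s (l k) x j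
  have hM : ContinuousAt (fun x => (M x).det) p := by
    have hdet : Continuous fun A : Matrix (Fin 3) (Fin 3) ℝ => A.det := continuous_id.matrix_det
    refine hdet.continuousAt.comp (f := M)
      (continuousAt_pi.2 fun k => continuousAt_pi.2 fun j => ?_)
    have s₂ := smooth_moment (h.smooth hp) (hl k).self_of_nhds.1 2
    have s₃ := smooth_moment (h.smooth hp) (hl k).self_of_nhds.1 3
    fin_cases j
    exacts [s₂.continuousAt, s₃.continuousAt, (smooth_dx s₂).continuousAt]
  have hMp : (M p).det ≠ 0 := by
    have : M p = 1 := by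
      ext k j
      simp [M, hjet, Matrix.one_apply, Pi.single_apply, eq_comm]
    rw [this, Matrix.det_one]
    exact one_ne_zero
  filter_upwards [S.isOpen_U.mem_nhds hp, Filter.eventually_all.2 fun k =>
    eventually_eventually_nhds.2 (hl k), hM.eventually_ne hMp] with x hx hlx hdet c
  obtain ⟨a, ha⟩ := (Matrix.vecMul_surjective_iff_isUnit.2
    ((Matrix.isUnit_iff_isUnit_det _).2 hdet.isUnit)) c
  refine ⟨a 0 • l 0 + a 1 • l 1 + a 2 • l 2, ?_, ?_⟩
  · filter_upwards [S.isOpen_U.mem_nhds hx, hlx 0, hlx 1, hlx 2] with y hy k₀ k₁ k₂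
    exact S.abelianEqAt_add hy (S.abelianEqAt_add hy (S.abelianEqAt_smul hy _ k₀)
      (S.abelianEqAt_smul hy _ k₁)) (S.abelianEqAt_smul hy _ k₂)
  · have sm := fun k => (hlx k).self_of_nhds.1
    have sa : ∀ k, ContDiffAt ℝ ∞ (a k • l k) x := fun k => (sm k).const_smul (a k)
    have sb : ContDiffAt ℝ ∞ (a 0 • l 0 + a 1 • l 1) x := (sa 0).add (sa 1)
    rw [h.jet_add hx sb (sa 2), h.jet_add hx (sa 0) (sa 1),
      h.jet_smul hx _ (sm 0), h.jet_smul hx _ (sm 1), h.jet_smul hx _ (sm 2), ← ha]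
    ext j
    simp [Matrix.vecMul, dotProduct, Fin.sum_univ_three, M]

/-- At each nearby point the integrability condition is tested on a relation with jet (0, 0, 1)
there. -/
theorem eventually_dy_dy_slopeSum_eq_zero (h : S.HasSlopes s) (hlin : S.IsLinear) (hp : p ∈ S.U)
    (h3 : S.rank p hp = 3) : ∀ᶠ x in 𝓝 p, dy (dy (slopeSum s)) x = 0 := by
  filter_upwards [S.isOpen_U.mem_nhds hp, h.eventually_exists_relation hp h3] with x hx hex
  obtain ⟨l, hl, hj⟩ := hex ![0, 0, 1]
  exact h.dy_dy_slopeSum_eq_zero_of_relation hlin hx hl (congrFun hj 0) (congrFun hj 1)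
    (ne_of_eq_of_ne (congrFun hj 2) one_ne_zero)

/-- Here 2τ = σ² - Σ sᵢ², and straightness turns -sᵢ ∂_y sᵢ into ∂ₓsᵢ. -/
theorem dy_slopeE₂ (h : S.HasSlopes s) (hlin : S.IsLinear) (hx : x ∈ S.U) :
    dy (slopeE₂ s) x = dx (slopeSum s) x + slopeSum s x * dy (slopeSum s) x := by
  have g := fun i => HasGrad.of_smooth (h.smooth hx i)
  have gσ := HasGrad.sum Finset.univ fun i _ => g i
  have gτ := ((((((g 0).mul (g 1)).add ((g 0).mul (g 2))).add ((g 0).mul (g 3))).add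
    ((g 1).mul (g 2))).add ((g 1).mul (g 3))).add ((g 2).mul (g 3))
  have e₁ : dy (slopeE₂ s) x = _ := gτ.dy_eq
  have e₂ : dy (slopeSum s) x = _ := gσ.dy_eq
  have e₃ : dx (slopeSum s) x = _ := gσ.dx_eq
  have b := h.burgers_eq_zero hlin hx
  simp only [burgers] at b
  rw [e₁, e₂, e₃, slopeSum]
  simp only [Fin.sum_univ_four]
  linear_combination -(b 0) - b 1 - b 2 - b 3

/-- Functions that satisfy the moment equations are the moments of an abelian relation. -/
theorem abelianEqAt_of_moments (h : S.HasSlopes s) (hlin : S.IsLinear) {f g : Plane → ℝ}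
    (hx : x ∈ S.U) (sf : ContDiffAt ℝ ∞ f x) (sg : ContDiffAt ℝ ∞ g x) (h₁ : dy f x = 0)
    (h₂ : dx f x + dy g x = 0)
    (h₃ : dx g x + dy (fun y => slopeSum s y * g y - slopeE₂ s y * f y) x = 0) :
    S.AbelianEqAt (fun y i => lagrangeA (fun j => s j y) i * f y +
      lagrangeB (fun j => s j y) i * g y) x := by
  set l : Plane → Fin 4 → ℝ := fun y i => lagrangeA (fun j => s j y) i * f y +
      lagrangeB (fun j => s j y) i * g y with hl
  have hU : ∀ᶠ y in 𝓝 x, y ∈ S.U := S.isOpen_U.mem_nhds hx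
  have sl : ContDiffAt ℝ ∞ l x := contDiffAt_pi.2 fun i =>
    ((h.smooth_lagrangeA hx i).mul sf).add ((h.smooth_lagrangeB hx i).mul sg)
  have m₀ : moment s 0 l =ᶠ[𝓝 x] fun _ => 0 := by
    filter_upwards [hU] with y hy
    simpa [moment] using (lagrange_moments (h.injective hy) (f y) (g y)).1
  have m₁ : moment s 1 l =ᶠ[𝓝 x] fun _ => 0 := by
    filter_upwards [hU] with y hy
    simpa [moment] using (lagrange_moments (h.injective hy) (f y) (g y)).2.1
  have m₂ : moment s 2 l =ᶠ[𝓝 x] f := by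
    filter_upwards [hU] with y hy
    exact (lagrange_moments (h.injective hy) (f y) (g y)).2.2.1
  have m₃ : moment s 3 l =ᶠ[𝓝 x] g := by
    filter_upwards [hU] with y hy
    exact (lagrange_moments (h.injective hy) (f y) (g y)).2.2.2
  have m₄ : moment s 4 l =ᶠ[𝓝 x] fun y => slopeSum s y * g y - slopeE₂ s y * f y := by
    filter_upwards [m₀, m₁, m₂, m₃] with y e₀ e₁ e₂ e₃
    rw [moment_four e₀ e₁, e₂, e₃]
    rfl
  -- The defects of closedness have vanishing moments of orders 0 to 3; as the slopes are distinct,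
  -- the defects vanish.
  have tr : ∀ k, ∑ i, closedness (s i) (fun y => l y i) x * s i x ^ k =
      dx (moment s k l) x + dy (moment s (k + 1) l) x := by
    intro k
    rw [moment_transport (h.smooth hx) sl]
    simp [h.burgers_eq_zero hlin hx]
  have z : HasGrad (fun _ => (0 : ℝ)) 0 0 x := .const 0
  have t₀ : ∑ i, closedness (s i) (fun y => l y i) x = 0 := by
    have := tr 0
    rw [dx_congr m₀, dy_congr m₁, z.dx_eq, z.dy_eq] at this
    simpa using this
  have t₁ : ∑ i, closedness (s i) (fun y => l y i) x * s i x = 0 := by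
    have := tr 1
    rw [dx_congr m₁, dy_congr m₂, z.dx_eq, h₁] at this
    simpa using this
  have t₂ : ∑ i, closedness (s i) (fun y => l y i) x * s i x ^ 2 = 0 := by
    rw [tr 2, dx_congr m₂, dy_congr m₃, h₂]
  have t₃ : ∑ i, closedness (s i) (fun y => l y i) x * s i x ^ 3 = 0 := by
    rw [tr 3, dx_congr m₃, dy_congr m₄, h₃]
  refine (h.abelianEqAt_iff hx).2 ⟨sl, m₀.self_of_nhds, m₁.self_of_nhds, fun i => ?_⟩
  rw [lagrange_formula (l := fun i => closedness (s i) (fun y => l y i) x) (h.injective hx) t₀ t₁ i,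
    t₂, t₃]
  ring

/-- A web of straight lines whose slopes have a sum that is affine in `y` has rank three. -/
theorem rank_eq_three (h : S.HasSlopes s) (hlin : S.IsLinear) (hp : p ∈ S.U)
    (hσ : ∀ᶠ x in 𝓝 p, dy (dy (slopeSum s)) x = 0) : S.rank p hp = 3 := by
  have hU : ∀ᶠ y in 𝓝 p, y ∈ S.U := S.isOpen_U.mem_nhds hp
  obtain ⟨M, hM⟩ := exists_primitive (hU.mono fun x hx => smooth_dy (h.smooth_slopeSum hx)) hσ
  rw [h.rank_eq_three_iff hp]
  intro c
  -- Integrating factor: M is a primitive of σ_y dx. With f = μF and F affine in x, the equation g_y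
  -- = -fₓ integrates to the `g` below.
  set μ : Plane → ℝ := fun x => Real.exp (-M x) with hμ
  have gμ : ∀ x, HasGrad M (dy (slopeSum s) x) 0 x →
      HasGrad μ (-(dy (slopeSum s) x * μ x)) 0 x := fun x g =>
    ((g.neg).comp_hasDerivAt (Real.hasDerivAt_exp _)).congr_grad (by ring) (by ring)
  have hμ0 : μ p ≠ 0 := (Real.exp_pos _).ne'
  -- The three constants solve f(p) = c₀, fₓ(p) = c₂ and g(p) = c₁.
  set k₀ := c 0 / μ p with hk₀
  set k₁ := c 2 / μ p + dy (slopeSum s) p * k₀ with hk₁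
  set k₂ := c 1 / μ p - slopeSum s p * k₀ + k₁ * p.2 with hk₂
  set F : Plane → ℝ := fun x => k₀ + k₁ * (x.1 - p.1) with hF
  set f : Plane → ℝ := fun x => μ x * F x with hf
  set g : Plane → ℝ := fun x => μ x * (slopeSum s x * F x - k₁ * x.2 + k₂) with hg
  have gF : ∀ x, HasGrad F k₁ 0 x := fun x =>
    ((HasGrad.const k₀).add ((HasGrad.const k₁).mul (HasGrad.fst.sub (.const p.1)))).congr_grad
      (by ring) (by ring)
  have gf : ∀ x, HasGrad M (dy (slopeSum s) x) 0 x →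
      HasGrad f (μ x * (k₁ - dy (slopeSum s) x * F x)) 0 x := fun x hx =>
    ((gμ x hx).mul (gF x)).congr_grad (by ring) (by ring)
  have gg : ∀ x ∈ S.U, HasGrad M (dy (slopeSum s) x) 0 x → HasGrad g
      (-(dy (slopeSum s) x) * g x + μ x * (dx (slopeSum s) x * F x + slopeSum s x * k₁))
      (μ x * (dy (slopeSum s) x * F x - k₁)) x := fun x hxU hx =>
    ((gμ x hx).mul ((((HasGrad.of_smooth (h.smooth_slopeSum hxU)).mul (gF x)).sub
      ((HasGrad.const k₁).mul .snd)).add (.const k₂))).congr_grad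
      (by simp only [hg]; ring) (by ring)
  refine ⟨fun y i => lagrangeA (fun j => s j y) i * f y + lagrangeB (fun j => s j y) i * g y,
    ?_, ?_⟩
  · filter_upwards [hU, hM] with x hxU ⟨sM, hx⟩
    have sμ : ContDiffAt ℝ ∞ μ x := sM.neg.exp
    have sF : ContDiffAt ℝ ∞ F x :=
      contDiffAt_const.add (contDiffAt_const.mul (contDiffAt_fst.sub contDiffAt_const))
    have sg : ContDiffAt ℝ ∞ g x := sμ.mul ((((h.smooth_slopeSum hxU).mul sF).sub
      (contDiffAt_const.mul contDiffAt_snd)).add contDiffAt_const)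
    refine h.abelianEqAt_of_moments hlin hxU (sμ.mul sF) sg (gf x hx).dy_eq ?_ ?_
    · rw [(gf x hx).dx_eq, (gg x hxU hx).dy_eq]
      ring
    · rw [(gg x hxU hx).dx_eq, (((HasGrad.of_smooth (h.smooth_slopeSum hxU)).mul
        (gg x hxU hx)).sub ((HasGrad.of_smooth (h.smooth_slopeE₂ hxU)).mul (gf x hx))).dy_eq,
        h.dy_slopeE₂ hlin hxU]
      simp only [hf, hg]
      ring
  · have m := fun x (hx : x ∈ S.U) => lagrange_moments (h.injective hx) (f x) (g x)
    have m₂ : moment s 2 (fun y i => lagrangeA (fun j => s j y) i * f y +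
        lagrangeB (fun j => s j y) i * g y) =ᶠ[𝓝 p] f := by
      filter_upwards [hU] with x hx using (m x hx).2.2.1
    have hFp : F p = k₀ := by simp [hF]
    ext j
    fin_cases j
    · refine m₂.self_of_nhds.trans ?_
      change f p = c 0
      simp only [hf, hFp, hk₀]
      exact mul_div_cancel₀ _ hμ0
    · refine (m p hp).2.2.2.trans ?_
      change g p = c 1
      simp only [hg, hFp, hk₂]
      field_simp
      ring
    · change dx (moment s 2 _) p = _
      rw [dx_congr m₂, (gf p hM.self_of_nhds.2).dx_eq, hFp, hk₁]
      change _ = c 2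
      field_simp
      ring

end HasSlopes

end FourWeb

end

/-! ### Transfer to arbitrary webs and conclusion. -/

namespace FourWeb

open PlanarWeb

variable {W : FourWeb} {p : Plane}

/-- For a web of straight lines, maximum rank means vanishing curvature. -/
theorem IsLinear.rank_eq_three_iff (hlin : W.IsLinear) (hp : p ∈ W.U) :
    W.rank p hp = 3 ↔ ∀ᶠ x in 𝓝 p, W.curvatureForm x = 0 := by
  obtain ⟨S, s, φ, hS, hpφ, hφ, hSlin⟩ := W.exists_slopes hp
  replace hS : S.HasSlopes s := hS
  have hlin' := hSlin hlin
  have hq := hφ.target_subset (φ.map_source hpφ)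
  have key : S.rank (φ p) hq = 3 ↔ ∀ᶠ x in 𝓝 (φ p), S.curvatureForm x = 0 := by
    have hU := S.isOpen_U.mem_nhds hq
    constructor
    · intro h3
      filter_upwards [hU, hS.eventually_dy_dy_slopeSum_eq_zero hlin' hq h3] with x hx h0
      rw [hS.curvatureForm_eq hlin' hx, h0, mul_zero]
    · intro h0
      refine hS.rank_eq_three hlin' hq ?_
      filter_upwards [hU, h0] with x hx e
      rw [hS.curvatureForm_eq hlin' hx] at e
      linarith
  rw [hφ.rank_eq hpφ, key]
  refine ⟨hφ.eventually_curvatureForm_eq_zero hpφ, fun h0 => ?_⟩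
  refine hφ.symm.eventually_curvatureForm_eq_zero (φ.map_source hpφ) ?_
  rwa [φ.left_inv hpφ]

theorem isLinearizableAt_of_rank (hp : p ∈ W.U) (h3 : W.rank p hp = 3) :
    W.IsLinearizableAt p := by
  obtain ⟨S, s, φ, hS, hpφ, hφ, -⟩ := W.exists_slopes hp
  replace hS : S.HasSlopes s := hS
  rw [hφ.rank_eq hpφ] at h3
  obtain ⟨W', hlin, hequiv⟩ := hS.isLinearizableAt_of_rank _ h3
  obtain ⟨ψ, hψ, hψe⟩ := isEquivalentAt_iff.1 hequiv
  exact ⟨W', hlin, isEquivalentAt_iff.2 ⟨φ.trans ψ, ⟨hpφ, hψ⟩, hφ.trans hψe⟩⟩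

/-- A linearizable web has maximum rank if and only if its curvature vanishes. -/
theorem IsLinearizableAt.rank_eq_three_iff (h : W.IsLinearizableAt p) (hp : p ∈ W.U) :
    W.rank p hp = 3 ↔ ∀ᶠ x in 𝓝 p, W.curvatureForm x = 0 := by
  obtain ⟨W', hlin, hequiv⟩ := h
  obtain ⟨φ, hpφ, hφ⟩ := isEquivalentAt_iff.1 hequiv
  rw [hφ.rank_eq hpφ, hlin.rank_eq_three_iff]
  refine ⟨hφ.eventually_curvatureForm_eq_zero hpφ, fun h0 => ?_⟩
  refine hφ.symm.eventually_curvatureForm_eq_zero (φ.map_source hpφ) ?_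
  rwa [φ.left_inv hpφ]

end FourWeb

theorem theorem3 (W : FourWeb) :
    (∀ (p : PlanarWeb.Plane) (hp : p ∈ W.U),
      W.rank p hp = 3 ↔ W.IsLinearizableAt p ∧ ∀ᶠ x in 𝓝 p, W.curvatureForm x = 0) ∧
    (∀ (V : Set PlanarWeb.Plane) (η : Fin 4 → PlanarWeb.OneForm) (a : PlanarWeb.Plane → ℝ),
      W.IsNormalization V η a → ∀ x ∈ V,
        W.curvatureFunction η x = PlanarWeb.c₀ (η 0) (η 1) a x) := by
  refine ⟨fun p hp => ⟨fun h3 => ?_, fun h => (h.1.rank_eq_three_iff hp).2 h.2⟩,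
    fun V η a h x hx => h.curvatureFunction_eq hx⟩
  have hl := FourWeb.isLinearizableAt_of_rank hp h3
  exact ⟨hl, (hl.rank_eq_three_iff hp).1 h3⟩
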